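/- For integers $a_0,\dots,a_{d-1}$ with $d\ge 1$ put $f(x)=x^d+a_{d-1}x^{d-1}+\dots+a_1x+a_0\in\mathbb Z[x]$. Let $a_0,\dots,a_{d-1}$ be random integers distributed in one of the following three ways. Here $H$ is a positive integer, with $H\ge 3$ in (1) and (3). The phrase "$a_0$ is uniformly distributed over the values $P(n)$, $n\in[-H,H]$" may be read in either of two ways: $a_0$ is uniform on the set $\{P(n): n\in\mathbb Z,\ -H\le n\le H\}$, or $a_0$ has the law of $P(n)$ with $n$ uniform on the integers in $[-H,H]$. The statement holds for both. (1) Sparse coefficients. For every nonzero $P\in\mathbb Z[x]$ there is a constant $C(P)$, depending only on $P$, such that for all $d\ge 1$ and $H\ge 3$: if $a_0$ is uniformly distributed over the values $P(n)$, $n\in[-H,H]$, each $a_j$ with $1\le j\le d-1$ is uniformly distributed over an arbitrary set of $H$ integers (which may depend on $j$), and $a_0,\dots,a_{d-1}$ are independent, then $$\mathbb P(f\text{ is irreducible over }\mathbb Z)\ \ge\ 1-\frac{\deg P}{2H+1}-\frac{2d\,2^d(\log H)^{C(P)}}{H}.$$ (2) Binomial coefficients. Fix $d\ge 1$. If $a_0,\dots,a_{d-1}$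 are independent, each with the binomial distribution $B(H,p)$, $0\le p\le 1$, then $$\mathbb P(f\text{ is irreducible over }\mathbb Z)\ \ge\ 1-o(1)\qquad\text{as }\min(Hp,H(1-p))\to\infty,$$ that is, the probability is at least $1-\varepsilon_d(\min(Hp,H(1-p)))$ for a function $\varepsilon_d$, depending only on $d$, with $\varepsilon_d(x)\to 0$ as $x\to\infty$. (3) Dependent coefficients. For every nonzero $P\in\mathbb Z[x]$ there is a constant $C(P)$, depending only on $P$, such that for all $d\ge 1$, $H\ge 3$ and $L\ge 0$ the following holds. Let $a_0$ be uniformly distributed over the values $P(n)$, $n\in[-H,H]$. Let $t_1,\dots,t_{d-1}$ be independent of each other and of $a_0$, each $t_i$ uniformly distributed over an arbitrary set of $H$ real numbers (which may depend on $i$). For $1\le i\le d-1$ let $a_i=P_i(a_{i-1},\dots,a_0,t_i)$ almost surely, where $P_i$ is a polynomial with real coefficients of total degree at most $L$ such that, whenever $a_0$ is fixed to be one of its nonzero values $P(n)$, $n\in[-H,H]$, the resulting polynomial in $a_{i-1},\dots,a_1,t_i$ has positive degree in $t_i$; and suppose that the $a_i$ are integers. Then $$\mathbb P(f\text{ is irreducible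 over }\mathbb Z)\ \ge\ 1-\frac{\deg P}{2H+1}-\frac{2d^2(2L)^d(\log H)^{C(P)}}{H}.$$ -/

import Mathlib

open MeasureTheory ProbabilityTheory Polynomial Filter Topology

noncomputable section

/-- The monic integer polynomial `x ^ d + a_{d-1} x ^ (d-1) + ⋯ + a_1 x + a_0`. -/
def monicPoly {d : ℕ} (a : Fin d → ℤ) : ℤ[X] :=
  X ^ d + ∑ i : Fin d, C (a i) * X ^ (i : ℕ)

/-- The probability that the monic polynomial with random coefficients `a_0, …, a_{d-1}` is
irreducible in `ℤ[x]`. -/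
def probIrreducible {Ω : Type*} [MeasurableSpace Ω] (μ : Measure Ω) {d : ℕ}
    (a : Fin d → Ω → ℤ) : ℝ :=
  μ.real {ω | Irreducible (monicPoly fun i => a i ω)}

/-- `Y` is uniformly distributed on the values `P(n)`, `-H ≤ n ≤ H`. Both usual meanings are
admitted: `Y` is uniform on the set of these values, or `Y = P(n)` in law, where `n` is uniform on
the integers of `[-H, H]` (so that values are counted with multiplicity). -/
def IsUniformOnValues {Ω : Type*} [MeasurableSpace Ω] (μ : Measure Ω) (P : ℤ[X]) (H : ℕ)
    (Y : Ω → ℤ) : Prop :=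
  HasLaw Y (uniformOn ((fun n : ℤ => P.eval n) '' Set.Icc (-(H : ℤ)) H)) μ ∨
  HasLaw Y ((uniformOn (Set.Icc (-(H : ℤ)) H)).map fun n : ℤ => P.eval n) μ

/-- The sparse model: `a_0` is uniform on the values of `P` on `[-H, H]`, each other coefficient is
uniform on some set of `H` integers, and the coefficients are independent. -/
structure IsSparseModel {Ω : Type*} [MeasurableSpace Ω] (μ : Measure Ω) (P : ℤ[X]) (H d : ℕ)
    [NeZero d] (a : Fin d → Ω → ℤ) : Prop where
  const_coeff : IsUniformOnValues μ P H (a 0)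
  higher_coeff : ∀ j : Fin d, j ≠ 0 →
    ∃ A : Finset ℤ, A.card = H ∧ HasLaw (a j) (uniformOn (A : Set ℤ)) μ
  indep : iIndepFun a μ

/-- The binomial model: the coefficients are independent with the binomial law `B(H, p)`. -/
structure IsBinomialModel {Ω : Type*} [MeasurableSpace Ω] (μ : Measure Ω) (H : ℕ)
    (p : unitInterval) (d : ℕ) (a : Fin d → Ω → ℤ) : Prop where
  law : ∀ j : Fin d, HasLaw (a j) ((binomial H p).map fun k : ℕ => (k : ℤ)) μ
  indep : iIndepFun a μ

/-- Real polynomials in the variables `a_{i-1}, …, a_0` and `t_i`: the variable `some j` stands for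
`a_j` (where `j < i`), the variable `none` stands for `t_i`. -/
abbrev StepPoly {d : ℕ} (i : Fin d) : Type :=
  MvPolynomial (Option {j : Fin d // j < i}) ℝ

/-- The value `Q(a_{i-1}, …, a_0, t)`. -/
def StepPoly.value {d : ℕ} {i : Fin d} (Q : StepPoly i) (a : Fin d → ℝ) (t : ℝ) : ℝ :=
  MvPolynomial.eval (fun v => v.elim t fun j => a j) Q

/-- The polynomial `Q(a_{i-1}, …, a_1, c, t_i)` obtained from `Q` by fixing `a_0 = c`. -/
def StepPoly.fixConst {d : ℕ} [NeZero d] {i : Fin d} (Q : StepPoly i) (c : ℝ) : StepPoly i :=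
  MvPolynomial.bind₁
    (fun v => v.elim (MvPolynomial.X none) fun j =>
      if (j : Fin d) = 0 then MvPolynomial.C c else MvPolynomial.X (some j)) Q

/-- The dependent model: `a_0` is uniform on the values of `P` on `[-H, H]`; the variables
`t_1, …, t_{d-1}` are independent of each other and of `a_0`, each is uniform on some set of `H`
real numbers; and `a_i = Q_i(a_{i-1}, …, a_0, t_i)` for `1 ≤ i ≤ d - 1`, where `Q_i` is a
polynomial of degree at most `L` that has positive degree in `t_i` once `a_0` is fixed to any of
its nonzero values. -/
structure IsDependentModel {Ω : Type*} [MeasurableSpace Ω] (μ : Measure Ω) (P : ℤ[X])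
    (H L d : ℕ) [NeZero d] (a : Fin d → Ω → ℤ) (t : {i : Fin d // i ≠ 0} → Ω → ℝ)
    (Q : ∀ i : {i : Fin d // i ≠ 0}, StepPoly i.1) : Prop where
  const_coeff : IsUniformOnValues μ P H (a 0)
  law_t : ∀ i, ∃ T : Finset ℝ, T.card = H ∧ HasLaw (t i) (uniformOn (T : Set ℝ)) μ
  indep_t : iIndepFun t μ
  indep_const : IndepFun (a 0) (fun ω i => t i ω) μ
  totalDegree_le : ∀ i, (Q i).totalDegree ≤ L
  degree_pos : ∀ i, ∀ n ∈ Set.Icc (-(H : ℤ)) H, P.eval n ≠ 0 →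
    0 < ((Q i).fixConst (P.eval n : ℤ)).degreeOf none
  coeff_eq : ∀ i : {i : Fin d // i ≠ 0}, ∀ᵐ ω ∂μ, (a i ω : ℝ) = (Q i).value (fun j => (a j ω : ℝ)) (t i ω)

end

/-! A factorisation f = gh splits the complex roots of f into two blocks, and the product of the
roots of g is an integer b dividing a_0.

Dependent coefficients. The event a_0 = 0 costs at most deg P/(2H+1). Fix a_0 = v ≠ 0 and every
other coefficient except s = a_{d-1}. For each k and each b ∣ v, the product over all k-sets of
roots of (product of the set - b) is symmetric in the roots, hence an integer polynomial F(s), and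
it vanishes whenever f has a factor of degree k with root product b. For large s one root has size
about s and all others have modulus at most 1/2. So a proper nonempty set of roots, or its
complement, has product of modulus below 1, whereas b and v/b are nonzero integers; hence F ≠ 0. The
same picture bounds the growth of F and gives deg F ≤ C(d,k) (`exists_poly_vanishing_of_factor`).
Summing over k and b, at most 2^d · 2τ(v) values of s are bad. When s = q(t_{d-1}) with q
nonconstant of degree at most L, a factor L is lost; the parameters for which the leading
coefficient of q vanishes are few by Schwartz–Zippel (`card_reducibleParam_mul_le`). Averaging over
a_0 needs a polylogarithmic mean of τ(P(n)) (`exists_sum_card_divisors_eval_le`). The sparse model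
is the case a_i = t_i, L = 1.

Divisor mean. P is replaced by a separable Q with the same prime content up to constants, and
τ(Q(n)) is bounded by a power of τ(d) for some divisor d ≤ H of Q(n). Exchanging sums leaves the
count of roots of Q modulo d, which is O(τ(d)^{deg Q}), and moments of τ(d)/d type, which are powers
of log H.

Binomial coefficients. With high probability all a_i are close to s = Hp. Put U = 1 + x + ... +
x^{d-1}. Then all roots of f but one have modulus at most 2, and |U| < 1 at each of these. A factor
g of f avoiding the exceptional root has |Res(g, U)| < 1, so the resultant, an integer, is 0 and f
vanishes at a root of U (`irreducible_of_coeff_near`). For each such root this is a relation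
determining a_0 from the other coefficients, and binomial atoms are O(1/√λ) with λ = min(Hp,
H(1-p)). -/

/-! ### Divisor function: submultiplicativity, small divisors, moments -/

theorem card_divisors_mul_le (a b : ℕ) :
    (a * b).divisors.card ≤ a.divisors.card * b.divisors.card := by
  classical
  rw [Nat.divisors_mul]
  exact Finset.card_mul_le

theorem one_le_card_divisors {n : ℕ} (hn : n ≠ 0) : 1 ≤ n.divisors.card :=
  Finset.card_pos.2 ⟨1, by simp [hn]⟩

theorem card_divisors_le_of_dvd {a b : ℕ} (h : a ∣ b) (hb : b ≠ 0) :
    a.divisors.card ≤ b.divisors.card :=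
  Finset.card_le_card (Nat.divisors_subset_of_dvd hb h)

theorem card_divisors_pow_le (a m : ℕ) : (a ^ m).divisors.card ≤ a.divisors.card ^ m := by
  induction m with
  | zero => simp
  | succ m ih =>
    rw [pow_succ, pow_succ]
    exact (card_divisors_mul_le _ _).trans (Nat.mul_le_mul_right _ ih)

/-- Let d be the largest divisor of n not exceeding y and let n = d p q with p prime. Maximality
gives d p > y, so q ≤ y^(k-1) and induction yields a small divisor e of q. Since τ(n) ≤ 2τ(d)τ(q),
whichever of d and e has more divisors serves. -/
theorem exists_small_divisor_card_divisors_le {y : ℕ} (hy : 1 ≤ y) (k : ℕ) :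
    ∀ n : ℕ, n ≠ 0 → n ≤ y ^ k →
      ∃ d, d ∣ n ∧ d ≤ y ∧ n.divisors.card ≤ (2 * d.divisors.card) ^ k := by
  induction k with
  | zero =>
    intro n hn h
    have : n = 1 := by simp at h; omega
    exact ⟨1, by simp, hy, by simp [this]⟩
  | succ k ih =>
    intro n hn h
    obtain ⟨d, hd, hmax⟩ := Finset.exists_max_image (n.divisors.filter (· ≤ y)) id
      ⟨1, by simp [hn, hy]⟩
    simp only [Finset.mem_filter, Nat.mem_divisors, id] at hd hmax
    obtain ⟨⟨hdn, -⟩, hdy⟩ := hd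
    obtain ⟨m, rfl⟩ := hdn
    have hd0 : d ≠ 0 := left_ne_zero_of_mul hn
    have hm0 : m ≠ 0 := right_ne_zero_of_mul hn
    have hdτ := one_le_card_divisors hd0
    rcases eq_or_ne m 1 with rfl | hm1
    · refine ⟨d, by simp, hdy, ?_⟩
      rw [mul_one]
      calc d.divisors.card ≤ 2 * d.divisors.card := by omega
        _ ≤ _ := Nat.le_self_pow (by omega) _
    · obtain ⟨p, hp, q, rfl⟩ := Nat.exists_prime_and_dvd hm1
      have hq0 : q ≠ 0 := right_ne_zero_of_mul hm0
      have hdp : y < d * p := by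
        by_contra! hle
        have := hmax (d * p) ⟨⟨⟨q, by ring⟩, hn⟩, hle⟩
        have h2 := hp.two_le
        have : d * 2 ≤ d * p := Nat.mul_le_mul_left _ h2
        omega
      have hq : q ≤ y ^ k := by
        by_contra! hlt
        have h1 : y * y ^ k < (d * p) * q := Nat.mul_lt_mul'' hdp hlt
        rw [pow_succ'] at h
        have : d * (p * q) = d * p * q := by ring
        omega
      obtain ⟨e, heq, hey, he⟩ := ih q hq0 hq
      have hτp : p.divisors.card = 2 := by
        rw [hp.divisors, Finset.card_pair hp.one_lt.ne]
      have key : (d * (p * q)).divisors.card ≤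
          (2 * d.divisors.card) * (2 * e.divisors.card) ^ k := by
        calc _ ≤ d.divisors.card * (p.divisors.card * q.divisors.card) :=
              (card_divisors_mul_le _ _).trans
                (Nat.mul_le_mul_left _ (card_divisors_mul_le _ _))
          _ = (2 * d.divisors.card) * q.divisors.card := by rw [hτp]; ring
          _ ≤ _ := Nat.mul_le_mul_left _ he
      rcases le_total d.divisors.card e.divisors.card with hle | hle
      · refine ⟨e, (heq.mul_left p).mul_left d, hey, key.trans ?_⟩
        rw [pow_succ']
        gcongr
      · refine ⟨d, by simp, hdy, key.trans ?_⟩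
        rw [pow_succ']
        gcongr

/-- One factor τ(d) counts the factorisations d = uv. For each of them τ(uv)^k ≤ τ(u)^k τ(v)^k, and
u, v ≤ N, so the sum is part of the expanded square. -/
theorem sum_card_divisors_pow_div_succ_le (N k : ℕ) :
    ∑ d ∈ Finset.Icc 1 N, (d.divisors.card : ℝ) ^ (k + 1) / d ≤
      (∑ d ∈ Finset.Icc 1 N, (d.divisors.card : ℝ) ^ k / d) ^ 2 := by
  rw [sq, Finset.sum_mul_sum, ← Finset.sum_product']
  set g : ℕ × ℕ → ℝ := fun x => (x.1.divisors.card : ℝ) ^ k / x.1 *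
    ((x.2.divisors.card : ℝ) ^ k / x.2) with hg
  calc _ ≤ ∑ d ∈ Finset.Icc 1 N, ∑ x ∈ d.divisorsAntidiagonal, g x := by
        refine Finset.sum_le_sum fun d hd => ?_
        have hcard : (d.divisors.card : ℝ) = d.divisorsAntidiagonal.card := by
          rw [← Nat.map_div_right_divisors, Finset.card_map]
        rw [pow_succ', mul_div_assoc]
        nth_rewrite 1 [hcard]
        rw [← nsmul_eq_mul]
        refine Finset.card_nsmul_le_sum _ _ _ fun x hx => ?_
        rw [Nat.mem_divisorsAntidiagonal] at hx
        rw [hg, ← hx.1]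
        simp only [Nat.cast_mul]
        rw [div_mul_div_comm, ← mul_pow]
        gcongr
        exact_mod_cast card_divisors_mul_le _ _
    _ = ∑ x ∈ (Finset.Icc 1 N).biUnion Nat.divisorsAntidiagonal, g x := by
        rw [Finset.sum_biUnion]
        intro a _ b _ hab
        rw [Function.onFun, Finset.disjoint_left]
        intro x hx hx'
        rw [Nat.mem_divisorsAntidiagonal] at hx hx'
        exact hab (hx.1.symm.trans hx'.1)
    _ ≤ _ := by
        refine Finset.sum_le_sum_of_subset_of_nonneg ?_ fun x _ _ => by positivity
        intro x hx
        simp only [Finset.mem_biUnion, Finset.mem_Icc, Nat.mem_divisorsAntidiagonal] at hx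
        obtain ⟨d, ⟨h1, h2⟩, rfl, h3⟩ := hx
        simp only [Finset.mem_product, Finset.mem_Icc]
        have ha : 0 < x.1 := Nat.pos_of_ne_zero (left_ne_zero_of_mul h3)
        have hb : 0 < x.2 := Nat.pos_of_ne_zero (right_ne_zero_of_mul h3)
        refine ⟨⟨ha, ?_⟩, hb, ?_⟩
        · exact (Nat.le_mul_of_pos_right _ hb).trans h2
        · exact (Nat.le_mul_of_pos_left _ ha).trans h2

theorem sum_card_divisors_pow_div_le (N k : ℕ) :
    ∑ d ∈ Finset.Icc 1 N, (d.divisors.card : ℝ) ^ k / d ≤ (1 + Real.log N) ^ 2 ^ k := by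
  induction k with
  | zero =>
    have := harmonic_le_one_add_log N
    rw [harmonic_eq_sum_Icc] at this
    push_cast at this
    simpa using this
  | succ k ih =>
    refine (sum_card_divisors_pow_div_succ_le N k).trans ?_
    rw [pow_succ 2 k, pow_mul]
    have : 0 ≤ ∑ d ∈ Finset.Icc 1 N, (d.divisors.card : ℝ) ^ k / d :=
      Finset.sum_nonneg fun _ _ => by positivity
    gcongr

/-! ### Roots of a polynomial modulo d -/

/-- The residues modulo `d` at which `Q` vanishes modulo `d`. -/
def rootResidues (Q : ℤ[X]) (d : ℕ) : Finset ℕ :=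
  (Finset.range d).filter fun r => (d : ℤ) ∣ Q.eval (r : ℤ)

theorem mem_rootResidues {Q : ℤ[X]} {d r : ℕ} :
    r ∈ rootResidues Q d ↔ r < d ∧ (d : ℤ) ∣ Q.eval (r : ℤ) := by
  simp [rootResidues]

theorem dvd_eval_congr (Q : ℤ[X]) {d x y : ℤ} (h : x ≡ y [ZMOD d]) :
    d ∣ Q.eval x ↔ d ∣ Q.eval y := by
  have h1 : d ∣ Q.eval y - Q.eval x := h.dvd.trans (Polynomial.sub_dvd_eval_sub y x Q)
  exact (dvd_iff_dvd_of_dvd_sub h1).symm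

theorem mod_mem_rootResidues {Q : ℤ[X]} {d e r : ℕ} (he : e ≠ 0) (hed : e ∣ d)
    (hr : (d : ℤ) ∣ Q.eval (r : ℤ)) : r % e ∈ rootResidues Q e := by
  rw [mem_rootResidues]
  refine ⟨Nat.mod_lt _ (Nat.pos_of_ne_zero he), ?_⟩
  have h1 : (e : ℤ) ∣ Q.eval (r : ℤ) := (Int.natCast_dvd_natCast.2 hed).trans hr
  refine (dvd_eval_congr Q ?_).1 h1
  push_cast
  exact (Int.mod_modEq _ _).symm

theorem card_rootResidues_le (Q : ℤ[X]) (d : ℕ) : (rootResidues Q d).card ≤ d :=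
  (Finset.card_filter_le _ _).trans (by simp)

theorem card_rootResidues_mul_le (Q : ℤ[X]) {a b : ℕ} (ha : a ≠ 0) (hb : b ≠ 0)
    (hab : a.Coprime b) :
    (rootResidues Q (a * b)).card ≤ (rootResidues Q a).card * (rootResidues Q b).card := by
  rw [← Finset.card_product]
  refine Finset.card_le_card_of_injOn (fun r => (r % a, r % b)) ?_ ?_
  · intro r hr
    have hr' := (mem_rootResidues.1 (Finset.mem_coe.1 hr)).2
    simp only [Finset.coe_product, Set.mem_prod, Finset.mem_coe]
    exact ⟨mod_mem_rootResidues ha (Dvd.intro _ rfl) hr',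
      mod_mem_rootResidues hb (Dvd.intro_left _ rfl) hr'⟩
  · intro r hr s hs h
    have hr' := (mem_rootResidues.1 (Finset.mem_coe.1 hr)).1
    have hs' := (mem_rootResidues.1 (Finset.mem_coe.1 hs)).1
    simp only [Prod.mk.injEq] at h
    exact Nat.ModEq.eq_of_lt_of_lt ((Nat.modEq_and_modEq_iff_modEq_mul hab).1 h) hr' hs'

theorem card_rootResidues_prime_le {Q A B : ℤ[X]} {Δ : ℤ} (hQ : A * Q + B * derivative Q = C Δ)
    {p : ℕ} (hp : p.Prime) (hpΔ : ¬ (p : ℤ) ∣ Δ) :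
    (rootResidues Q p).card ≤ Q.natDegree := by
  classical
  have := Fact.mk hp
  set q := Q.map (Int.castRingHom (ZMod p)) with hq
  -- If Q vanished identically modulo p, so would its derivative, and the Bézout relation would give
  -- p ∣ Δ.
  have hq0 : q ≠ 0 := by
    intro h0
    have h := congrArg (Polynomial.map (Int.castRingHom (ZMod p))) hQ
    simp only [Polynomial.map_add, Polynomial.map_mul, ← Polynomial.derivative_map,
      Polynomial.map_C] at h
    rw [← hq, h0] at h
    simp only [mul_zero, derivative_zero, add_zero] at h
    have := (Polynomial.C_eq_zero.1 h.symm)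
    exact hpΔ ((ZMod.intCast_zmod_eq_zero_iff_dvd Δ p).1 (by simpa only [eq_intCast, map_zero] using this))
  calc (rootResidues Q p).card ≤ q.roots.toFinset.card := by
        refine Finset.card_le_card_of_injOn (fun r => (r : ZMod p)) ?_ ?_
        · intro r hr
          have hr' := (mem_rootResidues.1 (Finset.mem_coe.1 hr)).2
          simp only [Finset.mem_coe, Multiset.mem_toFinset]
          rw [Polynomial.mem_roots hq0, Polynomial.IsRoot.def, hq]
          have := (ZMod.intCast_zmod_eq_zero_iff_dvd _ p).2 hr'
          rw [Polynomial.eval_map, ← this]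
          have h2 := Polynomial.eval₂_at_apply (p := Q) (Int.castRingHom (ZMod p)) (r : ℤ)
          simpa using h2
        · intro r hr s hs h
          have hr' := (mem_rootResidues.1 (Finset.mem_coe.1 hr)).1
          have hs' := (mem_rootResidues.1 (Finset.mem_coe.1 hs)).1
          exact Nat.ModEq.eq_of_lt_of_lt ((ZMod.natCast_eq_natCast_iff _ _ _).1 h) hr' hs'
    _ ≤ Multiset.card q.roots := Multiset.toFinset_card_le _
    _ ≤ q.natDegree := Polynomial.card_roots' q
    _ ≤ Q.natDegree := Polynomial.natDegree_map_le

theorem pow_dvd_of_pow_dvd_mul {p : ℕ} (hp : p.Prime) {a u : ℤ} {j e : ℕ}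
    (h : ((p : ℤ) ^ j) ∣ a * u) (hu : ¬ ((p : ℤ) ^ (e + 1)) ∣ u) : ((p : ℤ) ^ (j - e)) ∣ a := by
  have := Fact.mk hp
  rcases eq_or_ne a 0 with rfl | ha
  · simp
  have hu0 : u ≠ 0 := by rintro rfl; simp at hu
  rw [padicValInt_dvd_iff] at h hu ⊢
  rw [padicValInt.mul ha hu0] at h
  have := mul_ne_zero ha hu0
  right
  simp only [this, false_or, hu0] at h hu
  omega

/-- By Taylor, Q(y) - Q(x) = (y - x)(Q'(x) + c(y - x)). If p^(δ+1) divided the second factor it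
would divide Q'(x), and with Q(x) also Δ. So that factor absorbs at most p^δ, and the rest of p^j
divides y - x. -/
theorem modEq_of_modEq_of_roots {Q A B : ℤ[X]} {Δ : ℤ}
    (hQ : A * Q + B * derivative Q = C Δ) {p : ℕ} (hp : p.Prime) {δ j : ℕ}
    (hδ : ¬ ((p : ℤ) ^ (δ + 1)) ∣ Δ) (hj : δ + 1 ≤ j) {x y : ℤ}
    (hx : (p : ℤ) ^ j ∣ Q.eval x) (hy : (p : ℤ) ^ j ∣ Q.eval y)
    (hxy : (p : ℤ) ^ (δ + 1) ∣ y - x) : (p : ℤ) ^ (j - δ) ∣ y - x := by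
  obtain ⟨c, hc⟩ := Polynomial.binomExpansion Q x (y - x)
  rw [add_sub_cancel] at hc
  have h1 : (p : ℤ) ^ j ∣ (y - x) * (Q.derivative.eval x + c * (y - x)) := by
    have : (y - x) * (Q.derivative.eval x + c * (y - x)) = Q.eval y - Q.eval x := by
      rw [hc]; ring
    rw [this]; exact dvd_sub hy hx
  refine pow_dvd_of_pow_dvd_mul hp h1 fun h2 => hδ ?_
  have h3 : (p : ℤ) ^ (δ + 1) ∣ Q.derivative.eval x :=
    (dvd_add_left (hxy.mul_left c)).1 h2
  have h4 : (p : ℤ) ^ (δ + 1) ∣ Q.eval x := (pow_dvd_pow _ hj).trans hx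
  have h5 := congrArg (Polynomial.eval x) hQ
  simp only [Polynomial.eval_add, Polynomial.eval_mul, Polynomial.eval_C] at h5
  rw [← h5]
  exact dvd_add (h4.mul_left _) (h3.mul_left _)

/-- Roots modulo p^j that agree modulo p^(δ+1) agree modulo p^(j-δ), so a root is determined by its
residue modulo p^(δ+1) and its quotient by p^(j-δ), which takes p^δ values. The bound does not
depend on j. -/
theorem card_rootResidues_prime_pow_le {Q A B : ℤ[X]} {Δ : ℤ}
    (hQ : A * Q + B * derivative Q = C Δ) {p : ℕ} (hp : p.Prime) {δ j : ℕ}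
    (hδ : ¬ ((p : ℤ) ^ (δ + 1)) ∣ Δ) (hj : δ + 1 ≤ j) :
    (rootResidues Q (p ^ j)).card ≤ (rootResidues Q (p ^ (δ + 1))).card * p ^ δ := by
  have hpos : 0 < p := hp.pos
  rw [← Finset.card_range (p ^ δ), ← Finset.card_product]
  refine Finset.card_le_card_of_injOn (fun r => (r % p ^ (δ + 1), r / p ^ (j - δ))) ?_ ?_
  · intro r hr
    obtain ⟨hr1, hr2⟩ := mem_rootResidues.1 (Finset.mem_coe.1 hr)
    simp only [Finset.coe_product, Set.mem_prod, Finset.mem_coe, Finset.mem_range]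
    refine ⟨mod_mem_rootResidues (by positivity) (pow_dvd_pow _ hj) hr2, ?_⟩
    rw [Nat.div_lt_iff_lt_mul (by positivity), ← pow_add]
    rwa [show δ + (j - δ) = j by omega]
  · intro r hr s hs h
    obtain ⟨hr1, hr2⟩ := mem_rootResidues.1 (Finset.mem_coe.1 hr)
    obtain ⟨hs1, hs2⟩ := mem_rootResidues.1 (Finset.mem_coe.1 hs)
    simp only [Prod.mk.injEq] at h
    push_cast at hr2 hs2
    have h1 : (p : ℤ) ^ (δ + 1) ∣ (s : ℤ) - r := by
      have := (Nat.modEq_iff_dvd.1 h.1)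
      push_cast at this
      exact this
    have h2 := modEq_of_modEq_of_roots hQ hp hδ hj hr2 hs2 h1
    have h3 : r % p ^ (j - δ) = s % p ^ (j - δ) := by
      refine (Nat.modEq_iff_dvd.2 ?_)
      push_cast
      exact h2
    rw [← Nat.div_add_mod r (p ^ (j - δ)), ← Nat.div_add_mod s (p ^ (j - δ)), h.2, h3]

theorem exists_card_rootResidues_le {Q A B : ℤ[X]} {Δ : ℤ} (hΔ : Δ ≠ 0)
    (hQ : A * Q + B * derivative Q = C Δ) :
    ∃ K : ℕ, ∀ d : ℕ, d ≠ 0 →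
      (rootResidues Q d).card ≤ K * d.divisors.card ^ Q.natDegree := by
  set v : ℕ → ℕ := fun p => Δ.natAbs.factorization p with hv
  have hvΔ : ∀ p : ℕ, p.Prime → ¬ ((p : ℤ) ^ (v p + 1)) ∣ Δ := by
    intro p hp h
    have h' : p ^ (v p + 1) ∣ Δ.natAbs := by
      have := Int.natAbs_dvd_natAbs.2 h
      simpa [Int.natAbs_pow] using this
    have := (hp.pow_dvd_iff_le_factorization (by simpa using hΔ)).1 h'
    simp only [hv] at this
    omega
  -- For p ∣ Δ the count is at most p^v · p^(v+1), and 2v + 1 ≤ 3v because v ≥ 1. For p ∤ Δ it is at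
  -- most deg Q ≤ 2^(deg Q) ≤ τ(p^j)^(deg Q), and the weight is 1.
  set w : ℕ → ℕ := fun p => p ^ (3 * v p) with hw
  have hw1 : ∀ p : ℕ, p.Prime → 1 ≤ w p := fun p hp => Nat.one_le_pow _ _ hp.pos
  have key : ∀ d : ℕ, d ≠ 0 →
      (rootResidues Q d).card ≤ (∏ p ∈ d.primeFactors, w p) * d.divisors.card ^ Q.natDegree := by
    intro d
    induction d using Nat.recOnPosPrimePosCoprime with
    | zero => simp
    | one => intro _; simpa using card_rootResidues_le Q 1
    | prime_pow p j hp hj =>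
      intro _
      rw [Nat.primeFactors_prime_pow hj.ne' hp, Finset.prod_singleton]
      have hτ : 2 ≤ (p ^ j).divisors.card := by
        rw [Nat.divisors_prime_pow hp]; simp; omega
      have hτD : 1 ≤ (p ^ j).divisors.card ^ Q.natDegree := Nat.one_le_pow _ _ (by omega)
      rcases Nat.eq_zero_or_pos (v p) with h0 | h0
      · have h1 := hvΔ p hp
        have h2 := card_rootResidues_prime_pow_le hQ hp h1 (j := j) (by omega)
        rw [h0] at h1 h2
        simp only [zero_add, pow_one, pow_zero, mul_one] at h1 h2
        have h3 := card_rootResidues_prime_le hQ hp h1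
        have hD : Q.natDegree ≤ 2 ^ Q.natDegree := Nat.lt_two_pow_self.le
        have h4 : 2 ^ Q.natDegree ≤ (p ^ j).divisors.card ^ Q.natDegree :=
          Nat.pow_le_pow_left hτ _
        have h5 := Nat.le_mul_of_pos_left ((p ^ j).divisors.card ^ Q.natDegree) (hw1 p hp)
        omega
      · have h1 : (rootResidues Q (p ^ j)).card ≤ w p := by
          rcases Nat.lt_or_ge j (v p + 1) with hlt | hge
          · refine (card_rootResidues_le _ _).trans (Nat.pow_le_pow_right hp.pos (by omega))
          · refine (card_rootResidues_prime_pow_le hQ hp (hvΔ p hp) hge).trans ?_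
            refine (Nat.mul_le_mul_right _ (card_rootResidues_le _ _)).trans ?_
            rw [← pow_add]
            exact Nat.pow_le_pow_right hp.pos (by omega)
        exact h1.trans (Nat.le_mul_of_pos_right _ hτD)
    | coprime a b ha hb hab iha ihb =>
      intro _
      have ha0 : a ≠ 0 := by omega
      have hb0 : b ≠ 0 := by omega
      rw [hab.primeFactors_mul, Finset.prod_union hab.disjoint_primeFactors,
        hab.card_divisors_mul, mul_pow]
      calc _ ≤ _ := card_rootResidues_mul_le Q ha0 hb0 hab
        _ ≤ _ := Nat.mul_le_mul (iha ha0) (ihb hb0)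
        _ = _ := by ring
  refine ⟨∏ p ∈ Δ.natAbs.primeFactors, w p, fun d hd => (key d hd).trans ?_⟩
  refine Nat.mul_le_mul_right _ ?_
  -- Only primes dividing Δ have weight different from 1, so the constant is independent of d.
  calc ∏ p ∈ d.primeFactors, w p
      = ∏ p ∈ d.primeFactors.filter (· ∈ Δ.natAbs.primeFactors), w p := by
        symm
        refine Finset.prod_filter_of_ne fun p _ hp => ?_
        by_contra hn
        refine hp ?_
        have : v p = 0 := by
          rw [← Nat.support_factorization] at hn
          exact Finsupp.notMem_support_iff.1 hn
        simp [hw, this]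
    _ ≤ _ := by
        refine Finset.prod_le_prod_of_subset_of_one_le' ?_ ?_
        · intro p hp
          exact (Finset.mem_filter.1 hp).2
        · intro p hp _
          exact hw1 p (Nat.prime_of_mem_primeFactors hp)

/-! ### Mean of the divisor function along polynomial values -/

theorem card_dvd_eval_mul_le (Q : ℤ[X]) {H d : ℕ} (hd : d ≠ 0) (hdH : d ≤ H) :
    ((Finset.Icc (-(H : ℤ)) H).filter fun n => (d : ℤ) ∣ Q.eval n).card * d ≤
      (rootResidues Q d).card * (4 * H) := by
  have hdz : (0 : ℤ) < d := by exact_mod_cast Nat.pos_of_ne_zero hd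
  have h1 : ((Finset.Icc (-(H : ℤ)) H).filter fun n => (d : ℤ) ∣ Q.eval n).card ≤
      (rootResidues Q d).card * (2 * (H / d) + 2) := by
    -- The range of n / d for |n| ≤ H: the floor of a negative quotient can reach -⌊H/d⌋ - 1.
    have hc : (Finset.Icc (-((H / d : ℕ) : ℤ) - 1) ((H / d : ℕ) : ℤ)).card = 2 * (H / d) + 2 := by
      rw [Int.card_Icc]; omega
    rw [← hc, ← Finset.card_product]
    refine Finset.card_le_card_of_injOn (fun n : ℤ => ((n % d).toNat, n / d)) ?_ ?_
    · intro n hn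
      simp only [Finset.coe_filter, Finset.mem_Icc, Set.mem_ofPred_eq] at hn
      simp only [Finset.coe_product, Set.mem_prod, Finset.mem_coe, mem_rootResidues,
        Finset.mem_Icc]
      have hm0 := Int.emod_nonneg n hdz.ne'
      have hm1 := Int.emod_lt_of_pos n hdz
      refine ⟨⟨by omega, ?_⟩, ?_, ?_⟩
      · rw [Int.toNat_of_nonneg hm0]
        exact (dvd_eval_congr Q (Int.mod_modEq n d)).2 hn.2
      · push_cast
        rw [Int.le_ediv_iff_mul_le hdz]
        have := Int.lt_ediv_add_one_mul_self (H : ℤ) hdz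
        nlinarith [hn.1.1]
      · push_cast
        exact Int.ediv_le_ediv hdz hn.1.2
    · intro n hn m hm h
      simp only [Prod.mk.injEq] at h
      have hm0 := Int.emod_nonneg n hdz.ne'
      have hm1 := Int.emod_nonneg m hdz.ne'
      rw [← Int.mul_ediv_add_emod n d, ← Int.mul_ediv_add_emod m d, h.2,
        show n % d = m % d by omega]
  calc _ ≤ (rootResidues Q d).card * (2 * (H / d) + 2) * d := Nat.mul_le_mul_right _ h1
    _ ≤ _ := by
      rw [mul_assoc]
      refine Nat.mul_le_mul_left _ ?_
      have := Nat.div_mul_le_self H d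
      nlinarith

/-- Root counts modulo d are controlled only for separable polynomials, whereas P may have repeated
factors. Q is the squarefree part of P over ℚ with denominators cleared, so P divides a constant
times a power of Q, and coprimality of Q and Q' becomes the relation with Δ. -/
theorem exists_squarefree_companion {P : ℤ[X]} (hP : P ≠ 0) :
    ∃ (Q A B W : ℤ[X]) (Δ e : ℤ) (m : ℕ), Δ ≠ 0 ∧ e ≠ 0 ∧
      A * Q + B * derivative Q = C Δ ∧ P * W = C e * Q ^ m ∧
      ∀ n : ℤ, Q.eval n = 0 → P.eval n = 0 := by
  have hinj : Function.Injective (Int.castRingHom ℚ) := Int.cast_injective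
  have hmapinj := Polynomial.map_injective (Int.castRingHom ℚ) hinj
  have hclear : ∀ f : ℚ[X], ∃ (g : ℤ[X]) (c : ℤ), c ≠ 0 ∧
      g.map (Int.castRingHom ℚ) = C (c : ℚ) * f := by
    intro f
    obtain ⟨b, hbM, hb⟩ := IsLocalization.integerNormalization_spec (nonZeroDivisors ℤ) f
    refine ⟨IsLocalization.integerNormalization (nonZeroDivisors ℤ) f, b,
      nonZeroDivisors.ne_zero hbM, ?_⟩
    rw [← eq_intCast (algebraMap ℤ ℚ) b, ← Polynomial.smul_eq_C_mul, algebraMap_smul]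
    exact hb
  have hP' : P.map (Int.castRingHom ℚ) ≠ 0 := by
    rwa [Ne, Polynomial.map_eq_zero_iff hinj]
  obtain ⟨y, m, hy, hyP, hPy⟩ := exists_squarefree_dvd_pow_of_ne_zero hP'
  obtain ⟨Q, c, hc, hQ⟩ := hclear y
  rw [← PerfectField.separable_iff_squarefree] at hy
  have hcQ : IsUnit (C (c : ℚ)) := Polynomial.isUnit_C.2 (by simpa using hc)
  have hQsep : (Q.map (Int.castRingHom ℚ)).Separable := by
    rw [hQ]; exact Polynomial.Separable.unit_mul hcQ hy
  obtain ⟨a, b, hab⟩ := hQsep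
  obtain ⟨A, ca, hca, hA⟩ := hclear a
  obtain ⟨B, cb, hcb, hB⟩ := hclear b
  have hdvd : P.map (Int.castRingHom ℚ) ∣ (Q.map (Int.castRingHom ℚ)) ^ m := by
    refine hPy.trans (pow_dvd_pow_of_dvd ?_ m)
    rw [hQ]; exact Dvd.intro_left _ rfl
  obtain ⟨w, hw⟩ := hdvd
  obtain ⟨W, e, he, hW⟩ := hclear w
  refine ⟨Q, C cb * A, C ca * B, W, ca * cb, e, m, mul_ne_zero hca hcb, he, ?_, ?_, ?_⟩
  · apply hmapinj
    simp only [Polynomial.map_add, Polynomial.map_mul, Polynomial.map_C, hA, hB,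
      ← Polynomial.derivative_map]
    simp only [eq_intCast, Int.cast_mul]
    linear_combination (C (ca : ℚ)) * C (cb : ℚ) * hab - C.map_mul (ca : ℚ) (cb : ℚ)
  · apply hmapinj
    simp only [Polynomial.map_mul, Polynomial.map_C, hW, Polynomial.map_pow]
    simp only [eq_intCast]
    linear_combination - C (e : ℚ) * hw
  · intro n hn
    obtain ⟨z, hz⟩ := hyP
    have h1 : (Q.map (Int.castRingHom ℚ)).eval (n : ℚ) = 0 := by
      have h := Polynomial.eval_intCast_map (Int.castRingHom ℚ) Q n
      simpa [hn] using h
    rw [hQ, Polynomial.eval_mul, Polynomial.eval_C, mul_eq_zero] at h1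
    have h2 : y.eval (n : ℚ) = 0 := h1.resolve_left (by simpa using hc)
    have h3 := Polynomial.eval_intCast_map (Int.castRingHom ℚ) P n
    rw [hz, Polynomial.eval_mul, h2, zero_mul] at h3
    simpa using h3.symm

theorem exists_natAbs_eval_le_pow (Q : ℤ[X]) :
    ∃ k : ℕ, ∀ H : ℕ, 2 ≤ H → ∀ n ∈ Finset.Icc (-(H : ℤ)) H, (Q.eval n).natAbs ≤ H ^ k := by
  set S := ∑ i ∈ Finset.range (Q.natDegree + 1), (Q.coeff i).natAbs
  -- The coefficient sum S is at most 2^S ≤ H^S, so it moves into the exponent.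
  refine ⟨S + Q.natDegree, fun H hH n hn => ?_⟩
  have hn' : n.natAbs ≤ H := by
    rw [Finset.mem_Icc] at hn; omega
  rw [Polynomial.eval_eq_sum_range]
  calc _ ≤ ∑ i ∈ Finset.range (Q.natDegree + 1), (Q.coeff i * n ^ i).natAbs :=
        Int.natAbs_sum_le _ _
    _ ≤ ∑ i ∈ Finset.range (Q.natDegree + 1), (Q.coeff i).natAbs * H ^ Q.natDegree := by
        refine Finset.sum_le_sum fun i hi => ?_
        rw [Int.natAbs_mul, Int.natAbs_pow]
        refine Nat.mul_le_mul_left _ ((Nat.pow_le_pow_left hn' _).trans ?_)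
        exact Nat.pow_le_pow_right (by omega) (by simp at hi; omega)
    _ = S * H ^ Q.natDegree := by rw [Finset.sum_mul]
    _ ≤ H ^ S * H ^ Q.natDegree := by
        refine Nat.mul_le_mul_right _ (Nat.lt_two_pow_self.le.trans (Nat.pow_le_pow_left hH _))
    _ = _ := by rw [pow_add]

theorem one_lt_log_three : 1 < Real.log 3 := by
  rw [Real.lt_log_iff_exp_lt (by norm_num)]
  exact Real.exp_one_lt_d9.trans (by norm_num)

theorem one_lt_log_of_three_le {H : ℕ} (hH : 3 ≤ H) : 1 < Real.log H :=
  one_lt_log_three.trans_le (Real.log_le_log (by norm_num) (by exact_mod_cast hH))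

/-- Since log 3 > 1, every constant is dominated by a power of log H once H ≥ 3. This is how all
multiplicative constants end up in the exponent of the logarithm. -/
theorem exists_const_le_log_rpow (K : ℝ) :
    ∃ c : ℝ, 0 ≤ c ∧ ∀ H : ℕ, 3 ≤ H → K ≤ Real.log H ^ c := by
  obtain ⟨n, hn⟩ := pow_unbounded_of_one_lt K one_lt_log_three
  refine ⟨n, by positivity, fun H hH => hn.le.trans ?_⟩
  rw [Real.rpow_natCast]
  have : Real.log 3 ≤ Real.log H := Real.log_le_log (by norm_num) (by exact_mod_cast hH)
  have := one_lt_log_three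
  gcongr

/-- Van der Corput's bound for the divisor function along the values of a polynomial. -/
theorem exists_sum_card_divisors_eval_le {P : ℤ[X]} (hP : P ≠ 0) :
    ∃ c : ℝ, 0 ≤ c ∧ ∀ H : ℕ, 3 ≤ H →
      ∑ n ∈ (Finset.Icc (-(H : ℤ)) H).filter (fun n => P.eval n ≠ 0),
        ((P.eval n).natAbs.divisors.card : ℝ) ≤ H * Real.log H ^ c := by
  obtain ⟨Q, A, B, W, Δ, e, m, hΔ, he, hQ, hPW, hzero⟩ := exists_squarefree_companion hP
  obtain ⟨K, hK⟩ := exists_card_rootResidues_le hΔ hQ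
  obtain ⟨k, hk⟩ := exists_natAbs_eval_le_pow Q
  set τe := e.natAbs.divisors.card
  set l := k * m
  -- The moment of order l + deg Q combines τ(d)^l from the pointwise bound with τ(d)^(deg Q) from
  -- the root count; M is the resulting power of 1 + log H.
  set M := 2 ^ (l + Q.natDegree) with hM
  set G : ℝ := τe * 2 ^ l * (K * 4) * 2 ^ M
  obtain ⟨c, hc0, hc⟩ := exists_const_le_log_rpow G
  refine ⟨c + M, by positivity, fun H hH => ?_⟩
  have hlog := one_lt_log_of_three_le hH
  have hHpos : (0 : ℝ) < H := by positivity
  -- A single small divisor d of Q(n) already bounds τ(P(n)); summing over all d ≤ H dividing Q(n)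
  -- removes the dependence of d on n.
  have hpt : ∀ n ∈ (Finset.Icc (-(H : ℤ)) H).filter (fun n => P.eval n ≠ 0),
      ((P.eval n).natAbs.divisors.card : ℝ) ≤
        ∑ d ∈ Finset.Icc 1 H, if (d : ℤ) ∣ Q.eval n then
          (τe * 2 ^ l : ℝ) * (d.divisors.card : ℝ) ^ l else 0 := by
    intro n hn
    rw [Finset.mem_filter] at hn
    have hQn : (Q.eval n).natAbs ≠ 0 := by
      rw [Ne, Int.natAbs_eq_zero]; exact fun h => hn.2 (hzero n h)
    obtain ⟨d, hdvd, hdH, hd⟩ := exists_small_divisor_card_divisors_le (y := H) (by omega) k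
      (Q.eval n).natAbs hQn (hk H (by omega) n hn.1)
    have hd0 : d ≠ 0 := by rintro rfl; exact hQn (zero_dvd_iff.1 hdvd)
    have h1 : (P.eval n).natAbs ∣ e.natAbs * (Q.eval n).natAbs ^ m := by
      rw [← Int.natAbs_pow, ← Int.natAbs_mul, Int.natAbs_dvd_natAbs]
      refine ⟨W.eval n, ?_⟩
      have := congrArg (Polynomial.eval n) hPW
      simpa using this.symm
    have h2 : (P.eval n).natAbs.divisors.card ≤ τe * (2 ^ l * d.divisors.card ^ l) := by
      calc _ ≤ (e.natAbs * (Q.eval n).natAbs ^ m).divisors.card :=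
            card_divisors_le_of_dvd h1 (mul_ne_zero (by simpa using he) (pow_ne_zero _ hQn))
        _ ≤ τe * (Q.eval n).natAbs.divisors.card ^ m :=
            (card_divisors_mul_le _ _).trans (Nat.mul_le_mul_left _ (card_divisors_pow_le _ _))
        _ ≤ τe * ((2 * d.divisors.card) ^ k) ^ m := by gcongr
        _ = _ := by rw [← pow_mul, mul_pow]
    have h3 : ((P.eval n).natAbs.divisors.card : ℝ) ≤
        (if (d : ℤ) ∣ Q.eval n then (τe * 2 ^ l : ℝ) * (d.divisors.card : ℝ) ^ l else 0) := by
      rw [if_pos (Int.natCast_dvd.2 hdvd), mul_assoc]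
      exact_mod_cast h2
    refine h3.trans (Finset.single_le_sum (f := fun d : ℕ => if (d : ℤ) ∣ Q.eval n then
          (τe * 2 ^ l : ℝ) * (d.divisors.card : ℝ) ^ l else 0) (fun i _ => ?_) ?_)
    · positivity
    · exact Finset.mem_Icc.2 ⟨Nat.pos_of_ne_zero hd0, hdH⟩
  have hsum : ∑ n ∈ (Finset.Icc (-(H : ℤ)) H).filter (fun n => P.eval n ≠ 0),
        ((P.eval n).natAbs.divisors.card : ℝ) ≤ τe * 2 ^ l * (K * 4) * H *
        ∑ d ∈ Finset.Icc 1 H, (d.divisors.card : ℝ) ^ (l + Q.natDegree) / d := by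
    calc _ ≤ ∑ n ∈ (Finset.Icc (-(H : ℤ)) H).filter (fun n => P.eval n ≠ 0),
          ∑ d ∈ Finset.Icc 1 H, (if (d : ℤ) ∣ Q.eval n then
            (τe * 2 ^ l : ℝ) * (d.divisors.card : ℝ) ^ l else 0) := Finset.sum_le_sum hpt
      _ ≤ ∑ n ∈ Finset.Icc (-(H : ℤ)) H,
          ∑ d ∈ Finset.Icc 1 H, (if (d : ℤ) ∣ Q.eval n then
            (τe * 2 ^ l : ℝ) * (d.divisors.card : ℝ) ^ l else 0) :=
          Finset.sum_le_sum_of_subset_of_nonneg (Finset.filter_subset _ _)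
            fun _ _ _ => Finset.sum_nonneg fun _ _ => by positivity
      _ = ∑ d ∈ Finset.Icc 1 H,
          (((Finset.Icc (-(H : ℤ)) H).filter fun n => (d : ℤ) ∣ Q.eval n).card : ℝ) *
            ((τe * 2 ^ l : ℝ) * (d.divisors.card : ℝ) ^ l) := by
          rw [Finset.sum_comm]
          refine Finset.sum_congr rfl fun d _ => ?_
          rw [← Finset.sum_filter, Finset.sum_const, nsmul_eq_mul]
      _ ≤ _ := by
          rw [Finset.mul_sum]
          refine Finset.sum_le_sum fun d hd => ?_
          rw [Finset.mem_Icc] at hd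
          have hd0 : d ≠ 0 := by omega
          have hdpos : (0 : ℝ) < d := by positivity
          have h1 : (((Finset.Icc (-(H : ℤ)) H).filter fun n => (d : ℤ) ∣ Q.eval n).card : ℝ) * d ≤
              (K * (d.divisors.card : ℝ) ^ Q.natDegree) * (4 * H) := by
            exact_mod_cast (card_dvd_eval_mul_le Q hd0 hd.2).trans
              (Nat.mul_le_mul_right _ (hK d hd0))
          rw [← le_div_iff₀ hdpos] at h1
          calc _ ≤ _ := mul_le_mul_of_nonneg_right h1 (by positivity)
            _ = _ := by rw [pow_add]; ring
  calc _ ≤ _ := hsum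
    _ ≤ τe * 2 ^ l * (K * 4) * H * (1 + Real.log H) ^ M := by
        have := sum_card_divisors_pow_div_le H (l + Q.natDegree)
        gcongr
    _ ≤ τe * 2 ^ l * (K * 4) * H * (2 * Real.log H) ^ M := by
        have : 1 + Real.log H ≤ 2 * Real.log H := by linarith
        gcongr
    _ = H * (G * Real.log H ^ M) := by rw [mul_pow]; ring
    _ ≤ H * (Real.log H ^ c * Real.log H ^ M) := by
        have := hc H hH
        gcongr
    _ = _ := by
        rw [Real.rpow_add (by linarith), Real.rpow_natCast]

/-! ### Locating a single large root -/

noncomputable section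

theorem re_sum_bounds_of_near {m : Multiset ℂ} {s ρ : ℝ} (hρ : 0 ≤ ρ)
    (h : ∀ r ∈ m, ‖r‖ ≤ ρ ∨ ‖r + s‖ ≤ s / 3) :
    (m.filter fun r => ¬ ‖r‖ ≤ ρ).card * (2 * s / 3) - m.card * ρ ≤ -(m.sum).re ∧
    -(m.sum).re ≤ (m.filter fun r => ¬ ‖r‖ ≤ ρ).card * (4 * s / 3) + m.card * ρ := by
  induction m using Multiset.induction_on with
  | empty => simp
  | cons r m ih =>
    obtain ⟨ih1, ih2⟩ := ih fun x hx => h x (Multiset.mem_cons_of_mem hx)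
    rw [Multiset.sum_cons, Multiset.card_cons, Complex.add_re]
    push_cast
    by_cases hr : ‖r‖ ≤ ρ
    · rw [Multiset.filter_cons_of_neg (p := fun r : ℂ => ¬ ‖r‖ ≤ ρ) m (not_not.2 hr)]
      have := abs_le.1 ((Complex.abs_re_le_norm r).trans hr)
      constructor <;> linarith [this.1, this.2]
    · rw [Multiset.filter_cons_of_pos (p := fun r : ℂ => ¬ ‖r‖ ≤ ρ) m hr, Multiset.card_cons]
      have h1 := (h r (Multiset.mem_cons_self _ _)).resolve_left hr
      have := abs_le.1 ((Complex.abs_re_le_norm _).trans h1)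
      simp only [Complex.add_re, Complex.ofReal_re] at this
      push_cast
      constructor <;> linarith [this.1, this.2]

/-- If each of finitely many complex numbers is small or near `-s`, and their sum is near `-s`,
then all but one are small. -/
theorem exists_unique_large {m : Multiset ℂ} {s ρ : ℝ} (hρ : 0 ≤ ρ)
    (h : ∀ r ∈ m, ‖r‖ ≤ ρ ∨ ‖r + s‖ ≤ s / 3) (hsum : ‖m.sum + s‖ ≤ s / 6)
    (hcard : m.card * ρ < s / 6) :
    ∃ r₀ m', m = r₀ ::ₘ m' ∧ ∀ r ∈ m', ‖r‖ ≤ ρ := by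
  obtain ⟨h1, h2⟩ := re_sum_bounds_of_near hρ h
  have h3 := abs_le.1 ((Complex.abs_re_le_norm _).trans hsum)
  simp only [Complex.add_re, Complex.ofReal_re] at h3
  have hs : 0 < s := by
    have : 0 ≤ (m.card : ℝ) * ρ := by positivity
    linarith
  set N := (m.filter fun r => ¬ ‖r‖ ≤ ρ).card with hN
  -- Here -Re of the sum lies in [5s/6, 7s/6] and the small terms contribute less than s/6. No large
  -- term would give less than s/6, and two or more would give over 4s/3 - s/6 = 7s/6.
  have hN1 : N = 1 := by
    rcases Nat.lt_trichotomy N 1 with hlt | heq | hgt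
    · have : N = 0 := by omega
      rw [this] at h2
      push_cast at h2
      linarith [h3.1, h3.2]
    · exact heq
    · have : (2 : ℝ) ≤ N := by exact_mod_cast hgt
      nlinarith [h3.1, h3.2]
  obtain ⟨r₀, hr₀⟩ := Multiset.card_eq_one.1 hN1
  refine ⟨r₀, m.filter fun r => ‖r‖ ≤ ρ, ?_, fun r hr => (Multiset.mem_filter.1 hr).2⟩
  conv_lhs => rw [← Multiset.filter_add_not (fun r => ‖r‖ ≤ ρ) m]
  rw [hr₀, add_comm, Multiset.singleton_add]

theorem exists_unique_large_index {ι : Type*} [Fintype ι] [DecidableEq ι] {r : ι → ℂ} {s ρ : ℝ}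
    (hρ : 0 ≤ ρ) (h : ∀ i, ‖r i‖ ≤ ρ ∨ ‖r i + s‖ ≤ s / 3) (hsum : ‖∑ i, r i + s‖ ≤ s / 6)
    (hcard : Fintype.card ι * ρ < s / 6) : ∃ i₀, ∀ i ≠ i₀, ‖r i‖ ≤ ρ := by
  obtain ⟨r₀, m', hm, hm'⟩ := exists_unique_large (m := Finset.univ.val.map r) hρ
    (by simpa using h) (by simpa using hsum) (by simpa using hcard)
  have hr₀ : r₀ ∈ Finset.univ.val.map r := by rw [hm]; exact Multiset.mem_cons_self _ _
  obtain ⟨i₀, hi₀, rfl⟩ := Multiset.mem_map.1 hr₀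
  refine ⟨i₀, fun i hi => hm' _ ?_⟩
  rw [← Multiset.cons_erase hi₀, Multiset.map_cons, Multiset.cons_inj_right] at hm
  rw [← hm]
  exact Multiset.mem_map_of_mem _ ((Multiset.mem_erase_of_ne hi).2 (by simp))

theorem exists_roots_family {n : ℕ} {f : ℂ[X]} (hf : f.Monic) (hn : f.natDegree = n) :
    ∃ r : Fin n → ℂ, ∏ i, (X - C (r i)) = f := by
  have hsp := IsAlgClosed.splits f
  have hcard : f.roots.card = n := by rw [← hn]; exact hsp.natDegree_eq_card_roots.symm
  have hlen : f.roots.toList.length = n := by rw [Multiset.length_toList, hcard]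
  subst hlen
  refine ⟨fun i => f.roots.toList.get i, ?_⟩
  conv_rhs => rw [hsp.eq_prod_roots_of_monic hf, ← Multiset.coe_toList f.roots]
  rw [Multiset.map_coe, Multiset.prod_coe, ← List.prod_ofFn]
  congr 1
  conv_rhs => rw [← List.ofFn_get f.roots.toList, List.map_ofFn]
  rfl

/-! ### Subset products of roots as polynomials in the subleading coefficient -/

/-- `∏_{|S| = k} (∏_{i ∈ S} X_i - b)`. -/
def subsetProductPoly (σ : Type*) [Fintype σ] [DecidableEq σ] (k : ℕ) (b : ℤ) :
    MvPolynomial σ ℤ :=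
  ∏ S ∈ (Finset.univ : Finset σ).powersetCard k, (∏ i ∈ S, MvPolynomial.X i - MvPolynomial.C b)

theorem subsetProductPoly_isSymmetric (σ : Type*) [Fintype σ] [DecidableEq σ] (k : ℕ) (b : ℤ) :
    (subsetProductPoly σ k b).IsSymmetric := by
  intro e
  rw [subsetProductPoly, map_prod]
  refine Finset.prod_bij' (fun S _ => S.map e.toEmbedding) (fun S _ => S.map e.symm.toEmbedding)
    ?_ ?_ ?_ ?_ ?_
  · intro S hS; simpa [Finset.mem_powersetCard] using hS
  · intro S hS; simpa [Finset.mem_powersetCard] using hS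
  · intro S _; ext; simp
  · intro S _; ext; simp
  · intro S _; simp [Finset.prod_map]

/-- The polynomial `x ^ (n + 1) + s x ^ n + ∑_{i < n} a_i x ^ i`. -/
def subleadingFamily (n : ℕ) (a : ℕ → ℤ) (s : ℂ) : ℂ[X] :=
  X ^ (n + 1) + C s * X ^ n + ∑ i ∈ Finset.range n, C (a i : ℂ) * X ^ i

theorem coeff_subleadingFamily (n : ℕ) (a : ℕ → ℤ) (s : ℂ) (j : ℕ) (hj : j ≤ n) :
    (subleadingFamily n a s).coeff j = if j = n then s else (a j : ℂ) := by
  simp only [subleadingFamily, coeff_add, coeff_X_pow, coeff_C_mul, finsetSum_coeff]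
  rw [if_neg (by omega)]
  split_ifs with h
  · subst h
    rw [Finset.sum_eq_zero]
    · simp
    · intro i hi
      rw [if_neg (by simp at hi; omega)]; simp
  · rw [Finset.sum_eq_single j]
    · simp
    · intro i _ hij
      rw [if_neg hij.symm]; simp
    · intro hn; simp at hn; omega

theorem subleadingFamily_degree_aux (n : ℕ) (a : ℕ → ℤ) (s : ℂ) :
    (C s * X ^ n + ∑ i ∈ Finset.range n, C (a i : ℂ) * X ^ i).degree < ((n + 1 : ℕ) : WithBot ℕ) := by
  have h1 : (C s * X ^ n : ℂ[X]).degree < ((n + 1 : ℕ) : WithBot ℕ) :=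
    (degree_C_mul_X_pow_le n s).trans_lt (by exact_mod_cast Nat.lt_succ_self n)
  refine (degree_add_le _ _).trans_lt (max_lt h1 ?_)
  refine (degree_sum_le _ _).trans_lt ?_
  rw [Finset.sup_lt_iff (by exact WithBot.bot_lt_coe _)]
  intro i hi
  refine (degree_C_mul_X_pow_le i _).trans_lt ?_
  simp at hi
  exact_mod_cast hi.trans (Nat.lt_succ_self n)

theorem monic_subleadingFamily (n : ℕ) (a : ℕ → ℤ) (s : ℂ) : (subleadingFamily n a s).Monic := by
  rw [subleadingFamily, add_assoc]
  exact monic_X_pow_add (subleadingFamily_degree_aux n a s)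

theorem natDegree_subleadingFamily (n : ℕ) (a : ℕ → ℤ) (s : ℂ) :
    (subleadingFamily n a s).natDegree = n + 1 := by
  rw [subleadingFamily, add_assoc]
  refine natDegree_eq_of_degree_eq_some ?_
  rw [degree_add_eq_left_of_degree_lt, degree_X_pow]
  rw [degree_X_pow]
  exact subleadingFamily_degree_aux n a s

theorem esymm_of_prod_eq {n : ℕ} {f : ℂ[X]} {r : Fin n → ℂ} (hr : ∏ i, (X - C (r i)) = f)
    {j : ℕ} (hj : j ≤ n) :
    (Finset.univ.val.map r).esymm j = (-1) ^ j * f.coeff (n - j) := by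
  have h := Multiset.prod_X_sub_C_coeff (Finset.univ.val.map r) (k := n - j) (by simp)
  have hcard : (Finset.univ.val.map r).card = n := by simp
  rw [hcard, Nat.sub_sub_self hj, Multiset.map_map] at h
  have h2 : (Finset.univ.val.map ((fun t => X - C t) ∘ r)).prod = f := hr
  rw [h2] at h
  rw [h, ← mul_assoc, ← mul_pow]
  simp

/-- The product is symmetric in the roots, hence an integer polynomial in the elementary symmetric
functions. By Vieta these are, up to sign, the coefficients, all fixed integers except s. -/
theorem exists_poly_of_subsetProducts (n k : ℕ) (b : ℤ) (a : ℕ → ℤ) :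
    ∃ F : ℤ[X], ∀ (s : ℂ) (r : Fin (n + 1) → ℂ),
      ∏ i, (X - C (r i)) = subleadingFamily n a s →
      aeval s F = ∏ S ∈ (Finset.univ : Finset (Fin (n + 1))).powersetCard k,
        (∏ i ∈ S, r i - b) := by
  set e := MvPolynomial.esymmAlgEquiv (Fin (n + 1)) ℤ (n := n + 1) (by simp)
  set φ := subsetProductPoly (Fin (n + 1)) k b
  set ψ := e.symm ⟨φ, subsetProductPoly_isSymmetric _ k b⟩
  have hψ : MvPolynomial.aeval (fun i : Fin (n + 1) =>
      MvPolynomial.esymm (Fin (n + 1)) ℤ (i + 1)) ψ = φ := by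
    rw [← MvPolynomial.esymmAlgHom_apply]
    have : e ψ = ⟨φ, subsetProductPoly_isSymmetric _ k b⟩ := e.apply_symm_apply _
    exact congrArg Subtype.val this
  -- The symmetric function of index i + 1 corresponds to the coefficient of x^(n-i), which is the
  -- variable s exactly for i = 0.
  refine ⟨MvPolynomial.aeval (fun i : Fin (n + 1) =>
    (-1) ^ ((i : ℕ) + 1) * (if n - (i : ℕ) = n then X else C (a (n - i)))) ψ, fun s r hr => ?_⟩
  have h1 : MvPolynomial.aeval r φ = ∏ S ∈ (Finset.univ : Finset (Fin (n + 1))).powersetCard k,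
        (∏ i ∈ S, r i - b) := by
    simp [φ, subsetProductPoly, map_prod]
  rw [← h1, ← hψ, ← AlgHom.comp_apply, ← AlgHom.comp_apply]
  congr 1
  apply MvPolynomial.algHom_ext
  intro i
  simp only [AlgHom.comp_apply, MvPolynomial.aeval_X]
  rw [MvPolynomial.aeval_esymm_eq_multiset_esymm, esymm_of_prod_eq hr (by omega),
    show n + 1 - ((i : ℕ) + 1) = n - i by omega, coeff_subleadingFamily _ _ _ _ (by omega)]
  split_ifs <;> simp

/-- The equation reads r^n (r + s) = -∑ a_i r^i, and |r| ≥ 1/2 gives |r|^i ≤ 2^n |r|^n for i < n. -/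
theorem norm_add_le_of_root_subleadingFamily {n : ℕ} {a : ℕ → ℤ} {s r : ℂ} {M : ℝ}
    (hM : ∀ i < n, ‖(a i : ℂ)‖ ≤ M) (hr : (subleadingFamily n a s).eval r = 0)
    (hr2 : 1 / 2 ≤ ‖r‖) : ‖r + s‖ ≤ n * (M * 2 ^ n) := by
  have hrpos : 0 < ‖r‖ := by linarith
  have h1 : r ^ n * (r + s) = -∑ i ∈ Finset.range n, (a i : ℂ) * r ^ i := by
    simp only [subleadingFamily, eval_add, eval_pow, eval_X, eval_mul, eval_C,
      eval_finsetSum] at hr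
    linear_combination hr
  have h2 : ‖r‖ ^ n * ‖r + s‖ ≤ ‖r‖ ^ n * (n * (M * 2 ^ n)) := by
    rw [← norm_pow, ← norm_mul, h1, norm_neg]
    calc _ ≤ ∑ i ∈ Finset.range n, ‖(a i : ℂ) * r ^ i‖ := norm_sum_le _ _
      _ ≤ ∑ i ∈ Finset.range n, ‖r ^ n‖ * (M * 2 ^ n) := by
        refine Finset.sum_le_sum fun i hi => ?_
        have hi' := Finset.mem_range.1 hi
        have hMi := hM i hi'
        have hM0 := (norm_nonneg _).trans hMi
        rw [norm_mul, norm_pow, norm_pow]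
        have h3 : ‖r‖ ^ i ≤ ‖r‖ ^ n * 2 ^ n := by
          obtain ⟨j, rfl⟩ := Nat.exists_eq_add_of_lt hi'
          have h4 : 1 ≤ (‖r‖ * 2) ^ (j + 1) := one_le_pow₀ (by linarith)
          have h5 : (1 : ℝ) ≤ 2 ^ i := one_le_pow₀ (by norm_num)
          calc ‖r‖ ^ i ≤ ‖r‖ ^ i * ((‖r‖ * 2) ^ (j + 1) * 2 ^ i) :=
                le_mul_of_one_le_right (by positivity) (one_le_mul_of_one_le_of_one_le h4 h5)
            _ = _ := by rw [mul_pow]; ring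
        calc _ ≤ M * (‖r‖ ^ n * 2 ^ n) := by gcongr
          _ = _ := by ring
      _ = _ := by rw [Finset.sum_const, Finset.card_range, nsmul_eq_mul, norm_pow]; ring
  exact le_of_mul_le_mul_left h2 (by positivity)

/-- A root of modulus above 1/2 stays at bounded distance from -s, and the roots sum to -s, so
exactly one of them can be large. -/
theorem eventually_large_root_subleadingFamily (n : ℕ) (a : ℕ → ℤ) :
    ∀ᶠ s : ℝ in atTop, 1 ≤ s ∧ ∀ r : Fin (n + 1) → ℂ,
      ∏ i, (X - C (r i)) = subleadingFamily n a s →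
      ∃ i₀, (∀ i ≠ i₀, ‖r i‖ ≤ 1 / 2) ∧ ‖r i₀‖ ≤ 2 * s := by
  set M : ℝ := ∑ i ∈ Finset.range n, ‖(a i : ℂ)‖
  filter_upwards [eventually_ge_atTop (3 * (n * (M * 2 ^ n))), eventually_gt_atTop (6 * (n + 1 : ℝ)),
    eventually_ge_atTop 1] with s hs1 hs2 hs3
  refine ⟨hs3, fun r hr => ?_⟩
  have hroot : ∀ i, (subleadingFamily n a s).eval (r i) = 0 := by
    intro i
    rw [← hr, eval_prod]
    exact Finset.prod_eq_zero (Finset.mem_univ i) (by simp)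
  have hdich : ∀ i, ‖r i‖ ≤ 1 / 2 ∨ ‖r i + s‖ ≤ s / 3 := by
    intro i
    rcases le_total ‖r i‖ (1 / 2) with h | h
    · exact Or.inl h
    · refine Or.inr ((norm_add_le_of_root_subleadingFamily (M := M) ?_ (hroot i) h).trans ?_)
      · intro j hj
        exact Finset.single_le_sum (f := fun i => ‖(a i : ℂ)‖) (fun _ _ => norm_nonneg _)
          (Finset.mem_range.2 hj)
      · linarith
  have hsum : ∑ i, r i + s = 0 := by
    have h := esymm_of_prod_eq hr (j := 1) (by omega)
    rw [Nat.add_sub_cancel, coeff_subleadingFamily _ _ _ _ le_rfl, Multiset.esymm, Multiset.powersetCard_one] at h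
    simp only [Multiset.map_map, Function.comp_def, Multiset.prod_singleton, if_true] at h
    change ∑ i, r i = _ at h
    rw [h]; ring
  obtain ⟨i₀, hi₀⟩ := exists_unique_large_index (r := r) (s := s) (ρ := 1 / 2) (by norm_num) hdich
    (by rw [hsum, norm_zero]; linarith) (by simp; linarith)
  refine ⟨i₀, hi₀, ?_⟩
  rcases hdich i₀ with h | h
  · linarith
  · have : ‖r i₀‖ ≤ ‖r i₀ + s‖ + ‖(s : ℂ)‖ := by
      simpa using norm_sub_le (r i₀ + s) s
    rw [Complex.norm_real, Real.norm_of_nonneg (by linarith)] at this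
    linarith

/-- Either S or its complement avoids the large root, so its product has modulus below 1. But that
product has the modulus of b or of a0 / b, both nonzero integers. -/
theorem subset_product_ne {n : ℕ} {a0 b : ℤ} (ha0 : a0 ≠ 0) (hb : b ∣ a0)
    {r : Fin (n + 1) → ℂ} (hprod : ‖∏ i, r i‖ = |(a0 : ℝ)|) {i₀ : Fin (n + 1)}
    (hi₀ : ∀ i ≠ i₀, ‖r i‖ ≤ 1 / 2) {S : Finset (Fin (n + 1))} (hS : S.Nonempty)
    (hS' : Sᶜ.Nonempty) : ∏ i ∈ S, r i ≠ b := by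
  intro hSb
  have hsmall : ∀ T : Finset (Fin (n + 1)), T.Nonempty → i₀ ∉ T → ‖∏ i ∈ T, r i‖ < 1 := by
    intro T hT hiT
    rw [norm_prod]
    calc ∏ i ∈ T, ‖r i‖ ≤ ∏ i ∈ T, (1 / 2 : ℝ) :=
          Finset.prod_le_prod (fun _ _ => norm_nonneg _)
            fun i hi => hi₀ i (by rintro rfl; exact hiT hi)
      _ < 1 := by
          rw [Finset.prod_const]
          exact pow_lt_one₀ (by norm_num) (by norm_num) hT.card_pos.ne'
  obtain ⟨c, rfl⟩ := hb
  have hb0 : b ≠ 0 := left_ne_zero_of_mul ha0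
  have hc0 : c ≠ 0 := right_ne_zero_of_mul ha0
  have h1 : (1 : ℝ) ≤ |(b : ℝ)| := by exact_mod_cast Int.one_le_abs hb0
  have h2 : (1 : ℝ) ≤ |(c : ℝ)| := by exact_mod_cast Int.one_le_abs hc0
  have hbn : ‖(b : ℂ)‖ = |(b : ℝ)| := by simp
  by_cases hi : i₀ ∈ S
  · have h3 := hsmall Sᶜ hS' (by simpa using hi)
    rw [← Finset.prod_mul_prod_compl S, hSb, norm_mul, hbn, Int.cast_mul, abs_mul] at hprod
    have : ‖∏ i ∈ Sᶜ, r i‖ = |(c : ℝ)| := mul_left_cancel₀ (by linarith) hprod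
    linarith
  · have h3 := hsmall S hS hi
    rw [hSb, hbn] at h3
    linarith

theorem natDegree_le_of_eventually_abs_le {F : ℝ[X]} {N : ℕ} {β : ℝ} (hβ : 0 ≤ β)
    (h : ∀ᶠ s : ℝ in atTop, |F.eval s| ≤ (2 * s + β) ^ N) : F.natDegree ≤ N := by
  by_contra! hlt
  set G : ℝ[X] := (C 2 * X + C β) ^ N
  have hG : G.degree ≤ N := by
    refine (degree_pow_le _ _).trans ?_
    have : (C 2 * X + C β : ℝ[X]).degree ≤ 1 := degree_linear_le
    calc _ ≤ N • (1 : WithBot ℕ) := nsmul_le_nsmul_right this N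
      _ = N := by simp
  have hF0 : F ≠ 0 := by rintro rfl; simp at hlt
  have hdeg : G.degree < F.degree := by
    rw [degree_eq_natDegree hF0]
    exact hG.trans_lt (by exact_mod_cast hlt)
  have ho := (isLittleO_atTop_of_degree_lt G F hdeg).def (c := 1 / 2) (by norm_num)
  obtain ⟨s, h1, h2, h3⟩ := (h.and (ho.and (eventually_gt_atTop 0))).exists
  have h4 : G.eval s = (2 * s + β) ^ N := by simp [G]
  have h5 : 0 < (2 * s + β) ^ N := by positivity
  rw [h4, Real.norm_of_nonneg h5.le, Real.norm_eq_abs] at h2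
  linarith

/-- F is nonzero because at a large s none of its factors vanishes, by `subset_product_ne`. For the
degree, at most one root exceeds 1 in modulus and it is at most 2s, so each of the C(n+1, k) factors
is at most 2s + |b|. -/
theorem exists_poly_vanishing_of_factor (n k : ℕ) (hk : 1 ≤ k) (hkn : k ≤ n) {b : ℤ} {a : ℕ → ℤ}
    (ha0 : a 0 ≠ 0) (hb : b ∣ a 0) :
    ∃ F : ℤ[X], F ≠ 0 ∧ F.natDegree ≤ (n + 1).choose k ∧
      ∀ (s : ℂ) (r : Fin (n + 1) → ℂ), ∏ i, (X - C (r i)) = subleadingFamily n a s →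
        ∀ S : Finset (Fin (n + 1)), S.card = k → ∏ i ∈ S, r i = b → aeval s F = 0 := by
  obtain ⟨F, hF⟩ := exists_poly_of_subsetProducts n k b a
  have hev : ∀ s : ℝ, aeval (s : ℂ) F = (((F.map (Int.castRingHom ℝ)).eval s : ℝ) : ℂ) := by
    intro s
    rw [eval_map]
    exact aeval_algebraMap_apply ℂ s F
  have hroots : ∀ s : ℝ, ∃ r : Fin (n + 1) → ℂ, ∏ i, (X - C (r i)) = subleadingFamily n a s :=
    fun s => exists_roots_family (monic_subleadingFamily n a s) (natDegree_subleadingFamily n a s)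
  refine ⟨F, ?_, ?_, ?_⟩
  · rintro rfl
    obtain ⟨s, -, hs⟩ := (eventually_large_root_subleadingFamily n a).exists
    obtain ⟨r, hr⟩ := hroots s
    obtain ⟨i₀, hi₀, -⟩ := hs r hr
    have h0 := hF s r hr
    rw [map_zero, eq_comm, Finset.prod_eq_zero_iff] at h0
    obtain ⟨S, hS, hS0⟩ := h0
    rw [Finset.mem_powersetCard] at hS
    refine subset_product_ne ha0 hb ?_ hi₀ (S := S) ?_ ?_ (sub_eq_zero.1 hS0)
    · have := congrArg (eval 0) hr
      have h2 : (subleadingFamily n a s).eval 0 = a 0 := by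
        rw [← coeff_zero_eq_eval_zero, coeff_subleadingFamily _ _ _ _ (by omega),
          if_neg (by omega)]
      rw [h2, eval_prod] at this
      have h3 : ‖∏ i, eval 0 (X - C (r i))‖ = ‖∏ i, r i‖ := by
        rw [norm_prod, norm_prod]; simp
      rw [← h3, this]; simp
    · exact Finset.card_pos.1 (by omega)
    · refine Finset.card_pos.1 ?_
      rw [Finset.card_compl, Fintype.card_fin]; omega
  · rw [← natDegree_map_eq_of_injective (f := Int.castRingHom ℝ) Int.cast_injective F]
    refine natDegree_le_of_eventually_abs_le (β := |(b : ℝ)|) (abs_nonneg _) ?_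
    filter_upwards [eventually_large_root_subleadingFamily n a] with s hs
    obtain ⟨hs1, hs⟩ := hs
    obtain ⟨r, hr⟩ := hroots s
    obtain ⟨i₀, hi₀, hi₀'⟩ := hs r hr
    have h1 : |(F.map (Int.castRingHom ℝ)).eval s| = ‖aeval (s : ℂ) F‖ := by
      rw [hev, Complex.norm_real, Real.norm_eq_abs]
    rw [h1, hF s r hr, norm_prod]
    have hc : (n + 1).choose k = ((Finset.univ : Finset (Fin (n + 1))).powersetCard k).card := by
      simp
    rw [hc, ← Finset.prod_const]
    refine Finset.prod_le_prod (fun _ _ => norm_nonneg _) fun S _ => ?_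
    refine (norm_sub_le _ _).trans (add_le_add ?_ (by simp))
    rw [norm_prod]
    calc ∏ i ∈ S, ‖r i‖ ≤ ∏ i ∈ S, (if i = i₀ then 2 * s else 1) := by
          refine Finset.prod_le_prod (fun _ _ => norm_nonneg _) fun i _ => ?_
          split_ifs with h
          · rwa [h]
          · exact (hi₀ i h).trans (by norm_num)
      _ ≤ 2 * s := by
          rw [Finset.prod_ite_eq']
          split_ifs <;> linarith
  · intro s r hr S hS hSb
    rw [hF s r hr]
    exact Finset.prod_eq_zero (i := S) (by simp [Finset.mem_powersetCard, hS]) (by rw [hSb, sub_self])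

/-! ### Factorisations of the monic integer polynomial -/

theorem monic_monicPoly {d : ℕ} (a : Fin d → ℤ) :
    (monicPoly a).Monic ∧ (monicPoly a).natDegree = d := by
  have hdeg : (∑ i : Fin d, C (a i) * X ^ (i : ℕ)).degree < (d : WithBot ℕ) := by
    refine (degree_sum_le _ _).trans_lt ?_
    rw [Finset.sup_lt_iff (by exact WithBot.bot_lt_coe _)]
    intro i _
    refine (degree_C_mul_X_pow_le _ _).trans_lt ?_
    exact_mod_cast i.2
  refine ⟨monic_X_pow_add hdeg, natDegree_eq_of_degree_eq_some ?_⟩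
  rw [monicPoly, degree_add_eq_left_of_degree_lt, degree_X_pow]
  rw [degree_X_pow]
  exact hdeg

theorem exists_factors_of_not_irreducible {d : ℕ} (hd : d ≠ 0) {a : Fin d → ℤ}
    (h : ¬ Irreducible (monicPoly a)) :
    ∃ g h : ℤ[X], g.Monic ∧ h.Monic ∧ g * h = monicPoly a ∧ 1 ≤ g.natDegree ∧ 1 ≤ h.natDegree ∧
      g.natDegree + h.natDegree = d := by
  obtain ⟨hm, hdeg⟩ := monic_monicPoly a
  rw [hm.irreducible_iff_natDegree'] at h
  have h1 : monicPoly a ≠ 1 := by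
    intro h1; rw [h1, natDegree_one] at hdeg; exact hd hdeg.symm
  simp only [ne_eq, h1, not_false_eq_true, true_and, not_forall] at h
  obtain ⟨f, g, hf, hg, hfg, hmem⟩ := h
  simp only [Finset.mem_Ioc, not_not] at hmem
  have hsum : f.natDegree + g.natDegree = d := by rw [← hdeg, ← hfg, hf.natDegree_mul hg]
  exact ⟨f, g, hf, hg, hfg, by omega, by omega, hsum⟩

theorem irreducible_monicPoly_one (a : Fin 1 → ℤ) : Irreducible (monicPoly a) := by
  by_contra h
  obtain ⟨g, h, -, -, -, h1, h2, h3⟩ := exists_factors_of_not_irreducible one_ne_zero h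
  omega

/-- Extension of a coefficient vector by zero. -/
def extendCoeff {d : ℕ} (a : Fin d → ℤ) (j : ℕ) : ℤ := if h : j < d then a ⟨j, h⟩ else 0

theorem map_monicPoly_eq_subleadingFamily {n : ℕ} (a : Fin (n + 1) → ℤ) :
    (monicPoly a).map (Int.castRingHom ℂ) =
      subleadingFamily n (extendCoeff a) (a (Fin.last n) : ℂ) := by
  have h : ∑ i : Fin (n + 1), C (a i : ℂ) * X ^ (i : ℕ) =
      ∑ i ∈ Finset.range (n + 1), C (extendCoeff a i : ℂ) * X ^ i := by
    rw [Finset.sum_range]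
    refine Finset.sum_congr rfl fun i _ => ?_
    rw [extendCoeff, dif_pos i.2]
  rw [monicPoly, Polynomial.map_add, Polynomial.map_pow, map_X, Polynomial.map_sum]
  simp only [Polynomial.map_mul, map_C, Polynomial.map_pow, map_X]
  simp only [eq_intCast (Int.castRingHom ℂ)]
  rw [h, Finset.sum_range_succ, subleadingFamily]
  have : extendCoeff a n = a (Fin.last n) := by rw [extendCoeff, dif_pos (by omega)]; rfl
  rw [this]; ring

theorem exists_subset_product_of_not_irreducible {n : ℕ} {a : Fin (n + 1) → ℤ}
    (h : ¬ Irreducible (monicPoly a)) :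
    ∃ (k : ℕ) (b : ℤ) (r : Fin (n + 1) → ℂ) (S : Finset (Fin (n + 1))), 1 ≤ k ∧ k ≤ n ∧
      b ∣ a 0 ∧ ∏ i, (X - C (r i)) = subleadingFamily n (extendCoeff a) (a (Fin.last n) : ℂ) ∧
      S.card = k ∧ ∏ i ∈ S, r i = b := by
  obtain ⟨g, h, hg, hh, hgh, hg1, hh1, hsum⟩ := exists_factors_of_not_irreducible (by omega) h
  obtain ⟨r₁, hr₁⟩ := exists_roots_family (hg.map (Int.castRingHom ℂ)) (hg.natDegree_map _)
  obtain ⟨r₂, hr₂⟩ := exists_roots_family (hh.map (Int.castRingHom ℂ)) (hh.natDegree_map _)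
  have hprod : ∏ i, (X - C (Fin.append r₁ r₂ i)) = (monicPoly a).map (Int.castRingHom ℂ) := by
    rw [Fin.prod_univ_add, ← hgh, Polynomial.map_mul, ← hr₁, ← hr₂]
    simp
  -- The roots of f are those of g followed by those of h, and S is the first block; its product is
  -- ±g(0), which divides g(0)h(0) = a 0.
  refine ⟨g.natDegree, (-1) ^ g.natDegree * g.eval 0, Fin.append r₁ r₂ ∘ Fin.cast hsum.symm,
    (Finset.univ.map (Fin.castAddEmb h.natDegree)).map (finCongr hsum).toEmbedding,
    hg1, by omega, ?_, ?_, by simp, ?_⟩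
  · have h0 : (monicPoly a).eval 0 = a 0 := by
      rw [monicPoly, eval_add, eval_finsetSum, Fin.sum_univ_succ]
      simp
    rw [← h0, ← hgh, eval_mul]
    exact ⟨(-1) ^ g.natDegree * h.eval 0, by rw [mul_mul_mul_comm, ← mul_pow]; simp⟩
  · rw [← map_monicPoly_eq_subleadingFamily, ← hprod]
    exact Fintype.prod_equiv (finCongr hsum.symm) _ _ fun i => rfl
  · rw [Finset.prod_map, Finset.prod_map]
    have h0 := congrArg (eval 0) hr₁
    rw [eval_prod] at h0
    simp only [eval_sub, eval_X, eval_C, zero_sub, Finset.prod_neg] at h0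
    have h1 : (g.map (Int.castRingHom ℂ)).eval 0 = ((g.eval 0 : ℤ) : ℂ) := by
      simpa using Polynomial.eval_intCast_map (Int.castRingHom ℂ) g 0
    rw [h1] at h0
    simp only [Int.cast_mul, Int.cast_pow, Int.cast_neg, Int.cast_one, ← h0]
    rw [← mul_assoc]
    simp [← mul_pow]

/-! ### The polynomial recursion of the dependent model -/

theorem totalDegree_aeval_le {σ τ R : Type*} [CommSemiring R] (g : σ → MvPolynomial τ R)
    {M : ℕ} (hg : ∀ i, (g i).totalDegree ≤ M) (p : MvPolynomial σ R) :
    (MvPolynomial.aeval g p).totalDegree ≤ p.totalDegree * M := by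
  rw [MvPolynomial.aeval_def, MvPolynomial.eval₂_eq]
  refine MvPolynomial.totalDegree_finsetSum_le fun s hs => ?_
  refine (MvPolynomial.totalDegree_mul _ _).trans ?_
  rw [MvPolynomial.algebraMap_eq, MvPolynomial.totalDegree_C, zero_add]
  refine (MvPolynomial.totalDegree_finsetProd _ _).trans ?_
  calc ∑ i ∈ s.support, (g i ^ s i).totalDegree ≤ ∑ i ∈ s.support, s i * M :=
        Finset.sum_le_sum fun i _ =>
          (MvPolynomial.totalDegree_pow _ _).trans (Nat.mul_le_mul_left _ (hg i))
    _ = (s.sum fun _ e => e) * M := by rw [Finsupp.sum, Finset.sum_mul]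
    _ ≤ _ := Nat.mul_le_mul_right _ (MvPolynomial.le_totalDegree hs)

namespace StepPoly

variable {d : ℕ} [NeZero d] {i : Fin d}

/-- The substitution `a_0 = c` in polynomials in `a_{i-1}, …, a_0`. -/
def fixZero (i : Fin d) (c : ℝ) :
    MvPolynomial {j : Fin d // j < i} ℝ →ₐ[ℝ] MvPolynomial {j : Fin d // j < i} ℝ :=
  MvPolynomial.bind₁ fun j => if (j : Fin d) = 0 then MvPolynomial.C c else MvPolynomial.X j

theorem value_fixConst (Q : StepPoly i) {c : ℝ} {a : Fin d → ℝ} (ha : a 0 = c) (t : ℝ) :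
    (Q.fixConst c).value a t = Q.value a t := by
  rw [value, value, fixConst, ← MvPolynomial.aeval_eq_eval, MvPolynomial.aeval_bind₁]
  congr 2
  funext v
  rcases v with _ | j
  · simp
  · simp only [Option.elim_some]
    split_ifs with h
    · simp [h, ha]
    · simp

theorem totalDegree_fixConst_le (Q : StepPoly i) (c : ℝ) :
    (Q.fixConst c).totalDegree ≤ Q.totalDegree := by
  rw [fixConst, MvPolynomial.bind₁]
  refine (totalDegree_aeval_le _ (M := 1) ?_ Q).trans (by rw [mul_one])
  rintro (_ | j)
  · simp
  · simp only [Option.elim_some]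
    split_ifs <;> simp

/-- Once a_0 = c is substituted nothing depends on a_0 any more; this is expressed as invariance
under a second substitution. -/
theorem map_fixZero_optionEquivLeft (Q : StepPoly i) (c : ℝ) :
    (MvPolynomial.optionEquivLeft ℝ _ (Q.fixConst c)).map (fixZero i c : _ →+* _) =
      MvPolynomial.optionEquivLeft ℝ _ (Q.fixConst c) := by
  have h : ((Polynomial.mapAlgHom (fixZero i c)).comp
      (MvPolynomial.optionEquivLeft ℝ _).toAlgHom).comp (MvPolynomial.bind₁
        (fun v : Option {j : Fin d // j < i} => v.elim (MvPolynomial.X none) fun j =>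
          if (j : Fin d) = 0 then MvPolynomial.C c else MvPolynomial.X (some j))) =
      ((MvPolynomial.optionEquivLeft ℝ _).toAlgHom).comp (MvPolynomial.bind₁
        (fun v : Option {j : Fin d // j < i} => v.elim (MvPolynomial.X none) fun j =>
          if (j : Fin d) = 0 then MvPolynomial.C c else MvPolynomial.X (some j))) := by
    apply MvPolynomial.algHom_ext
    rintro (_ | j)
    · simp
    · by_cases hj : (j : Fin d) = 0 <;> simp [hj, fixZero]
  exact DFunLike.congr_fun h Q

theorem eval_fixZero (p : MvPolynomial {j : Fin d // j < i} ℝ) (c : ℝ)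
    (a : {j : Fin d // j < i} → ℝ) :
    MvPolynomial.eval a (fixZero i c p) =
      MvPolynomial.eval (fun j => if j.1 = 0 then c else a j) p := by
  rw [fixZero, ← MvPolynomial.aeval_eq_eval, MvPolynomial.aeval_bind₁, MvPolynomial.aeval_eq_eval]
  congr 2
  funext j
  split_ifs <;> simp

/-- The leading coefficient of `Q(a_{i-1}, …, a_1, c, t)` with respect to `t`, as a polynomial in
all the variables `a_j`. -/
def lead (Q : StepPoly i) (c : ℝ) : MvPolynomial (Fin d) ℝ :=
  MvPolynomial.rename Subtype.val
    (MvPolynomial.optionEquivLeft ℝ _ (Q.fixConst c)).leadingCoeff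

theorem lead_ne_zero {Q : StepPoly i} {c : ℝ} (h : 0 < (Q.fixConst c).degreeOf none) :
    Q.lead c ≠ 0 := by
  rw [lead, Ne, ← map_zero (MvPolynomial.rename Subtype.val),
    (MvPolynomial.rename_injective _ Subtype.val_injective).eq_iff, Polynomial.leadingCoeff_eq_zero]
  intro h0
  rw [← MvPolynomial.natDegree_optionEquivLeft, h0] at h
  simp at h

theorem totalDegree_lead_le (Q : StepPoly i) (c : ℝ) : (Q.lead c).totalDegree ≤ Q.totalDegree := by
  rw [lead]
  exact (MvPolynomial.totalDegree_rename_le _ _).trans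
    ((MvPolynomial.totalDegree_coeff_optionEquivLeft_le _ _ _ _).trans (totalDegree_fixConst_le Q c))

theorem eval_lead (Q : StepPoly i) (c : ℝ) (a : Fin d → ℝ) :
    MvPolynomial.eval a (Q.lead c) = MvPolynomial.eval (fun j : {j : Fin d // j < i} => a j)
      (MvPolynomial.optionEquivLeft ℝ _ (Q.fixConst c)).leadingCoeff := by
  rw [lead, MvPolynomial.eval_rename]; rfl

/-- Only the variables a_1, …, a_{i-1} survive in the leading coefficient, so a_0 may be reset to c
without affecting its vanishing. -/
theorem eval_lead_congr (Q : StepPoly i) (c : ℝ) {a a' : Fin d → ℝ}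
    (h : ∀ j, j ≠ 0 → j < i → a j = a' j) :
    MvPolynomial.eval a (Q.lead c) = MvPolynomial.eval a' (Q.lead c) := by
  have key : ∀ a : Fin d → ℝ, MvPolynomial.eval a (Q.lead c) =
      MvPolynomial.eval (fun j : {j : Fin d // j < i} => if (j : Fin d) = 0 then c else a j)
      (MvPolynomial.optionEquivLeft ℝ _ (Q.fixConst c)).leadingCoeff := by
    intro a
    rw [eval_lead, ← eval_fixZero]
    congr 1
    have h := congrArg (fun q => q.coeff
      (MvPolynomial.optionEquivLeft ℝ _ (Q.fixConst c)).natDegree)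
      (map_fixZero_optionEquivLeft Q c)
    simp only [Polynomial.coeff_map] at h
    exact h.symm
  rw [key, key]
  congr 2
  funext j
  split_ifs with hj
  · rfl
  · exact h j hj j.2

/-- For fixed `a`, the polynomial `Q(a_{i-1}, …, a_1, c, t)` in `t`. -/
def slice (Q : StepPoly i) (c : ℝ) (a : Fin d → ℝ) : ℝ[X] :=
  (MvPolynomial.optionEquivLeft ℝ _ (Q.fixConst c)).map
    (MvPolynomial.eval fun j : {j : Fin d // j < i} => a j)

theorem eval_slice (Q : StepPoly i) {c : ℝ} {a : Fin d → ℝ} (ha : a 0 = c) (t : ℝ) :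
    (Q.slice c a).eval t = Q.value a t := by
  rw [slice, ← MvPolynomial.optionEquivLeft_elim_eval, ← value_fixConst Q ha]
  rfl

theorem natDegree_slice_le (Q : StepPoly i) (c : ℝ) (a : Fin d → ℝ) :
    (Q.slice c a).natDegree ≤ Q.totalDegree := by
  refine Polynomial.natDegree_map_le.trans ?_
  rw [MvPolynomial.natDegree_optionEquivLeft]
  exact (MvPolynomial.degreeOf_le_totalDegree _ _).trans (totalDegree_fixConst_le Q c)

theorem natDegree_slice_pos {Q : StepPoly i} {c : ℝ} {a : Fin d → ℝ}
    (h : 0 < (Q.fixConst c).degreeOf none) (ha : MvPolynomial.eval a (Q.lead c) ≠ 0) :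
    0 < (Q.slice c a).natDegree := by
  rw [eval_lead] at ha
  rw [slice, Polynomial.natDegree_map_of_leadingCoeff_ne_zero _ ha,
    MvPolynomial.natDegree_optionEquivLeft]
  exact h

theorem value_congr (Q : StepPoly i) {a a' : Fin d → ℝ} (h : ∀ j < i, a j = a' j) (t : ℝ) :
    Q.value a t = Q.value a' t := by
  rw [value, value]
  congr 2
  funext v
  rcases v with _ | j
  · rfl
  · exact h j j.2

/-- The coefficient `a_i` as a polynomial in the variables `t_j`, when `a_0 = c`. -/
def unfold (Q : ∀ i : {i : Fin d // i ≠ 0}, StepPoly i.1) (c : ℝ) (i : Fin d) :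
    MvPolynomial {i : Fin d // i ≠ 0} ℝ :=
  if h : i = 0 then MvPolynomial.C c
  else MvPolynomial.aeval (fun v : Option {j : Fin d // j < i} =>
    v.elim (MvPolynomial.X ⟨i, h⟩) fun j => unfold Q c j.1) (Q ⟨i, h⟩)
termination_by i
decreasing_by exact j.2

/-- The vector `a` obeys the recursion with initial value `c` and parameters `t`. -/
def Obeys (Q : ∀ i : {i : Fin d // i ≠ 0}, StepPoly i.1) (c : ℝ)
    (t : {i : Fin d // i ≠ 0} → ℝ) (a : Fin d → ℝ) : Prop :=
  a 0 = c ∧ ∀ i : {i : Fin d // i ≠ 0}, a i = (Q i).value a (t i)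

variable {Q : ∀ i : {i : Fin d // i ≠ 0}, StepPoly i.1} {c : ℝ}

theorem eval_unfold_zero (t : {i : Fin d // i ≠ 0} → ℝ) :
    MvPolynomial.eval t (unfold Q c 0) = c := by
  rw [unfold, dif_pos rfl]; simp

theorem eval_unfold (t : {i : Fin d // i ≠ 0} → ℝ) (i : {i : Fin d // i ≠ 0}) :
    MvPolynomial.eval t (unfold Q c i) =
      (Q i).value (fun j => MvPolynomial.eval t (unfold Q c j)) (t i) := by
  rw [unfold, dif_neg i.2, value, ← MvPolynomial.aeval_eq_eval, MvPolynomial.aeval_eq_bind₁,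
    MvPolynomial.aeval_bind₁, MvPolynomial.aeval_eq_eval]
  congr 2
  funext v
  rcases v with _ | j
  · simp
  · simp

theorem obeys_unfold (t : {i : Fin d // i ≠ 0} → ℝ) :
    Obeys Q c t fun j => MvPolynomial.eval t (unfold Q c j) :=
  ⟨eval_unfold_zero t, eval_unfold t⟩

/-- The recursion determines each coefficient from the parameters with smaller or equal index. -/
theorem Obeys.eq_of_agree {t t' : {i : Fin d // i ≠ 0} → ℝ} {a a' : Fin d → ℝ}
    (h : Obeys Q c t a) (h' : Obeys Q c t' a') (i : Fin d)
    (htt : ∀ j : {i : Fin d // i ≠ 0}, j.1 ≤ i → t j = t' j) : a i = a' i := by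
  induction i using WellFoundedLT.induction with
  | ind i ih =>
    rcases eq_or_ne i 0 with rfl | hi
    · rw [h.1, h'.1]
    · rw [h.2 ⟨i, hi⟩, h'.2 ⟨i, hi⟩, htt ⟨i, hi⟩ le_rfl]
      exact value_congr _ (fun j hj => ih j hj fun k hk => htt k (hk.trans hj.le)) _

theorem totalDegree_unfold_le {L : ℕ} (hL : 1 ≤ L) (hQ : ∀ i, (Q i).totalDegree ≤ L) (i : Fin d) :
    (unfold Q c i).totalDegree ≤ L ^ (i : ℕ) := by
  induction i using WellFoundedLT.induction with
  | ind i ih =>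
    rw [unfold]
    split_ifs with h
    · simp
    · have hi : (i : ℕ) ≠ 0 := fun h0 => h (Fin.ext (by simpa using h0))
      refine (totalDegree_aeval_le _ (M := L ^ ((i : ℕ) - 1)) ?_ _).trans ?_
      · rintro (_ | j)
        · simpa using Nat.one_le_pow _ _ hL
        · refine (ih j.1 j.2).trans (Nat.pow_le_pow_right hL ?_)
          have : (j.1 : ℕ) < i := j.2
          omega
      · calc _ ≤ L * L ^ ((i : ℕ) - 1) := Nat.mul_le_mul_right _ (hQ _)
          _ = L ^ (i : ℕ) := by rw [← pow_succ', Nat.sub_add_cancel (by omega)]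

/-- There are parameters for which the leading coefficients do not vanish. -/
theorem exists_obeys_lead_ne_zero (hpos : ∀ i, 0 < ((Q i).fixConst c).degreeOf none) :
    ∃ (t : {i : Fin d // i ≠ 0} → ℝ) (a : Fin d → ℝ), Obeys Q c t a ∧
      ∀ i, MvPolynomial.eval a ((Q i).lead c) ≠ 0 := by
  classical
  set R : MvPolynomial (Fin d) ℝ := ∏ i, (Q i).lead c with hR
  have hR0 : R ≠ 0 := Finset.prod_ne_zero_iff.2 fun i _ => lead_ne_zero (hpos i)
  have hlead : ∀ a, MvPolynomial.eval a R ≠ 0 → ∀ i, MvPolynomial.eval a ((Q i).lead c) ≠ 0 := by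
    intro a ha i
    rw [hR, map_prod] at ha
    exact (Finset.prod_ne_zero_iff.1 ha) i (Finset.mem_univ i)
  -- Starting from any point where R is nonzero, the coordinates are replaced one at a time by
  -- values obeying the recursion, keeping R nonzero. Changing coordinate m does not disturb the
  -- steps already settled.
  have key : ∀ m : ℕ, m ≤ d → ∃ (t : {i : Fin d // i ≠ 0} → ℝ) (a : Fin d → ℝ), a 0 = c ∧
      (∀ i : {i : Fin d // i ≠ 0}, (i.1 : ℕ) < m → a i = (Q i).value a (t i)) ∧
      MvPolynomial.eval a R ≠ 0 := by
    intro m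
    induction m with
    | zero =>
      intro _
      obtain ⟨a, ha⟩ : ∃ a, MvPolynomial.eval a R ≠ 0 := by
        by_contra! h
        exact hR0 (MvPolynomial.funext fun a => by rw [h a, map_zero])
      refine ⟨0, Function.update a 0 c, by simp, by simp, ?_⟩
      have : MvPolynomial.eval (Function.update a 0 c) R = MvPolynomial.eval a R := by
        rw [hR, map_prod, map_prod]
        refine Finset.prod_congr rfl fun i _ => eval_lead_congr _ _ fun j hj _ => ?_
        rw [Function.update_of_ne hj]
      rwa [this]
    | succ m ih =>
      intro hm
      obtain ⟨t, a, ha0, hrec, hne⟩ := ih (by omega)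
      by_cases hm0 : (⟨m, hm⟩ : Fin d) = 0
      · refine ⟨t, a, ha0, fun i hi => ?_, hne⟩
        rcases Nat.lt_succ_iff_lt_or_eq.1 hi with h | h
        · exact hrec i h
        · exact absurd ((Fin.ext h : i.1 = ⟨m, hm⟩).trans hm0) i.2
      · set i : {i : Fin d // i ≠ 0} := ⟨⟨m, hm⟩, hm0⟩
        set p : ℝ[X] := MvPolynomial.aeval
          (fun j => if j = i.1 then Polynomial.X else Polynomial.C (a j)) R with hp
        have hpe : ∀ y, p.eval y = MvPolynomial.eval (Function.update a i.1 y) R := by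
          intro y
          rw [hp, ← Polynomial.coe_evalRingHom, MvPolynomial.aeval_def,
            MvPolynomial.hom_eval₂, MvPolynomial.eval, MvPolynomial.coe_eval₂Hom]
          congr 1
          · ext; simp
          · funext j
            by_cases hj : j = i.1
            · subst hj; simp
            · simp [hj]
        have hp0 : p ≠ 0 := by
          intro h0
          apply hne
          have := hpe (a i.1)
          rw [Function.update_eq_self, h0] at this
          simpa using this.symm
        have hq := natDegree_slice_pos (hpos i) (hlead a hne i)
        -- As a polynomial p in coordinate i, R is nonzero, and the slice is nonconstant because its
        -- leading coefficient survives at `a`. So the composition is nonzero and some parameter y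
        -- keeps R ≠ 0.
        have hcomp : p.comp ((Q i).slice c a) ≠ 0 := by
          intro h0
          rcases Polynomial.comp_eq_zero_iff.1 h0 with h | ⟨-, h⟩
          · exact hp0 h
          · rw [h] at hq; simp at hq
        obtain ⟨y, hy⟩ : ∃ y, (p.comp ((Q i).slice c a)).eval y ≠ 0 := by
          by_contra! h
          exact hcomp (Polynomial.funext fun a => by rw [h a, Polynomial.eval_zero])
        rw [Polynomial.eval_comp, hpe, eval_slice _ ha0] at hy
        have hvc : ∀ k : {i : Fin d // i ≠ 0}, (k.1 : ℕ) ≤ m → ∀ s,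
            (Q k).value (Function.update a i.1 ((Q i).value a y)) s = (Q k).value a s := by
          intro k hk s
          refine value_congr _ (fun j hj => Function.update_of_ne ?_ _ _) s
          intro hji
          have h1 : (j : ℕ) < k.1 := hj
          have h2 : (j : ℕ) = m := congrArg Fin.val hji
          omega
        refine ⟨Function.update t i y, Function.update a i.1 ((Q i).value a y), ?_, ?_, hy⟩
        · rw [Function.update_of_ne (Ne.symm hm0), ha0]
        · intro k hk
          rw [hvc k (by omega)]
          rcases eq_or_ne k i with rfl | hki
          · simp
          · have hki' : k.1 ≠ i.1 := fun h => hki (Subtype.ext h)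
            rw [Function.update_of_ne hki', Function.update_of_ne hki]
            refine hrec k ?_
            have : (k.1 : ℕ) ≠ m := fun h => hki' (Fin.ext h)
            omega
  obtain ⟨t, a, h0, hrec, hne⟩ := key d le_rfl
  exact ⟨t, a, ⟨h0, fun i => hrec i i.1.2⟩, hlead a hne⟩

end StepPoly

/-! ### Counting in product sets -/

/-- Schwartz–Zippel on a product of sets of the same size, over any finite index type. -/
theorem card_zeros_mul_le {ι : Type*} [Fintype ι] [DecidableEq ι] {p : MvPolynomial ι ℝ}
    (hp : p ≠ 0) {T : ι → Finset ℝ} {H : ℕ} (hT : ∀ i, (T i).card = H) :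
    ((Fintype.piFinset T).filter fun t => MvPolynomial.eval t p = 0).card * H ≤
      Fintype.card ι * p.totalDegree * H ^ Fintype.card ι := by
  rcases Nat.eq_zero_or_pos H with rfl | hH
  · simp
  set e := Fintype.equivFin ι
  set p' := MvPolynomial.rename e p
  have hp' : p' ≠ 0 := by
    rw [Ne, ← map_zero (MvPolynomial.rename e), (MvPolynomial.rename_injective _ e.injective).eq_iff]
    exact hp
  have h := MvPolynomial.schwartz_zippel_sum_degreeOf hp' fun i => T (e.symm i)
  have hcard : ((Fintype.piFinset T).filter fun t => MvPolynomial.eval t p = 0).card ≤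
      ((Fintype.piFinset fun i => T (e.symm i)).filter
        fun t => MvPolynomial.eval t p' = 0).card := by
    refine Finset.card_le_card_of_injOn (fun t => t ∘ e.symm) ?_ ?_
    · intro t ht
      simp only [Finset.coe_filter, Fintype.mem_piFinset, Set.mem_ofPred_eq] at ht ⊢
      refine ⟨fun i => ht.1 _, ?_⟩
      rw [MvPolynomial.eval_rename, Function.comp_assoc, Equiv.symm_comp_self, Function.comp_id]
      exact ht.2
    · intro t _ t' _ h
      funext i
      simpa using congrFun h (e i)
  simp only [hT, Finset.prod_const, Finset.card_univ, Fintype.card_fin] at h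
  rw [← Finset.sum_div] at h
  have hHq : (0 : ℚ≥0) < H := by exact_mod_cast hH
  rw [div_le_div_iff₀ (by positivity) hHq] at h
  have h2 : ∑ i, p'.degreeOf i ≤ Fintype.card ι * p.totalDegree := by
    calc ∑ i, p'.degreeOf i ≤ ∑ _i : Fin (Fintype.card ι), p.totalDegree :=
          Finset.sum_le_sum fun i _ => (MvPolynomial.degreeOf_le_totalDegree _ _).trans
            (MvPolynomial.totalDegree_rename_le _ _)
      _ = _ := by simp
  have h' : ((Fintype.piFinset fun i => T (e.symm i)).filter
        fun t => MvPolynomial.eval t p' = 0).card * H ≤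
        (∑ i, p'.degreeOf i) * H ^ Fintype.card ι := by exact_mod_cast h
  calc _ ≤ _ := Nat.mul_le_mul_right _ hcard
    _ ≤ _ := h'
    _ ≤ _ := Nat.mul_le_mul_right _ h2

/-- If each line in direction `i` meets `E` at most `N` times, then `E` is small. -/
theorem card_mul_le_of_fibers {ι α : Type*} [Fintype ι] [DecidableEq ι] [DecidableEq α]
    {T : ι → Finset α} {H N : ℕ} (hT : ∀ i, (T i).card = H) {E : Finset (ι → α)}
    (hE : E ⊆ Fintype.piFinset T) (i : ι)
    (h : ∀ t, ((T i).filter fun y => Function.update t i y ∈ E).card ≤ N) :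
    E.card * H ≤ N * H ^ Fintype.card ι := by
  -- Exchanging y with the i-th coordinate of t is injective, and the old coordinate is then a point
  -- of E on the line through the new point.
  have h1 : (E ×ˢ T i).card ≤ ((Fintype.piFinset T).sigma fun t =>
      (T i).filter fun y => Function.update t i y ∈ E).card := by
    refine Finset.card_le_card_of_injOn (fun x => ⟨Function.update x.1 i x.2, x.1 i⟩) ?_ ?_
    · rintro ⟨t, y⟩ hx
      simp only [Finset.coe_product, Set.mem_prod, Finset.mem_coe] at hx
      have ht := Fintype.mem_piFinset.1 (hE hx.1)
      simp only [Finset.coe_sigma, Set.mem_sigma_iff, Finset.mem_coe, Fintype.mem_piFinset,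
        Finset.mem_filter]
      refine ⟨fun j => ?_, ht i, by simpa using hx.1⟩
      rcases eq_or_ne j i with rfl | hj
      · simpa using hx.2
      · rw [Function.update_of_ne hj]; exact ht j
    · rintro ⟨t, y⟩ _ ⟨t', y'⟩ _ hxy
      simp only [Sigma.mk.injEq, heq_eq_eq] at hxy
      have hy : y = y' := by simpa using congrFun hxy.1 i
      refine Prod.ext (funext fun j => ?_) hy
      rcases eq_or_ne j i with rfl | hj
      · exact hxy.2
      · simpa [Function.update_of_ne hj] using congrFun hxy.1 j
  rw [Finset.card_product, hT, Finset.card_sigma] at h1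
  calc _ ≤ _ := h1
    _ ≤ ∑ _t ∈ Fintype.piFinset T, N := Finset.sum_le_sum fun t _ => h t
    _ = _ := by
      rw [Finset.sum_const, Fintype.card_piFinset]
      simp only [hT, Finset.prod_const, Finset.card_univ, smul_eq_mul]
      ring

/-! ### Reducible parameters for a fixed nonzero constant coefficient -/

/-- The positive and negative divisors of an integer. -/
def intDivisors (v : ℤ) : Finset ℤ :=
  v.natAbs.divisors.image (fun m : ℕ => (m : ℤ)) ∪ v.natAbs.divisors.image fun m : ℕ => -(m : ℤ)

theorem card_intDivisors_le (v : ℤ) : (intDivisors v).card ≤ 2 * v.natAbs.divisors.card := by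
  rw [two_mul]
  exact (Finset.card_union_le _ _).trans (add_le_add Finset.card_image_le Finset.card_image_le)

theorem mem_intDivisors {v b : ℤ} (hv : v ≠ 0) : b ∈ intDivisors v ↔ b ∣ v := by
  simp only [intDivisors, Finset.mem_union, Finset.mem_image, Nat.mem_divisors]
  constructor
  · rintro (⟨m, ⟨hm, -⟩, rfl⟩ | ⟨m, ⟨hm, -⟩, rfl⟩)
    · exact Int.natCast_dvd.2 hm
    · exact (Int.neg_dvd).2 (Int.natCast_dvd.2 hm)
  · intro h
    have h1 := Int.natAbs_dvd_natAbs.2 h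
    have h2 : v.natAbs ≠ 0 := by simpa using hv
    rcases Int.natAbs_eq b with hb | hb
    · exact Or.inl ⟨_, ⟨h1, h2⟩, hb.symm⟩
    · exact Or.inr ⟨_, ⟨h1, h2⟩, hb.symm⟩

/-- The parameters for which some integer coefficient vector obeying the recursion gives a
reducible polynomial. -/
def IsReducibleParam {d : ℕ} [NeZero d] (Q : ∀ i : {i : Fin d // i ≠ 0}, StepPoly i.1) (v : ℤ)
    (t : {i : Fin d // i ≠ 0} → ℝ) : Prop :=
  ∃ a : Fin d → ℤ, StepPoly.Obeys Q v t (fun j => (a j : ℝ)) ∧ ¬ Irreducible (monicPoly a)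

namespace StepPoly

theorem Obeys.eval_aeval_unfold {d : ℕ} [NeZero d] {Q : ∀ i : {i : Fin d // i ≠ 0}, StepPoly i.1}
    {c : ℝ} {t : {i : Fin d // i ≠ 0} → ℝ} {a : Fin d → ℝ} (h : Obeys Q c t a)
    (s : MvPolynomial (Fin d) ℝ) :
    MvPolynomial.eval t (MvPolynomial.aeval (unfold Q c) s) = MvPolynomial.eval a s := by
  have : a = fun j => MvPolynomial.eval t (unfold Q c j) :=
    funext fun j => h.eq_of_agree (obeys_unfold t) j fun _ _ => rfl
  rw [this, ← MvPolynomial.aeval_eq_eval, MvPolynomial.aeval_eq_bind₁, MvPolynomial.aeval_bind₁,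
    MvPolynomial.aeval_eq_eval]

/-- The condition on the parameters that the leading coefficient of the last step vanishes. -/
def lastLead {n : ℕ} (Q : ∀ i : {i : Fin (n + 1) // i ≠ 0}, StepPoly i.1) (c : ℝ)
    (l : {i : Fin (n + 1) // i ≠ 0}) : MvPolynomial {i : Fin (n + 1) // i ≠ 0} ℝ :=
  MvPolynomial.aeval (unfold Q c) ((Q l).lead c)

end StepPoly

open StepPoly

theorem sum_choose_Icc_le (n : ℕ) : ∑ k ∈ Finset.Icc 1 n, (n + 1).choose k ≤ 2 ^ (n + 1) := by
  rw [← Nat.sum_range_choose]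
  refine Finset.sum_le_sum_of_subset fun k hk => ?_
  simp at hk ⊢; omega

open scoped Classical in
-- Along a line in the last parameter y all coefficients but the last are constant, and the last one
-- is q(y) with q nonconstant of degree at most L. A bad y is a root of F ∘ q for one of the
-- polynomials F attached to some 1 ≤ k ≤ n and b ∣ v; the degrees add up to the bound.
theorem card_reducible_fiber_le {n L : ℕ} {Q : ∀ i : {i : Fin (n + 1) // i ≠ 0}, StepPoly i.1}
    {v : ℤ} (hv : v ≠ 0) (hL : ∀ i, (Q i).totalDegree ≤ L)
    (hpos : ∀ i, 0 < ((Q i).fixConst v).degreeOf none) {l : {i : Fin (n + 1) // i ≠ 0}}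
    (hl : l.1 = Fin.last n) (T : Finset ℝ) (t : {i : Fin (n + 1) // i ≠ 0} → ℝ) :
    (T.filter fun y => IsReducibleParam Q v (Function.update t l y) ∧
      MvPolynomial.eval (Function.update t l y) (lastLead Q v l) ≠ 0).card ≤
      2 ^ (n + 1) * L * (2 * v.natAbs.divisors.card) := by
  classical
  set B := T.filter fun y => IsReducibleParam Q v (Function.update t l y) ∧
      MvPolynomial.eval (Function.update t l y) (lastLead Q v l) ≠ 0 with hB
  rcases B.eq_empty_or_nonempty with h0 | ⟨y₀, hy₀⟩
  · simp [h0]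
  -- Any point of the bad set supplies the common integer values of the lower coefficients.
  obtain ⟨-, ⟨a₀, ha₀, -⟩, hlead⟩ := Finset.mem_filter.1 hy₀
  rw [lastLead, ha₀.eval_aeval_unfold] at hlead
  have ha00 : a₀ 0 = v := by
    have h : ((a₀ 0 : ℤ) : ℝ) = v := ha₀.1
    exact_mod_cast h
  set q := (Q l).slice v fun j => (a₀ j : ℝ) with hq
  have hq0 : 0 < q.natDegree := natDegree_slice_pos (hpos l) hlead
  have hqL : q.natDegree ≤ L := (natDegree_slice_le _ _ _).trans (hL l)
  have hext : extendCoeff a₀ 0 = v := by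
    rw [extendCoeff, dif_pos (by omega)]; exact ha00
  -- The conditions on k and b are moved behind the existential, with default 0, so that F can be
  -- chosen as a total function.
  have hF : ∀ (k : ℕ) (b : ℤ), ∃ F : ℤ[X], 1 ≤ k → k ≤ n → b ∣ v →
      F ≠ 0 ∧ F.natDegree ≤ (n + 1).choose k ∧
      ∀ (s : ℂ) (r : Fin (n + 1) → ℂ),
        ∏ i, (X - C (r i)) = subleadingFamily n (extendCoeff a₀) s →
        ∀ S : Finset (Fin (n + 1)), S.card = k → ∏ i ∈ S, r i = b → aeval s F = 0 := by
    intro k b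
    by_cases h : 1 ≤ k ∧ k ≤ n ∧ b ∣ v
    · obtain ⟨F, hF⟩ := exists_poly_vanishing_of_factor n k h.1 h.2.1 (b := b)
        (a := extendCoeff a₀) (by rwa [hext]) (by rw [hext]; exact h.2.2)
      exact ⟨F, fun _ _ _ => hF⟩
    · exact ⟨0, fun h1 h2 h3 => absurd ⟨h1, h2, h3⟩ h⟩
  choose F hF using hF
  set G : ℕ → ℤ → ℝ[X] := fun k b => ((F k b).map (Int.castRingHom ℝ)).comp q with hG
  have hsub : B ⊆ (Finset.Icc 1 n).biUnion fun k => (intDivisors v).biUnion fun b =>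
      (G k b).roots.toFinset := by
    intro y hy
    obtain ⟨-, ⟨a, ha, hred⟩, -⟩ := Finset.mem_filter.1 hy
    have hagree : ∀ j : Fin (n + 1), j < Fin.last n → a j = a₀ j := by
      intro j hj
      have := ha.eq_of_agree ha₀ j fun k hk => by
        have hkl : k ≠ l := by
          rintro rfl
          rw [hl] at hk
          exact absurd (hk.trans_lt hj) (lt_irrefl _)
        rw [Function.update_of_ne hkl, Function.update_of_ne hkl]
      exact_mod_cast this
    obtain ⟨k, b, r, S, hk1, hkn, hb, hr, hS, hSb⟩ := exists_subset_product_of_not_irreducible hred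
    have hfam : subleadingFamily n (extendCoeff a) (a (Fin.last n) : ℂ) =
        subleadingFamily n (extendCoeff a₀) (a (Fin.last n) : ℂ) := by
      rw [subleadingFamily, subleadingFamily]
      congr 1
      refine Finset.sum_congr rfl fun i hi => ?_
      have hi' := Finset.mem_range.1 hi
      rw [extendCoeff, extendCoeff, dif_pos (by omega), dif_pos (by omega), hagree _ hi']
    rw [hfam] at hr
    have ha0 : a 0 = v := by
      have h : ((a 0 : ℤ) : ℝ) = v := ha.1
      exact_mod_cast h
    rw [ha0] at hb
    obtain ⟨hF0, -, hFv⟩ := hF k b hk1 hkn hb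
    have hval := hFv _ r hr S hS hSb
    have hqy : q.eval y = a (Fin.last n) := by
      have h1 := ha.2 l
      simp only [Function.update_self] at h1
      rw [hq, eval_slice _ ha₀.1, ← hl, h1]
      refine value_congr _ (fun j hj => ?_) y
      rw [hagree j (by rwa [← hl])]
    simp only [Finset.mem_biUnion, Finset.mem_Icc]
    refine ⟨k, ⟨hk1, hkn⟩, b, (mem_intDivisors hv).2 hb, ?_⟩
    rw [Multiset.mem_toFinset, mem_roots']
    refine ⟨?_, ?_⟩
    · rw [hG]
      intro h0
      rcases comp_eq_zero_iff.1 h0 with h | ⟨-, h⟩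
      · exact hF0 ((Polynomial.map_eq_zero_iff Int.cast_injective).1 h)
      · rw [h] at hq0; simp at hq0
    · rw [IsRoot.def, hG, eval_comp, hqy]
      have h1 : aeval ((a (Fin.last n) : ℤ) : ℂ) (F k b) = (((F k b).eval (a (Fin.last n)) : ℤ) : ℂ) := by
        simpa using aeval_algebraMap_apply ℂ (a (Fin.last n)) (F k b)
      rw [h1] at hval
      have h2 := eval_intCast_map (Int.castRingHom ℝ) (F k b) (a (Fin.last n))
      rw [h2]
      have h3 : (F k b).eval (a (Fin.last n)) = 0 := by exact_mod_cast hval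
      simp [h3]
  calc B.card ≤ _ := Finset.card_le_card hsub
    _ ≤ ∑ k ∈ Finset.Icc 1 n, ∑ b ∈ intDivisors v, (n + 1).choose k * L := by
        refine Finset.card_biUnion_le.trans (Finset.sum_le_sum fun k hk => ?_)
        refine Finset.card_biUnion_le.trans (Finset.sum_le_sum fun b hb => ?_)
        rw [Finset.mem_Icc] at hk
        obtain ⟨-, hdeg, -⟩ := hF k b hk.1 hk.2 ((mem_intDivisors hv).1 hb)
        refine (Multiset.toFinset_card_le _).trans ((card_roots' _).trans ?_)
        rw [hG, natDegree_comp]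
        exact Nat.mul_le_mul (natDegree_map_le.trans hdeg) hqL
    _ = (∑ k ∈ Finset.Icc 1 n, (n + 1).choose k) * L * (intDivisors v).card := by
        simp only [Finset.sum_const, smul_eq_mul]
        rw [Finset.sum_mul, Finset.sum_mul]
        exact Finset.sum_congr rfl fun _ _ => by ring
    _ ≤ _ := by
        have := sum_choose_Icc_le n
        have := card_intDivisors_le v
        gcongr

open scoped Classical in
-- Where the leading coefficient of the last step vanishes, Schwartz–Zippel gives the term d L^d;
-- elsewhere the line count applies in the last direction.
theorem card_reducibleParam_mul_le {d L H : ℕ} [NeZero d] (hd : 2 ≤ d)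
    {Q : ∀ i : {i : Fin d // i ≠ 0}, StepPoly i.1} {v : ℤ} (hv : v ≠ 0) (hL1 : 1 ≤ L)
    (hL : ∀ i, (Q i).totalDegree ≤ L) (hpos : ∀ i, 0 < ((Q i).fixConst v).degreeOf none)
    {T : {i : Fin d // i ≠ 0} → Finset ℝ} (hT : ∀ i, (T i).card = H) :
    ((Fintype.piFinset T).filter fun t => IsReducibleParam Q v t).card * H ≤
      (d * L ^ d + 2 ^ d * L * (2 * v.natAbs.divisors.card)) * H ^ (d - 1) := by
  classical
  obtain ⟨n, rfl⟩ : ∃ n, d = n + 1 := ⟨d - 1, by omega⟩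
  have hn : Fin.last n ≠ 0 := by
    intro h
    have := congrArg Fin.val h
    simp at this; omega
  set l : {i : Fin (n + 1) // i ≠ 0} := ⟨Fin.last n, hn⟩
  have hcard : Fintype.card {i : Fin (n + 1) // i ≠ 0} = n := by
    rw [Fintype.card_subtype_compl]; simp
  have hS0 : lastLead Q v l ≠ 0 := by
    obtain ⟨t, a, ha, hne⟩ := exists_obeys_lead_ne_zero hpos
    intro h0
    apply hne l
    rw [← ha.eval_aeval_unfold]
    change MvPolynomial.eval t (lastLead Q v l) = 0
    rw [h0, map_zero]
  -- The leading coefficient has degree at most L in the a_j, and each a_j has degree at most L^n in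
  -- the parameters.
  have hSdeg : (lastLead Q v l).totalDegree ≤ L ^ (n + 1) := by
    refine (totalDegree_aeval_le _ (M := L ^ n) (fun i => ?_) _).trans ?_
    · exact (totalDegree_unfold_le hL1 hL i).trans (Nat.pow_le_pow_right hL1 (by omega))
    · rw [pow_succ']
      exact Nat.mul_le_mul_right _ ((totalDegree_lead_le _ _).trans (hL l))
  have h1 := card_zeros_mul_le hS0 hT
  set E := (Fintype.piFinset T).filter fun t => IsReducibleParam Q v t ∧
    MvPolynomial.eval t (lastLead Q v l) ≠ 0
  have h2 : E.card * H ≤ (2 ^ (n + 1) * L * (2 * v.natAbs.divisors.card)) * H ^ n := by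
    have := card_mul_le_of_fibers (N := 2 ^ (n + 1) * L * (2 * v.natAbs.divisors.card)) hT
      (E := E) (Finset.filter_subset _ _) l fun t => by
        refine (Finset.card_le_card ?_).trans (card_reducible_fiber_le hv hL hpos (l := l) rfl (T l) t)
        intro y hy
        rw [Finset.mem_filter] at hy ⊢
        exact ⟨hy.1, (Finset.mem_filter.1 hy.2).2⟩
    rwa [hcard] at this
  have hsub : ((Fintype.piFinset T).filter fun t => IsReducibleParam Q v t) ⊆
      ((Fintype.piFinset T).filter fun t => MvPolynomial.eval t (lastLead Q v l) = 0) ∪ E := by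
    intro t ht
    rw [Finset.mem_filter] at ht
    rw [Finset.mem_union, Finset.mem_filter, Finset.mem_filter]
    tauto
  have h3 := (Finset.card_le_card hsub).trans (Finset.card_union_le _ _)
  rw [hcard] at h1
  have h4 : n * (lastLead Q v l).totalDegree * H ^ n ≤ (n + 1) * L ^ (n + 1) * H ^ n := by
    gcongr; omega
  calc _ ≤ _ := Nat.mul_le_mul_right H h3
    _ ≤ _ := by
      rw [add_mul, Nat.add_sub_cancel, add_mul]
      exact add_le_add (h1.trans h4) h2

/-! ### The law of the constant coefficient, in both readings -/

theorem uniformOn_real_singleton {α : Type*} [MeasurableSpace α] [MeasurableSingletonClass α]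
    [DecidableEq α] (s : Finset α) (y : α) :
    (uniformOn (s : Set α)).real {y} = if y ∈ s then 1 / (s.card : ℝ) else 0 := by
  rw [measureReal_def, ← Finset.coe_singleton, uniformOn_apply_finset]
  split_ifs with h
  · rw [Finset.inter_singleton_of_mem h]; simp
  · rw [Finset.inter_singleton_of_notMem h]; simp

theorem uniformOn_ae_mem {α : Type*} [MeasurableSpace α] [MeasurableSingletonClass α]
    (s : Finset α) : ∀ᵐ y ∂uniformOn (s : Set α), y ∈ s := by
  have := ae_cond_mem (μ := Measure.count) s.measurableSet
  simpa [uniformOn] using this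

/-- The set of values of `P` on the integers of `[-H, H]`. -/
def valueFinset (P : ℤ[X]) (H : ℕ) : Finset ℤ :=
  (Finset.Icc (-(H : ℤ)) H).image fun n => P.eval n

theorem coe_valueFinset (P : ℤ[X]) (H : ℕ) :
    (valueFinset P H : Set ℤ) = (fun n : ℤ => P.eval n) '' Set.Icc (-(H : ℤ)) H := by
  simp [valueFinset]

/-- The integers of `[-H, H]` at which `P` takes the value `v`. -/
def valueFiber (P : ℤ[X]) (H : ℕ) (v : ℤ) : Finset ℤ :=
  (Finset.Icc (-(H : ℤ)) H).filter fun n => P.eval n = v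

theorem valueFiber_subset (P : ℤ[X]) (H : ℕ) (v : ℤ) :
    valueFiber P H v ⊆ Finset.Icc (-(H : ℤ)) H :=
  Finset.filter_subset _ _

theorem sum_card_valueFiber_mul (P : ℤ[X]) (H : ℕ) (g : ℤ → ℝ) (s : Finset ℤ) :
    ∑ v ∈ valueFinset P H ∩ s, ((valueFiber P H v).card : ℝ) * g v =
      ∑ n ∈ (Finset.Icc (-(H : ℤ)) H).filter (fun n => P.eval n ∈ s), g (P.eval n) := by
  rw [← Finset.sum_fiberwise_of_maps_to (t := valueFinset P H ∩ s) (g := fun n => P.eval n)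
    (s := (Finset.Icc (-(H : ℤ)) H).filter fun n => P.eval n ∈ s)]
  · refine Finset.sum_congr rfl fun v hv => ?_
    have : ((Finset.Icc (-(H : ℤ)) H).filter (fun n => P.eval n ∈ s)).filter
        (fun n => P.eval n = v) = valueFiber P H v := by
      ext n
      simp only [valueFiber, Finset.mem_filter]
      constructor
      · tauto
      · rintro ⟨h1, h2⟩
        exact ⟨⟨h1, h2 ▸ (Finset.mem_inter.1 hv).2⟩, h2⟩
    rw [this, ← nsmul_eq_mul, ← Finset.sum_const]
    refine Finset.sum_congr rfl fun n hn => ?_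
    rw [(Finset.mem_filter.1 hn).2]
  · intro n hn
    rw [Finset.mem_filter] at hn
    exact Finset.mem_inter.2 ⟨Finset.mem_image_of_mem _ hn.1, hn.2⟩

theorem card_valueFiber_le {P : ℤ[X]} (hP : 1 ≤ P.natDegree) (H : ℕ) (v : ℤ) :
    (valueFiber P H v).card ≤ P.natDegree := by
  have h0 : P - C v ≠ 0 := by
    intro h
    rw [sub_eq_zero.1 h] at hP
    simp at hP
  calc _ ≤ (P - C v).roots.toFinset.card := by
        refine Finset.card_le_card fun n hn => ?_
        rw [Multiset.mem_toFinset, mem_roots h0]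
        simp [(Finset.mem_filter.1 hn).2]
    _ ≤ (P - C v).natDegree := (Multiset.toFinset_card_le _).trans (card_roots' _)
    _ = _ := natDegree_sub_C

theorem card_Icc_symm (H : ℕ) : (Finset.Icc (-(H : ℤ)) H).card = 2 * H + 1 := by
  rw [Int.card_Icc]; omega

theorem two_mul_add_one_le_card_valueFinset {P : ℤ[X]} (hP : 1 ≤ P.natDegree) (H : ℕ) :
    2 * H + 1 ≤ (valueFinset P H).card * P.natDegree := by
  rw [← card_Icc_symm]
  refine (Finset.card_le_mul_card_image _ P.natDegree fun v _ => ?_).trans (by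
    rw [mul_comm]; rfl)
  exact card_valueFiber_le hP H v

section Values

variable {Ω : Type*} [MeasurableSpace Ω] {μ : Measure Ω} [IsProbabilityMeasure μ] {P : ℤ[X]}
  {H : ℕ} {Y : Ω → ℤ}

theorem IsUniformOnValues.ae_mem (h : IsUniformOnValues μ P H Y) :
    ∀ᵐ ω ∂μ, Y ω ∈ valueFinset P H := by
  rcases h with h | h
  · rw [← coe_valueFinset] at h
    exact (h.ae_iff (p := fun y => y ∈ valueFinset P H) (measurable_of_countable _)).2
      (uniformOn_ae_mem _)
  · rw [← Finset.coe_Icc] at h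
    refine (h.ae_iff (p := fun y => y ∈ valueFinset P H) (measurable_of_countable _)).2 ?_
    rw [ae_map_iff (by fun_prop) (Set.to_countable _).measurableSet]
    filter_upwards [uniformOn_ae_mem (Finset.Icc (-(H : ℤ)) H)] with n hn
    exact Finset.mem_image_of_mem _ hn

theorem IsUniformOnValues.aemeasurable (h : IsUniformOnValues μ P H Y) : AEMeasurable Y μ := by
  rcases h with h | h <;> exact h.aemeasurable

theorem IsUniformOnValues.real_eq (h : IsUniformOnValues μ P H Y) (v : ℤ) :
    μ.real {ω | Y ω = v} = (if v ∈ valueFinset P H then 1 / ((valueFinset P H).card : ℝ) else 0) ∨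
    μ.real {ω | Y ω = v} = (valueFiber P H v).card / (2 * H + 1) := by
  rcases h with h | h
  · left
    rw [← coe_valueFinset] at h
    rw [← uniformOn_real_singleton]
    exact h.measureReal_eq (p := fun y => y = v) (Set.to_countable _).measurableSet
  · right
    rw [← Finset.coe_Icc] at h
    rw [h.measureReal_eq (p := fun y => y = v) (Set.to_countable _).measurableSet,
      map_measureReal_apply (by fun_prop) (Set.to_countable _).measurableSet]
    have : (fun n : ℤ => P.eval n) ⁻¹' {x | x = v} ∩ (Finset.Icc (-(H : ℤ)) H : Finset ℤ) =
        valueFiber P H v := by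
      ext n; simp [valueFiber, and_comm]
    rw [measureReal_def, ← uniformOn_inter_self (Finset.finite_toSet _), Set.inter_comm, this,
      uniformOn_apply_finset, Finset.inter_eq_right.2 (valueFiber_subset P H v), card_Icc_symm]
    rw [ENNReal.toReal_div]
    simp
    norm_cast

/-- With multiplicity, P has at most deg P zeros among 2H + 1 integers. Without it, the value set
has at least (2H+1)/deg P elements. A nonzero constant P never takes the value 0. -/
theorem IsUniformOnValues.real_zero_le (hP : P ≠ 0) (h : IsUniformOnValues μ P H Y) :
    μ.real {ω | Y ω = 0} ≤ P.natDegree / (2 * H + 1) := by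
  have hpos : (0 : ℝ) < 2 * H + 1 := by positivity
  rcases Nat.eq_zero_or_pos P.natDegree with h0 | h0
  · obtain ⟨c, rfl⟩ := natDegree_eq_zero.1 h0
    have hc : c ≠ 0 := by rintro rfl; simp at hP
    rcases h.real_eq 0 with h | h
    · rw [h, if_neg (by simp [valueFinset, hc])]
      positivity
    · rw [h]; simp [valueFiber, hc]
  · rcases h.real_eq 0 with h | h
    · rw [h]
      split_ifs with hm
      · have h1 := two_mul_add_one_le_card_valueFinset h0 H
        have h2 : (0 : ℝ) < (valueFinset P H).card := by
          exact_mod_cast Finset.card_pos.2 ⟨_, hm⟩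
        rw [div_le_div_iff₀ h2 hpos, one_mul]
        exact_mod_cast h1.trans_eq (mul_comm _ _)
      · positivity
    · rw [h]
      have := card_valueFiber_le h0 H 0
      gcongr

/-- Both readings are dominated by the law with multiplicity at the cost of a constant, so sums over
values become sums over n. The summand 1 in deg P + 1 is there for constant P. -/
theorem IsUniformOnValues.real_le (h : IsUniformOnValues μ P H Y) (v : ℤ) :
    μ.real {ω | Y ω = v} ≤ (P.natDegree + 1) / (2 * H + 1) * (valueFiber P H v).card := by
  have hpos : (0 : ℝ) < 2 * H + 1 := by positivity
  rcases h.real_eq v with h | h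
  · rw [h]
    split_ifs with hm
    · have hf : 1 ≤ (valueFiber P H v).card := by
        obtain ⟨n, hn, hv⟩ := Finset.mem_image.1 hm
        exact Finset.card_pos.2 ⟨n, Finset.mem_filter.2 ⟨hn, hv⟩⟩
      have hf' : (1 : ℝ) ≤ (valueFiber P H v).card := by exact_mod_cast hf
      rcases Nat.eq_zero_or_pos P.natDegree with h0 | h0
      · obtain ⟨c, rfl⟩ := natDegree_eq_zero.1 h0
        have hc : c = v := by
          obtain ⟨n, hn, hv⟩ := Finset.mem_image.1 hm
          simpa using hv
        have hfc : (valueFiber (C c) H v).card = 2 * H + 1 := by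
          rw [← card_Icc_symm, valueFiber, Finset.filter_true_of_mem (by simp [hc])]
        have hvc : (1 : ℝ) ≤ (valueFinset (C c) H).card := by
          exact_mod_cast Finset.card_pos.2 ⟨_, hm⟩
        rw [hfc]
        push_cast
        rw [div_mul_cancel₀ _ hpos.ne']
        refine (div_le_one_of_le₀ hvc (by positivity)).trans (by simp)
      · have h1 := two_mul_add_one_le_card_valueFinset h0 H
        have h2 : (0 : ℝ) < (valueFinset P H).card := by
          exact_mod_cast Finset.card_pos.2 ⟨_, hm⟩
        have h3 : 1 / ((valueFinset P H).card : ℝ) ≤ (P.natDegree + 1) / (2 * H + 1) := by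
          rw [div_le_div_iff₀ h2 hpos, one_mul]
          have : (2 * H + 1 : ℝ) ≤ (valueFinset P H).card * P.natDegree := by exact_mod_cast h1
          linarith
        exact h3.trans (le_mul_of_one_le_right (by positivity) hf')
    · positivity
  · rw [h, div_mul_eq_mul_div]
    gcongr
    exact le_mul_of_one_le_left (by positivity) (by simp)

theorem IsUniformOnValues.sum_real_mul_le (h : IsUniformOnValues μ P H Y) {g : ℤ → ℝ}
    (hg : ∀ v, 0 ≤ g v) :
    ∑ v ∈ (valueFinset P H).erase 0, μ.real {ω | Y ω = v} * g v ≤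
      (P.natDegree + 1) / (2 * H + 1) *
        ∑ n ∈ (Finset.Icc (-(H : ℤ)) H).filter (fun n => P.eval n ≠ 0), g (P.eval n) := by
  have h1 := sum_card_valueFiber_mul P H g ((valueFinset P H).erase 0)
  rw [Finset.inter_eq_right.2 (Finset.erase_subset _ _)] at h1
  have h2 : (Finset.Icc (-(H : ℤ)) H).filter (fun n => P.eval n ∈ (valueFinset P H).erase 0) =
      (Finset.Icc (-(H : ℤ)) H).filter (fun n => P.eval n ≠ 0) := by
    refine Finset.filter_congr fun n hn => ?_
    simp only [Finset.mem_erase, and_iff_left_iff_imp]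
    exact fun _ => Finset.mem_image_of_mem _ hn
  rw [← h2, ← h1, Finset.mul_sum]
  refine Finset.sum_le_sum fun v _ => ?_
  rw [← mul_assoc]
  exact mul_le_mul_of_nonneg_right (h.real_le v) (hg v)

theorem sum_real_fiber_le_one (hY : AEMeasurable Y μ) (s : Finset ℤ) :
    ∑ v ∈ s, μ.real {ω | Y ω = v} ≤ 1 := by
  have h1 : ∑ v ∈ s, μ.real {ω | Y ω = v} = ∑ v ∈ s, (μ.map Y).real {v} := by
    refine Finset.sum_congr rfl fun v _ => ?_
    rw [measureReal_def, measureReal_def, Measure.map_apply_of_aemeasurable hY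
      (measurableSet_singleton v)]
    rfl
  have := Measure.isProbabilityMeasure_map hY (μ := μ)
  rw [h1, sum_measureReal_singleton]
  exact measureReal_le_one

end Values

/-! ### Probability bound for the dependent model -/

section Dependent

variable {Ω : Type*} [MeasurableSpace Ω] {μ : Measure Ω} [IsProbabilityMeasure μ] {P : ℤ[X]}
  {H L d : ℕ} [NeZero d] {a : Fin d → Ω → ℤ} {t : {i : Fin d // i ≠ 0} → Ω → ℝ}
  {Q : ∀ i : {i : Fin d // i ≠ 0}, StepPoly i.1}

theorem IsDependentModel.real_point (h : IsDependentModel μ P H L d a t Q)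
    {T : {i : Fin d // i ≠ 0} → Finset ℝ} (hT : ∀ i, (T i).card = H)
    (hlaw : ∀ i, HasLaw (t i) (uniformOn (T i : Set ℝ)) μ) (v : ℤ)
    {τ : {i : Fin d // i ≠ 0} → ℝ} (hτ : τ ∈ Fintype.piFinset T) :
    μ.real {ω | a 0 ω = v ∧ (fun i => t i ω) = τ} =
      μ.real {ω | a 0 ω = v} * (1 / (H : ℝ) ^ (d - 1)) := by
  classical
  have h1 := h.indep_const.measure_inter_preimage_eq_mul {v} {τ} (measurableSet_singleton v)
    (measurableSet_singleton τ)
  have h2 := h.indep_t.measure_inter_preimage_eq_mul Finset.univ (sets := fun i => {τ i})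
    (fun i _ => measurableSet_singleton _)
  have h3 : (fun ω i => t i ω) ⁻¹' {τ} = ⋂ i ∈ Finset.univ, t i ⁻¹' {τ i} := by
    ext ω; simp [funext_iff]
  have h4 : ∀ i, μ.real (t i ⁻¹' {τ i}) = 1 / (H : ℝ) := by
    intro i
    have h5 := (hlaw i).measureReal_eq (p := fun y => y = τ i) (measurableSet_singleton _)
    have h6 := uniformOn_real_singleton (T i) (τ i)
    rw [if_pos (Fintype.mem_piFinset.1 hτ i), hT] at h6
    exact h5.trans h6
  have hcard : Fintype.card {i : Fin d // i ≠ 0} = d - 1 := by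
    rw [Fintype.card_subtype_compl]; simp
  change (μ (a 0 ⁻¹' {v} ∩ (fun ω i => t i ω) ⁻¹' {τ})).toReal = _
  rw [h1, ENNReal.toReal_mul, h3, h2, ENNReal.toReal_prod]
  congr 1
  calc ∏ i, (μ (t i ⁻¹' {τ i})).toReal = ∏ i, 1 / (H : ℝ) := Finset.prod_congr rfl fun i _ => h4 i
    _ = _ := by rw [Finset.prod_const, Finset.card_univ, hcard, one_div_pow]

open scoped Classical in
-- Up to a null set, reducibility forces a_0 = 0 or one of finitely many points (v, τ) with v ≠ 0
-- and τ a reducible parameter. Independence makes all τ equally likely given a_0 = v, so the count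
-- for each v becomes a probability.
theorem IsDependentModel.real_reducible_le (hP : P ≠ 0) (hd : 2 ≤ d) (hL : 1 ≤ L) (hH : 1 ≤ H)
    (h : IsDependentModel μ P H L d a t Q) :
    μ.real {ω | ¬ Irreducible (monicPoly fun i => a i ω)} ≤
      P.natDegree / (2 * H + 1) + (d * L ^ d + 2 ^ d * L * (2 *
        ∑ v ∈ (valueFinset P H).erase 0, μ.real {ω | a 0 ω = v} *
          (v.natAbs.divisors.card : ℝ))) / H := by
  have hHpos : (0 : ℝ) < H := by exact_mod_cast hH
  choose T hT hlaw using h.law_t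
  set V := (valueFinset P H).erase 0
  set E : ℤ → Finset ({i : Fin d // i ≠ 0} → ℝ) := fun v =>
    (Fintype.piFinset T).filter fun τ => IsReducibleParam Q v τ
  set Z : Set Ω := {ω | a 0 ω = 0} ∪ ⋃ v ∈ V, ⋃ τ ∈ E v, {ω | a 0 ω = v ∧ (fun i => t i ω) = τ}
  have hae : ∀ᵐ ω ∂μ, ω ∈ {ω | ¬ Irreducible (monicPoly fun i => a i ω)} → ω ∈ Z := by
    have h1 : ∀ᵐ ω ∂μ, ∀ i, t i ω ∈ T i := by
      rw [ae_all_iff]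
      intro i
      exact ((hlaw i).ae_iff (p := fun y => y ∈ T i)
        (measurableSet_setOfPred.1 (T i).measurableSet)).2 (uniformOn_ae_mem _)
    have h2 : ∀ᵐ ω ∂μ, ∀ i : {i : Fin d // i ≠ 0},
        (a i ω : ℝ) = (Q i).value (fun j => (a j ω : ℝ)) (t i ω) := ae_all_iff.2 h.coeff_eq
    filter_upwards [h1, h2, h.const_coeff.ae_mem] with ω ht ha hV hω
    by_cases h0 : a 0 ω = 0
    · exact Or.inl h0
    · right
      simp only [Set.mem_iUnion]
      refine ⟨a 0 ω, Finset.mem_erase.2 ⟨h0, hV⟩, fun i => t i ω, ?_, rfl, rfl⟩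
      exact Finset.mem_filter.2 ⟨Fintype.mem_piFinset.2 ht, fun i => a i ω, ⟨rfl, ha⟩, hω⟩
  have hfiber : ∀ v ∈ V, ∑ τ ∈ E v, μ.real {ω | a 0 ω = v ∧ (fun i => t i ω) = τ} ≤
      μ.real {ω | a 0 ω = v} *
        ((d * L ^ d + 2 ^ d * L * (2 * (v.natAbs.divisors.card : ℝ))) / H) := by
    intro v hv
    obtain ⟨hv0, hvV⟩ := Finset.mem_erase.1 hv
    obtain ⟨n, hn, rfl⟩ := Finset.mem_image.1 hvV
    have hc := card_reducibleParam_mul_le hd hv0 hL h.totalDegree_le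
      (fun i => h.degree_pos i n (by simpa using hn) hv0) hT
    have hc' : ((E (P.eval n)).card : ℝ) * H ≤ (d * L ^ d + 2 ^ d * L *
        (2 * ((P.eval n).natAbs.divisors.card : ℝ))) * H ^ (d - 1) := by exact_mod_cast hc
    rw [Finset.sum_congr rfl fun τ hτ => h.real_point hT hlaw (P.eval n)
      (Finset.mem_filter.1 hτ).1, Finset.sum_const, nsmul_eq_mul, mul_left_comm]
    refine mul_le_mul_of_nonneg_left ?_ measureReal_nonneg
    rw [mul_one_div, div_le_div_iff₀ (by positivity) hHpos]
    exact hc'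
  calc _ ≤ μ.real Z := ENNReal.toReal_mono (measure_ne_top _ _) (measure_mono_ae hae)
    _ ≤ μ.real {ω | a 0 ω = 0} + ∑ v ∈ V, ∑ τ ∈ E v,
        μ.real {ω | a 0 ω = v ∧ (fun i => t i ω) = τ} := by
      refine (measureReal_union_le _ _).trans (add_le_add le_rfl ?_)
      refine (measureReal_biUnion_finset_le _ _).trans (Finset.sum_le_sum fun v _ => ?_)
      exact measureReal_biUnion_finset_le _ _
    _ ≤ P.natDegree / (2 * H + 1) + ∑ v ∈ V, μ.real {ω | a 0 ω = v} *
        ((d * L ^ d + 2 ^ d * L * (2 * (v.natAbs.divisors.card : ℝ))) / H) :=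
      add_le_add (h.const_coeff.real_zero_le hP) (Finset.sum_le_sum hfiber)
    _ = P.natDegree / (2 * H + 1) + ((∑ v ∈ V, μ.real {ω | a 0 ω = v}) * (d * L ^ d) +
        2 ^ d * L * (2 * ∑ v ∈ V, μ.real {ω | a 0 ω = v} *
          (v.natAbs.divisors.card : ℝ))) / H := by
      congr 1
      rw [Finset.sum_mul, Finset.mul_sum, Finset.mul_sum, ← Finset.sum_add_distrib,
        Finset.sum_div]
      exact Finset.sum_congr rfl fun v _ => by ring
    _ ≤ _ := by
      have := sum_real_fiber_le_one h.const_coeff.aemeasurable V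
      have h2 := mul_le_of_le_one_left (by positivity : (0 : ℝ) ≤ d * L ^ d) this
      gcongr

theorem one_sub_real_le_probIrreducible {Ω : Type*} [MeasurableSpace Ω] (μ : Measure Ω)
    [IsProbabilityMeasure μ] {d : ℕ} (a : Fin d → Ω → ℤ) :
    1 - μ.real {ω | ¬ Irreducible (monicPoly fun i => a i ω)} ≤ probIrreducible μ a := by
  rw [probIrreducible, sub_le_iff_le_add]
  calc (1 : ℝ) = μ.real Set.univ := by simp
    _ ≤ _ := by
      have h : Set.univ ⊆ {ω | Irreducible (monicPoly fun i => a i ω)} ∪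
        {ω | ¬ Irreducible (monicPoly fun i => a i ω)} := fun ω _ => em _
      exact (measureReal_mono h).trans (measureReal_union_le _ _)

end Dependent

/-- Stated with d instead of d^2, so that the sparse model follows with L = 1 and no loss. -/
theorem exists_dependent_bound {P : ℤ[X]} (hP : P ≠ 0) :
    ∃ c : ℝ, ∀ (d H L : ℕ) [NeZero d], 3 ≤ H →
      ∀ (Ω : Type*) [MeasurableSpace Ω] (μ : Measure Ω) [IsProbabilityMeasure μ]
        (a : Fin d → Ω → ℤ) (t : {i : Fin d // i ≠ 0} → Ω → ℝ)
        (Q : ∀ i : {i : Fin d // i ≠ 0}, StepPoly i.1),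
        IsDependentModel μ P H L d a t Q →
        1 - (P.natDegree : ℝ) / (2 * H + 1) - 2 * d * (2 * L) ^ d * Real.log H ^ c / H
          ≤ probIrreducible μ a := by
  obtain ⟨c, hc0, hc⟩ := exists_sum_card_divisors_eval_le hP
  -- With S ≤ (deg P + 1)(log H)^c and (log H)^c ≥ 1, this constant times (log H)^c bounds 1 + 2S.
  obtain ⟨c', -, hc'⟩ := exists_const_le_log_rpow (1 + 2 * (P.natDegree + 1))
  refine ⟨c + c', fun d H L _ hH Ω _ μ _ a t Q h => ?_⟩
  refine le_trans ?_ (one_sub_real_le_probIrreducible μ a)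
  have hlog := one_lt_log_of_three_le hH
  have hHpos : (0 : ℝ) < H := by positivity
  have hterm : 0 ≤ 2 * d * (2 * L) ^ d * Real.log H ^ (c + c') / H := by
    have := Real.rpow_pos_of_pos (by linarith : 0 < Real.log H) (c + c')
    positivity
  have hdeg : 0 ≤ (P.natDegree : ℝ) / (2 * H + 1) := by positivity
  have hd0 := NeZero.ne d
  rcases Nat.lt_or_ge d 2 with hd | hd
  · obtain rfl : d = 1 := by omega
    have : {ω | ¬ Irreducible (monicPoly fun i => a i ω)} = ∅ := by
      ext ω; simpa using irreducible_monicPoly_one _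
    rw [this, measureReal_empty]
    linarith
  -- If L = 0, positive degree in t is impossible, so P vanishes at all 2H + 1 integers. Then deg P
  -- ≥ 2H + 1 and the claimed bound is trivial.
  rcases Nat.eq_zero_or_pos L with rfl | hL
  · have hall : ∀ n ∈ Finset.Icc (-(H : ℤ)) H, P.eval n = 0 := by
      intro n hn
      by_contra hne
      have hi : (⟨1, hd⟩ : Fin d) ≠ 0 := by
        intro h0
        have := congrArg Fin.val h0
        simp at this
      have h1 := h.degree_pos ⟨⟨1, hd⟩, hi⟩ n (by simpa using hn) hne
      have h2 := (MvPolynomial.degreeOf_le_totalDegree _ none).trans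
        ((StepPoly.totalDegree_fixConst_le (Q ⟨⟨1, hd⟩, hi⟩) (P.eval n : ℤ)).trans
          (h.totalDegree_le _)) |>.trans_lt h1
      exact lt_irrefl _ h2
    have hN : 2 * H + 1 ≤ P.natDegree := by
      rw [← card_Icc_symm]
      calc _ ≤ P.roots.toFinset.card := Finset.card_le_card fun n hn => by
            rw [Multiset.mem_toFinset, mem_roots hP]; exact hall n hn
        _ ≤ _ := (Multiset.toFinset_card_le _).trans (card_roots' _)
    have h1 : 1 ≤ (P.natDegree : ℝ) / (2 * H + 1) := by
      rw [one_le_div (by positivity)]; exact_mod_cast hN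
    have h2 : μ.real {ω | ¬ Irreducible (monicPoly fun i => a i ω)} ≤ 1 := measureReal_le_one
    linarith
  have h1 := h.real_reducible_le hP hd hL (by omega)
  set S := ∑ v ∈ (valueFinset P H).erase 0, μ.real {ω | a 0 ω = v} *
          (v.natAbs.divisors.card : ℝ)
  have hlogc : 1 ≤ Real.log H ^ c := Real.one_le_rpow hlog.le hc0
  have hS : S ≤ (P.natDegree + 1) * Real.log H ^ c := by
    refine (h.const_coeff.sum_real_mul_le (g := fun v => (v.natAbs.divisors.card : ℝ))
      fun v => by positivity).trans ?_
    calc _ ≤ (P.natDegree + 1) / (2 * H + 1) * (H * Real.log H ^ c) := by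
          have := hc H hH
          gcongr
      _ = (P.natDegree + 1) * Real.log H ^ c * (H / (2 * H + 1)) := by ring
      _ ≤ _ := by
          refine mul_le_of_le_one_right (by positivity) ?_
          exact div_le_one_of_le₀ (by linarith) (by positivity)
  have hL1 : (1 : ℝ) ≤ L := by exact_mod_cast hL
  have hd1 : (1 : ℝ) ≤ d := by exact_mod_cast (by omega : 1 ≤ d)
  have hLd : (L : ℝ) ≤ L ^ d := le_self_pow₀ hL1 hd0
  have h2d : (1 : ℝ) ≤ 2 ^ d := one_le_pow₀ (by norm_num)
  have hS0 : 0 ≤ S := Finset.sum_nonneg fun _ _ => by positivity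
  have h2 : d * (L : ℝ) ^ d + 2 ^ d * L * (2 * S) ≤
      2 * d * (2 * L) ^ d * Real.log H ^ (c + c') := by
    have e1 : d * (L : ℝ) ^ d ≤ d * (2 * L) ^ d := by
      rw [mul_pow]
      have : (L : ℝ) ^ d ≤ 2 ^ d * L ^ d := le_mul_of_one_le_left (by positivity) h2d
      gcongr
    have e2 : 2 ^ d * L * (2 * S) ≤ d * (2 * L) ^ d * (2 * S) := by
      rw [mul_pow]
      have : (2 : ℝ) ^ d * L ≤ d * (2 ^ d * L ^ d) := by
        calc (2 : ℝ) ^ d * L ≤ 2 ^ d * L ^ d := by gcongr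
          _ ≤ _ := le_mul_of_one_le_left (by positivity) hd1
      gcongr
    have e3 : 1 + 2 * S ≤ 2 * Real.log H ^ (c + c') := by
      rw [Real.rpow_add (by linarith)]
      have e4 := hc' H hH
      calc 1 + 2 * S ≤ Real.log H ^ c * (1 + 2 * (P.natDegree + 1)) := by linarith
        _ ≤ Real.log H ^ c * Real.log H ^ c' := by gcongr
        _ ≤ _ := by
          have : 0 < Real.log H ^ c * Real.log H ^ c' :=
            mul_pos (by positivity) (Real.rpow_pos_of_pos (by linarith) _)
          linarith
    calc _ ≤ d * (2 * L : ℝ) ^ d * (1 + 2 * S) := by linarith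
      _ ≤ d * (2 * L : ℝ) ^ d * (2 * Real.log H ^ (c + c')) := by gcongr
      _ = _ := by ring
  have h3 := div_le_div_of_nonneg_right h2 hHpos.le
  linarith

/-! ### The sparse model as a special case -/

theorem map_uniformOn_of_injective {α β : Type*} [MeasurableSpace α] [MeasurableSingletonClass α]
    [MeasurableSpace β] [MeasurableSingletonClass β] (A : Finset α) {f : α → β}
    (hf : Function.Injective f) (hfm : Measurable f) :
    (uniformOn (A : Set α)).map f = uniformOn (f '' (A : Set α)) := by
  ext s hs
  rw [Measure.map_apply hfm hs, uniformOn, uniformOn, cond_apply A.measurableSet,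
    cond_apply (A.finite_toSet.image f).measurableSet, ← Set.image_inter_preimage,
    Measure.count_injective_image hf, Measure.count_injective_image hf]

/-- The coefficients themselves, viewed as reals, serve as parameters t_i, with step polynomial Q_i
= t_i of degree 1. -/
theorem IsSparseModel.isDependentModel {Ω : Type*} [MeasurableSpace Ω] {μ : Measure Ω}
    [IsProbabilityMeasure μ] {P : ℤ[X]} {H d : ℕ} [NeZero d] {a : Fin d → Ω → ℤ}
    (h : IsSparseModel μ P H d a) :
    IsDependentModel μ P H 1 d a (fun i ω => (a i.1 ω : ℝ)) (fun _ => MvPolynomial.X none) where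
  const_coeff := h.const_coeff
  law_t i := by
    classical
    obtain ⟨A, hA, hlaw⟩ := h.higher_coeff i.1 i.2
    refine ⟨A.map ⟨(fun n : ℤ => (n : ℝ)), Int.cast_injective⟩, by simpa using hA, ?_⟩
    refine ⟨(measurable_of_countable _).comp_aemeasurable hlaw.aemeasurable, ?_⟩
    have h1 : μ.map (fun ω => (a i.1 ω : ℝ)) = (μ.map (a i.1)).map (fun n : ℤ => (n : ℝ)) :=
      (AEMeasurable.map_map_of_aemeasurable (measurable_of_countable _).aemeasurable
        hlaw.aemeasurable).symm
    rw [h1, hlaw.map_eq, map_uniformOn_of_injective A Int.cast_injective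
      (measurable_of_countable _), Finset.coe_map]
    rfl
  indep_t := by
    have h1 := h.indep.precomp (g := fun i : {i : Fin d // i ≠ 0} => i.1) Subtype.val_injective
    exact h1.comp (fun _ n => (n : ℝ)) fun _ => measurable_of_countable _
  indep_const := by
    have hae : ∀ i, AEMeasurable (a i) μ := by
      intro i
      rcases eq_or_ne i 0 with rfl | hi
      · exact h.const_coeff.aemeasurable
      · obtain ⟨A, -, hlaw⟩ := h.higher_coeff i hi
        exact hlaw.aemeasurable
    have h1 := h.indep.indepFun_finset₀ {0} {0}ᶜ disjoint_compl_right hae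
    have hm1 : Measurable fun x : ({0} : Finset (Fin d)) → ℤ =>
        x ⟨0, Finset.mem_singleton_self 0⟩ := measurable_pi_apply _
    have hm2 : Measurable fun (x : ({0}ᶜ : Finset (Fin d)) → ℤ) (i : {i : Fin d // i ≠ 0}) =>
        (x ⟨i.1, by simpa using i.2⟩ : ℝ) :=
      measurable_pi_lambda _ fun i =>
        (measurable_of_countable (fun n : ℤ => (n : ℝ))).comp (measurable_pi_apply _)
    exact h1.comp hm1 hm2
  totalDegree_le i := by simp
  degree_pos i n _ _ := by
    have : (StepPoly.fixConst (MvPolynomial.X none : StepPoly i.1) (P.eval n : ℤ)) =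
      MvPolynomial.X none := by simp [StepPoly.fixConst]
    rw [this, MvPolynomial.degreeOf_X]
    simp
  coeff_eq i := by
    refine Eventually.of_forall fun ω => ?_
    simp [StepPoly.value]

/-! ### Irreducibility when all coefficients are nearly equal -/

theorem eval_map_monicPoly {d : ℕ} (a : Fin d → ℤ) (r : ℂ) :
    ((monicPoly a).map (Int.castRingHom ℂ)).eval r = r ^ d + ∑ i : Fin d, (a i : ℂ) * r ^ (i : ℕ) := by
  simp [monicPoly, Polynomial.map_sum, eval_finsetSum]

/-- If the geometric sum has norm less than one at every root of a monic integer polynomial, then it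
vanishes at one of them. -/
theorem exists_root_geom_sum_eq_zero {d : ℕ} {g : ℤ[X]} (hg : g.Monic) (hdeg : 1 ≤ g.natDegree)
    (h : ∀ r ∈ (g.map (Int.castRingHom ℂ)).roots, ‖∑ i ∈ Finset.range d, r ^ i‖ < 1) :
    ∃ r ∈ (g.map (Int.castRingHom ℂ)).roots, ∑ i ∈ Finset.range d, r ^ i = 0 := by
  set G := g.map (Int.castRingHom ℂ) with hG
  set U : ℤ[X] := ∑ i ∈ Finset.range d, X ^ i with hU
  have hGm : G.Monic := hg.map _
  have hUe : ∀ r : ℂ, (U.map (Int.castRingHom ℂ)).eval r = ∑ i ∈ Finset.range d, r ^ i := by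
    intro r; simp [hU, Polynomial.map_sum, eval_finsetSum]
  -- For monic g the resultant with U is the product of U over the roots of g. It is an integer, so
  -- modulus below 1 forces it to vanish.
  have hres : ((resultant g U g.natDegree U.natDegree : ℤ) : ℂ) =
      (G.roots.map fun r => ∑ i ∈ Finset.range d, r ^ i).prod := by
    have h1 := resultant_map_map g U g.natDegree U.natDegree (Int.castRingHom ℂ)
    have h2 := resultant_eq_prod_eval G (U.map (Int.castRingHom ℂ)) U.natDegree
      natDegree_map_le (IsAlgClosed.splits G)
    rw [hG, hg.natDegree_map, ← hG, hGm.leadingCoeff, one_pow, one_mul] at h2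
    rw [← hG, h2] at h1
    rw [← eq_intCast (Int.castRingHom ℂ), ← h1]
    congr 1
    exact Multiset.map_congr rfl fun r _ => hUe r
  by_contra! hne
  have hcard : 1 ≤ G.roots.card := by
    rw [← (IsAlgClosed.splits G).natDegree_eq_card_roots, hG, hg.natDegree_map]
    exact hdeg
  have hlt : ∀ m : Multiset ℂ, (∀ r ∈ m, ‖∑ i ∈ Finset.range d, r ^ i‖ < 1) → 1 ≤ m.card →
      ‖(m.map fun r => ∑ i ∈ Finset.range d, r ^ i).prod‖ < 1 := by
    intro m
    induction m using Multiset.induction_on with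
    | empty => simp
    | cons r m ih =>
      intro hm _
      rw [Multiset.map_cons, Multiset.prod_cons, norm_mul]
      have h1 := hm r (Multiset.mem_cons_self _ _)
      have h3 : ‖(m.map fun r => ∑ i ∈ Finset.range d, r ^ i).prod‖ ≤ 1 := by
        rcases Nat.eq_zero_or_pos m.card with h0 | h0
        · rw [Multiset.card_eq_zero] at h0; simp [h0]
        · exact (ih (fun x hx => hm x (Multiset.mem_cons_of_mem hx)) h0).le
      calc _ ≤ ‖∑ i ∈ Finset.range d, r ^ i‖ * 1 := by gcongr
        _ < 1 := by rwa [mul_one]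
  have h1 := hlt G.roots h hcard
  rw [← hres, Complex.norm_intCast] at h1
  have h2 : resultant g U g.natDegree U.natDegree = 0 := by
    rw [← Int.abs_lt_one_iff]; exact_mod_cast h1
  rw [h2, Int.cast_zero, eq_comm, Multiset.prod_eq_zero_iff, Multiset.mem_map] at hres
  obtain ⟨r, hr, hr0⟩ := hres
  exact hne r hr hr0

/-- The equation gives s · U(r) = -(r^d + ∑ (a_i - s) r^i) with U the geometric sum, and for |r| ≤ 2
the right side has modulus at most 2^d (1 + dM). -/
theorem norm_geom_sum_lt_one_of_root {d : ℕ} {a : Fin d → ℤ} {s M : ℝ}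
    (hM : ∀ i, |(a i : ℝ) - s| ≤ M) (hs : 2 ^ d * (1 + d * M) < s) {r : ℂ}
    (hr : r ^ d + ∑ i : Fin d, (a i : ℂ) * r ^ (i : ℕ) = 0) (hr2 : ‖r‖ ≤ 2) :
    ‖∑ i ∈ Finset.range d, r ^ i‖ < 1 := by
  rcases Nat.eq_zero_or_pos d with rfl | hd
  · simp
  have hM0 : 0 ≤ M := (abs_nonneg _).trans (hM ⟨0, hd⟩)
  have hs0 : 0 < s := lt_of_le_of_lt (by positivity) hs
  have h1 : (s : ℂ) * ∑ i ∈ Finset.range d, r ^ i =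
      -(r ^ d + ∑ i : Fin d, ((a i : ℂ) - s) * r ^ (i : ℕ)) := by
    rw [Finset.sum_range, Finset.mul_sum]
    simp only [sub_mul, Finset.sum_sub_distrib]
    linear_combination hr
  have h2 : s * ‖∑ i ∈ Finset.range d, r ^ i‖ ≤ 2 ^ d * (1 + d * M) := by
    calc s * ‖∑ i ∈ Finset.range d, r ^ i‖ = ‖(s : ℂ) * ∑ i ∈ Finset.range d, r ^ i‖ := by
          rw [norm_mul, Complex.norm_real, Real.norm_of_nonneg hs0.le]
      _ ≤ ‖r ^ d‖ + ∑ i : Fin d, ‖((a i : ℂ) - s) * r ^ (i : ℕ)‖ := by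
          rw [h1, norm_neg]
          exact (norm_add_le _ _).trans (add_le_add le_rfl (norm_sum_le _ _))
      _ ≤ 2 ^ d + ∑ i : Fin d, M * 2 ^ d := by
          refine add_le_add ?_ (Finset.sum_le_sum fun i _ => ?_)
          · rw [norm_pow]; gcongr
          · rw [norm_mul, norm_pow]
            have h3 : ‖(a i : ℂ) - s‖ ≤ M := by
              have := hM i
              rw [← Real.norm_eq_abs, ← Complex.norm_real] at this
              simpa using this
            have h4 : ‖r‖ ^ (i : ℕ) ≤ 2 ^ d :=
              (pow_le_pow_left₀ (norm_nonneg _) hr2 _).trans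
                (pow_le_pow_right₀ (by norm_num) i.2.le)
            gcongr
      _ = _ := by simp; ring
  have h3 : s * ‖∑ i ∈ Finset.range d, r ^ i‖ < s * 1 := by linarith
  exact lt_of_mul_lt_mul_left h3 hs0.le

/-- Multiplying by r - 1 turns the equation into r^d (r + s) = r^d + s - (r - 1)f, where f = ∑ (a_i
- s) r^i. For |r| ≥ 2 one has |r - 1| ≤ 3(|r| - 1), so the last term is at most 3M|r|^d. Finally s ≤
|r|^d s/4, as d ≥ 2, and 1 + 3M ≤ s/12, which add up to s/3. -/
theorem norm_add_le_of_large_root {d : ℕ} (hd : 2 ≤ d) {a : Fin d → ℤ} {s M : ℝ}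
    (hM : ∀ i, |(a i : ℝ) - s| ≤ M) (hs : 12 + 36 * M ≤ s) {r : ℂ}
    (hr : r ^ d + ∑ i : Fin d, (a i : ℂ) * r ^ (i : ℕ) = 0) (hr2 : 2 ≤ ‖r‖) :
    ‖r + s‖ ≤ s / 3 := by
  have hM0 : 0 ≤ M := (abs_nonneg _).trans (hM ⟨0, by omega⟩)
  have hs0 : 0 < s := by linarith
  set ρ := ‖r‖
  have hρd : 4 ≤ ρ ^ d := by
    calc (4 : ℝ) = 2 ^ 2 := by norm_num
      _ ≤ ρ ^ 2 := by gcongr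
      _ ≤ ρ ^ d := pow_le_pow_right₀ (by linarith) hd
  have hρpos : 0 < ρ ^ d := by linarith
  set f := ∑ i : Fin d, ((a i : ℂ) - s) * r ^ (i : ℕ) with hf
  have h1 : r ^ d * (r + s) = r ^ d + s - (r - 1) * f := by
    have hg := geom_sum_mul r d
    rw [Finset.sum_range] at hg
    have hsplit : f = ∑ i : Fin d, (a i : ℂ) * r ^ (i : ℕ) - s * ∑ i : Fin d, r ^ (i : ℕ) := by
      rw [hf, Finset.mul_sum, ← Finset.sum_sub_distrib]
      exact Finset.sum_congr rfl fun i _ => by ring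
    rw [hsplit]
    linear_combination (r - 1) * hr - s * hg
  have hfn : ‖f‖ * (ρ - 1) ≤ M * ρ ^ d := by
    have h2 : ‖f‖ ≤ M * ∑ i ∈ Finset.range d, ρ ^ i := by
      rw [Finset.sum_range, Finset.mul_sum]
      refine (norm_sum_le _ _).trans (Finset.sum_le_sum fun i _ => ?_)
      rw [norm_mul, norm_pow]
      have h3 : ‖(a i : ℂ) - s‖ ≤ M := by
        have := hM i
        rw [← Real.norm_eq_abs, ← Complex.norm_real] at this
        simpa using this
      gcongr
    calc ‖f‖ * (ρ - 1) ≤ M * (∑ i ∈ Finset.range d, ρ ^ i) * (ρ - 1) :=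
          mul_le_mul_of_nonneg_right h2 (by linarith)
      _ = M * (ρ ^ d - 1) := by rw [mul_assoc, geom_sum_mul]
      _ ≤ M * ρ ^ d := by gcongr; linarith
  have h4 : ‖(r - 1) * f‖ ≤ 3 * (M * ρ ^ d) := by
    rw [norm_mul]
    calc _ ≤ (3 * (ρ - 1)) * ‖f‖ := by
          gcongr
          refine (norm_sub_le _ _).trans ?_
          rw [norm_one]; linarith
      _ = 3 * (‖f‖ * (ρ - 1)) := by ring
      _ ≤ _ := by gcongr
  have h5 : ρ ^ d * ‖r + s‖ ≤ ρ ^ d * (s / 3) := by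
    calc ρ ^ d * ‖r + s‖ = ‖r ^ d * (r + s)‖ := by rw [norm_mul, norm_pow]
      _ ≤ ρ ^ d + s + 3 * (M * ρ ^ d) := by
          rw [h1]
          refine (norm_sub_le _ _).trans (add_le_add ((norm_add_le _ _).trans ?_) h4)
          rw [norm_pow, Complex.norm_real, Real.norm_of_nonneg hs0.le]
      _ ≤ _ := by nlinarith
  exact le_of_mul_le_mul_left h5 hρpos

theorem neg_sum_roots_monicPoly {d : ℕ} (hd : 1 ≤ d) (a : Fin d → ℤ) :
    ((monicPoly a).map (Int.castRingHom ℂ)).roots.sum = -(a ⟨d - 1, by omega⟩ : ℂ) := by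
  obtain ⟨n, rfl⟩ : ∃ n, d = n + 1 := ⟨d - 1, by omega⟩
  rw [map_monicPoly_eq_subleadingFamily]
  have hm := monic_subleadingFamily n (extendCoeff a) (a (Fin.last n) : ℂ)
  have h := (IsAlgClosed.splits
    (subleadingFamily n (extendCoeff a) (a (Fin.last n) : ℂ))).nextCoeff_eq_neg_sum_roots_of_monic hm
  rw [nextCoeff_of_natDegree_pos (by rw [natDegree_subleadingFamily]; omega),
    natDegree_subleadingFamily, Nat.add_sub_cancel, coeff_subleadingFamily _ _ _ _ le_rfl,
    if_pos rfl] at h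
  exact neg_eq_iff_eq_neg.1 h.symm

/-- If all coefficients are close to the same large number and the polynomial does not vanish at
a nontrivial `d`-th root of unity, then it is irreducible. -/
theorem irreducible_of_coeff_near {d : ℕ} (hd : 2 ≤ d) {a : Fin d → ℤ} {s : ℝ}
    (hs : 36 * d * 2 ^ d ≤ s) (ha : ∀ i, |(a i : ℝ) - s| ≤ s / (36 * d * 2 ^ d))
    (hζ : ∀ ζ : ℂ, ∑ i ∈ Finset.range d, ζ ^ i = 0 →
      ζ ^ d + ∑ i : Fin d, (a i : ℂ) * ζ ^ (i : ℕ) ≠ 0) : Irreducible (monicPoly a) := by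
  by_contra hred
  obtain ⟨g, h, hg, hh, hgh, hg1, hh1, -⟩ := exists_factors_of_not_irreducible (by omega) hred
  -- With M = s/K ≥ 1 this K yields all the size conditions below: 12 + 36M ≤ s, 2^d (1 + dM) < s, M
  -- ≤ s/6 and 2d < s/6.
  set K : ℝ := 36 * d * 2 ^ d with hK
  have hd' : (2 : ℝ) ≤ d := by exact_mod_cast hd
  have h2d : (4 : ℝ) ≤ 2 ^ d := by
    calc (4 : ℝ) = 2 ^ 2 := by norm_num
      _ ≤ 2 ^ d := pow_le_pow_right₀ (by norm_num) hd
  have hK288 : 288 ≤ K := by nlinarith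
  have hK0 : 0 < K := by linarith
  set M := s / K with hMdef
  have hMs : M * K = s := div_mul_cancel₀ _ hK0.ne'
  have hM1 : 1 ≤ M := by rw [hMdef, one_le_div hK0]; exact hs
  set F := (monicPoly a).map (Int.castRingHom ℂ) with hF
  have hFm : F.Monic := (monic_monicPoly a).1.map _
  have hFg : F = g.map (Int.castRingHom ℂ) * h.map (Int.castRingHom ℂ) := by
    rw [hF, ← hgh, Polynomial.map_mul]
  have hroot : ∀ r ∈ F.roots, r ^ d + ∑ i : Fin d, (a i : ℂ) * r ^ (i : ℕ) = 0 := by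
    intro r hr
    rw [← eval_map_monicPoly]; exact (mem_roots'.1 hr).2
  have hcard : F.roots.card = d := by
    rw [← (IsAlgClosed.splits F).natDegree_eq_card_roots, hF, (monic_monicPoly a).1.natDegree_map,
      (monic_monicPoly a).2]
  obtain ⟨r₀, m', hm, hm'⟩ := exists_unique_large (m := F.roots) (s := s) (ρ := 2) (by norm_num)
    (fun r hr => by
      rcases le_total ‖r‖ 2 with h2 | h2
      · exact Or.inl h2
      · exact Or.inr (norm_add_le_of_large_root hd ha (by nlinarith) (hroot r hr) h2))
    (by
      rw [hF, neg_sum_roots_monicPoly (by omega)]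
      have h3 := ha ⟨d - 1, by omega⟩
      rw [← Real.norm_eq_abs, ← Complex.norm_real, ← norm_neg] at h3
      have h4 : -(a ⟨d - 1, by omega⟩ : ℂ) + s =
          -(((a ⟨d - 1, by omega⟩ : ℝ) - s : ℝ) : ℂ) := by push_cast; ring
      rw [h4]
      refine h3.trans ?_
      nlinarith)
    (by rw [hcard]; nlinarith)
  have hroots : F.roots = (g.map (Int.castRingHom ℂ)).roots + (h.map (Int.castRingHom ℂ)).roots := by
    rw [hFg, roots_mul (by rw [← hFg]; exact hFm.ne_zero)]
  -- A factor all of whose roots have modulus at most 2 shares a root with the geometric sum, where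
  -- f is assumed nonzero. One of g and h is such a factor, as r₀ is accounted for by the other.
  have key : ∀ k : ℤ[X], k.Monic → 1 ≤ k.natDegree →
      (∀ r ∈ (k.map (Int.castRingHom ℂ)).roots, r ∈ F.roots ∧ ‖r‖ ≤ 2) → False := by
    intro k hk hk1 hkr
    obtain ⟨r, hr, hr0⟩ := exists_root_geom_sum_eq_zero (d := d) hk hk1 fun r hr =>
      norm_geom_sum_lt_one_of_root ha (by nlinarith) (hroot r (hkr r hr).1) (hkr r hr).2
    exact hζ r hr0 (hroot r (hkr r hr).1)
  rw [hm] at hroots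
  have hmem : r₀ ∈ (g.map (Int.castRingHom ℂ)).roots + (h.map (Int.castRingHom ℂ)).roots := by
    rw [← hroots]; exact Multiset.mem_cons_self _ _
  rcases Multiset.mem_add.1 hmem with hr | hr
  · obtain ⟨n, hn⟩ := Multiset.exists_cons_of_mem hr
    rw [hn, Multiset.cons_add, Multiset.cons_inj_right] at hroots
    refine key h hh hh1 fun r hr => ?_
    have : r ∈ m' := by rw [hroots]; exact Multiset.mem_add.2 (Or.inr hr)
    exact ⟨by rw [hm]; exact Multiset.mem_cons_of_mem this, hm' r this⟩
  · obtain ⟨n, hn⟩ := Multiset.exists_cons_of_mem hr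
    rw [hn, Multiset.add_cons, Multiset.cons_inj_right] at hroots
    refine key g hg hg1 fun r hr => ?_
    have : r ∈ m' := by rw [hroots]; exact Multiset.mem_add.2 (Or.inl hr)
    exact ⟨by rw [hm]; exact Multiset.mem_cons_of_mem this, hm' r this⟩

/-! ### Binomial weights: atoms and deviations -/

/-- The weight of `k` under the binomial distribution `B(n, p)`. -/
def binomialWeight (n : ℕ) (p : ℝ) (k : ℕ) : ℝ := n.choose k * p ^ k * (1 - p) ^ (n - k)

theorem binomialWeight_nonneg {n : ℕ} {p : ℝ} (h0 : 0 ≤ p) (h1 : p ≤ 1) (k : ℕ) :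
    0 ≤ binomialWeight n p k := by
  have : 0 ≤ 1 - p := by linarith
  rw [binomialWeight]; positivity

theorem sum_binomialWeight (n : ℕ) (p : ℝ) :
    ∑ k ∈ Finset.range (n + 1), binomialWeight n p k = 1 := by
  have h := add_pow p (1 - p) n
  rw [add_sub_cancel, one_pow] at h
  rw [h]
  exact Finset.sum_congr rfl fun k _ => by rw [binomialWeight]; ring

theorem binomialWeight_symm {n k : ℕ} (hk : k ≤ n) (p : ℝ) :
    binomialWeight n p k = binomialWeight n (1 - p) (n - k) := by
  rw [binomialWeight, binomialWeight, Nat.choose_symm hk, Nat.sub_sub_self hk]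
  ring

theorem binomialWeight_succ {n m : ℕ} (hm : m < n) (p : ℝ) :
    binomialWeight n p (m + 1) * ((m + 1) * (1 - p)) = binomialWeight n p m * ((n - m) * p) := by
  have h1 : (n.choose (m + 1) : ℝ) * (m + 1) = n.choose m * (n - m) := by
    have := Nat.choose_succ_right_eq n m
    rw [← Nat.cast_sub hm.le]
    exact_mod_cast this
  have h2 : n - m = (n - (m + 1)) + 1 := by omega
  rw [binomialWeight, binomialWeight, h2, pow_succ (1 - p), pow_succ p]
  linear_combination p ^ m * p * (1 - p) ^ (n - (m + 1)) * (1 - p) * h1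

/-- The ratio of consecutive weights is (n-k)p / ((k+1)(1-p)). Up to J above the mean it is at least
(1-x)/(1+x), and (1-2x)(1+x) ≤ 1-x. -/
theorem mul_binomialWeight_le_succ {n k : ℕ} {p J x : ℝ} (h0 : 0 < p) (h1 : p < 1) (hx : 0 ≤ x)
    (hnp : J ≤ x * (n * p)) (hnq : J ≤ x * (n * (1 - p))) (hkn : k < n)
    (hk : (k : ℝ) + 1 ≤ n * p + J) :
    (1 - 2 * x) * binomialWeight n p k ≤ binomialWeight n p (k + 1) := by
  have hq0 : 0 < 1 - p := sub_pos.2 h1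
  have hkn' : (k : ℝ) ≤ n := by exact_mod_cast hkn.le
  have hA : (1 - 2 * x) * ((k + 1) * (1 - p)) ≤ (n - k) * p := by
    rcases le_total (1 - 2 * x) 0 with h | h
    · have t1 : (0 : ℝ) ≤ (k + 1) * (1 - p) := by positivity
      exact (mul_nonpos_of_nonpos_of_nonneg h t1).trans
        (mul_nonneg (sub_nonneg.2 hkn') h0.le)
    · set v : ℝ := n * p * (1 - p) with hv
      have hv0 : 0 ≤ v := by positivity
      have e1 : (k + 1) * (1 - p) ≤ (n * p + J) * (1 - p) :=
        mul_le_mul_of_nonneg_right hk hq0.le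
      have e2 : J * (1 - p) ≤ x * (n * p) * (1 - p) := mul_le_mul_of_nonneg_right hnp hq0.le
      have e3 : J * p ≤ x * (n * (1 - p)) * p := mul_le_mul_of_nonneg_right hnq h0.le
      have e4 : (k + 1) * (1 - p) ≤ (1 + x) * v := by
        rw [hv]; linarith
      have e5 : (1 - x) * v ≤ (n - k) * p := by
        have : (n * (1 - p) - J) * p ≤ (n - k) * p :=
          mul_le_mul_of_nonneg_right (by linarith) h0.le
        rw [hv]; linarith
      have e6 : 0 ≤ x ^ 2 * v := by positivity
      calc _ ≤ (1 - 2 * x) * ((1 + x) * v) := mul_le_mul_of_nonneg_left e4 h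
        _ ≤ (1 - x) * v := by linarith
        _ ≤ _ := e5
  have hpos : (0 : ℝ) < (k + 1) * (1 - p) := by positivity
  refine le_of_mul_le_mul_right ?_ hpos
  rw [binomialWeight_succ hkn]
  calc _ = binomialWeight n p k * ((1 - 2 * x) * ((k + 1) * (1 - p))) := by ring
    _ ≤ _ := mul_le_mul_of_nonneg_left hA (binomialWeight_nonneg h0.le h1.le _)

/-- Each of the j ≤ J steps loses at most a factor 1 - 2x with x = J/λ. By Bernoulli the total
factor is at least 1 - 2J²/λ ≥ 1/2. -/
theorem half_binomialWeight_le_add {n k J : ℕ} {p lam : ℝ} (hlam : 0 < lam) (h0 : 0 < p)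
    (h1 : p < 1) (hnp : lam ≤ n * p) (hnq : lam ≤ n * (1 - p)) (hk : (k : ℝ) ≤ n * p)
    (hJ : (J : ℝ) * J ≤ lam / 4) {j : ℕ} (hj : j ≤ J) :
    binomialWeight n p k / 2 ≤ binomialWeight n p (k + j) ∧ k + j ≤ n := by
  have hw := fun m => binomialWeight_nonneg (n := n) h0.le h1.le m
  rcases Nat.eq_zero_or_pos J with hJ0 | hJ0
  · obtain rfl : j = 0 := by omega
    have hkn : (k : ℝ) ≤ n := by linarith
    exact ⟨half_le_self (hw k), by exact_mod_cast hkn⟩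
  have h1J : (1 : ℝ) ≤ J := by exact_mod_cast hJ0
  have hJJ : (J : ℝ) ≤ J * J := le_mul_of_one_le_left (by linarith) h1J
  have hJlam : (J : ℝ) ≤ lam / 4 := hJJ.trans hJ
  set x := (J : ℝ) / lam with hx
  have hx0 : 0 ≤ x := by positivity
  have hxl : x * lam = J := div_mul_cancel₀ _ hlam.ne'
  have hJx : (J : ℝ) * x ≤ 1 / 4 := by
    rw [hx, ← mul_div_assoc, div_le_iff₀ hlam]; linarith
  have hx4 : x ≤ 1 / 4 := (le_mul_of_one_le_left hx0 h1J).trans hJx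
  have hle : ∀ i ≤ J, k + i ≤ n := by
    intro i hi
    have hi' : (i : ℝ) ≤ J := by exact_mod_cast hi
    have : ((k + i : ℕ) : ℝ) ≤ n := by push_cast; linarith
    exact_mod_cast this
  have hpow : (1 - 2 * x) ^ j * binomialWeight n p k ≤ binomialWeight n p (k + j) := by
    induction j with
    | zero => simp
    | succ j ih =>
      have hj' : (j : ℝ) + 1 ≤ J := by exact_mod_cast hj
      calc _ = (1 - 2 * x) * ((1 - 2 * x) ^ j * binomialWeight n p k) := by ring
        _ ≤ (1 - 2 * x) * binomialWeight n p (k + j) :=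
          mul_le_mul_of_nonneg_left (ih (by omega)) (by linarith)
        _ ≤ _ := by
          refine mul_binomialWeight_le_succ (J := J) h0 h1 hx0 ?_ ?_ (hle _ hj) ?_
          · exact hxl.symm.trans_le (mul_le_mul_of_nonneg_left hnp hx0)
          · exact hxl.symm.trans_le (mul_le_mul_of_nonneg_left hnq hx0)
          · push_cast; linarith
  have hbern : 1 / 2 ≤ (1 - 2 * x) ^ j := by
    have h2 := one_add_mul_le_pow (a := -(2 * x)) (by linarith) j
    have h3 : (j : ℝ) * x ≤ J * x :=
      mul_le_mul_of_nonneg_right (by exact_mod_cast hj) hx0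
    rw [← sub_eq_add_neg] at h2
    linarith
  refine ⟨?_, hle j hj⟩
  calc _ = 1 / 2 * binomialWeight n p k := by ring
    _ ≤ _ := mul_le_mul_of_nonneg_right hbern (hw k)
    _ ≤ _ := hpow

/-- With J = ⌊√λ/2⌋, the J + 1 weights from k to k + J are each at least half the weight at k, and
all weights sum to 1. Below the mean it suffices to look to the right. -/
theorem binomialWeight_le_of_le_mean {n k : ℕ} {p lam : ℝ} (hlam : 0 < lam) (h0 : 0 ≤ p)
    (h1 : p ≤ 1) (hnp : lam ≤ n * p) (hnq : lam ≤ n * (1 - p)) (hk : (k : ℝ) ≤ n * p) :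
    binomialWeight n p k ≤ 4 / √lam := by
  obtain ⟨J, hJle, hJlt⟩ : ∃ J : ℕ, (J : ℝ) ≤ √lam / 2 ∧ √lam / 2 < J + 1 :=
    ⟨⌊√lam / 2⌋₊, Nat.floor_le (by positivity), Nat.lt_floor_add_one _⟩
  have hsq : 0 < √lam := Real.sqrt_pos.2 hlam
  have hJ2 : (J : ℝ) * J ≤ lam / 4 := by
    have h2 : √lam * √lam = lam := Real.mul_self_sqrt hlam.le
    have h3 := mul_self_le_mul_self (Nat.cast_nonneg J) hJle
    linarith
  have hp0 : 0 < p := h0.lt_of_ne fun h => by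
    rw [← h, mul_zero] at hnp; linarith
  have hq0 : p < 1 := h1.lt_of_ne fun h => by
    rw [h, sub_self, mul_zero] at hnq; linarith
  have hhalf := fun (j : ℕ) (hj : j ≤ J) =>
    half_binomialWeight_le_add hlam hp0 hq0 hnp hnq hk hJ2 hj
  have hw := fun m => binomialWeight_nonneg (n := n) h0 h1 m
  have hsum : (J + 1 : ℝ) * (binomialWeight n p k / 2) ≤ 1 := by
    calc (J + 1 : ℝ) * (binomialWeight n p k / 2) =
          ∑ _j ∈ Finset.range (J + 1), binomialWeight n p k / 2 := by
          rw [Finset.sum_const, Finset.card_range, nsmul_eq_mul]; push_cast; rfl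
      _ ≤ ∑ j ∈ Finset.range (J + 1), binomialWeight n p (k + j) :=
          Finset.sum_le_sum fun j hj =>
            (hhalf j (Nat.lt_succ_iff.1 (Finset.mem_range.1 hj))).1
      _ = ∑ m ∈ (Finset.range (J + 1)).map (addLeftEmbedding k), binomialWeight n p m := by
          rw [Finset.sum_map]; rfl
      _ ≤ ∑ m ∈ Finset.range (n + 1), binomialWeight n p m := by
          refine Finset.sum_le_sum_of_subset_of_nonneg (fun m hm => ?_) fun m _ _ => hw m
          obtain ⟨j, hj, rfl⟩ := Finset.mem_map.1 hm
          exact Finset.mem_range.2 (Nat.lt_succ_iff.2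
            (hhalf j (Nat.lt_succ_iff.1 (Finset.mem_range.1 hj))).2)
      _ = 1 := sum_binomialWeight n p
  rw [le_div_iff₀ hsq]
  have h5 := mul_le_mul_of_nonneg_left hJlt.le (hw k)
  linarith

theorem binomialWeight_le {n : ℕ} {p lam : ℝ} (hlam : 0 < lam) (h0 : 0 ≤ p)
    (h1 : p ≤ 1) (hnp : lam ≤ n * p) (hnq : lam ≤ n * (1 - p)) (k : ℕ) :
    binomialWeight n p k ≤ 4 / √lam := by
  rcases Nat.lt_or_ge n k with hk | hk
  · rw [binomialWeight, Nat.choose_eq_zero_of_lt hk]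
    simp only [Nat.cast_zero, zero_mul]
    positivity
  · rcases le_total (k : ℝ) (n * p) with h | h
    · exact binomialWeight_le_of_le_mean hlam h0 h1 hnp hnq h
    · rw [binomialWeight_symm hk]
      refine binomialWeight_le_of_le_mean hlam (by linarith) (by linarith) hnq ?_ ?_
      · rwa [sub_sub_cancel]
      · rw [Nat.cast_sub hk]; linarith

/-- Chebyshev's inequality; the variance comes from the identity for Bernstein polynomials, rescaled
by n². -/
theorem sum_binomialWeight_far_le {n : ℕ} (p : unitInterval) {M : ℝ} (hM : 0 < M) :
    ∑ k ∈ (Finset.range (n + 1)).filter (fun k : ℕ => M < |(k : ℝ) - n * p|),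
      binomialWeight n p k ≤ n * p * (1 - p) / M ^ 2 := by
  have hp0 : (0 : ℝ) ≤ p := p.2.1
  have hp1 : (p : ℝ) ≤ 1 := p.2.2
  rcases Nat.eq_zero_or_pos n with rfl | hn
  · rw [Finset.sum_eq_zero]
    · simp
    · intro k hk
      rw [Finset.mem_filter, Finset.mem_range] at hk
      obtain ⟨h1, h2⟩ := hk
      obtain rfl : k = 0 := by omega
      simp at h2; linarith
  have hn' : (0 : ℝ) < n := by exact_mod_cast hn
  have hvar : ∑ k ∈ Finset.range (n + 1), ((k : ℝ) - n * p) ^ 2 * binomialWeight n p k =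
      n * p * (1 - p) := by
    have h := bernstein.variance hn.ne' p
    rw [eq_div_iff hn'.ne'] at h
    have h2 : ∑ k ∈ Finset.range (n + 1), ((k : ℝ) - n * p) ^ 2 * binomialWeight n p k =
        n ^ 2 * ∑ k : Fin (n + 1), ((p : ℝ) - bernstein.z k) ^ 2 * bernstein n k p := by
      rw [Finset.sum_range, Finset.mul_sum]
      refine Finset.sum_congr rfl fun k _ => ?_
      rw [bernstein_apply, ← mul_assoc, binomialWeight]
      congr 1
      simp only [bernstein.z]
      field_simp
      ring
    rw [h2]
    linear_combination (n : ℝ) * h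
  rw [le_div_iff₀ (by positivity), ← hvar, Finset.sum_mul]
  calc _ ≤ ∑ k ∈ (Finset.range (n + 1)).filter (fun k : ℕ => M < |(k : ℝ) - n * p|),
        ((k : ℝ) - n * p) ^ 2 * binomialWeight n p k := by
        refine Finset.sum_le_sum fun k hk => ?_
        have h1 := (Finset.mem_filter.1 hk).2
        rw [mul_comm]
        refine mul_le_mul_of_nonneg_right ?_ (binomialWeight_nonneg hp0 hp1 k)
        rw [← sq_abs ((k : ℝ) - n * p)]
        gcongr
    _ ≤ _ := Finset.sum_le_sum_of_subset_of_nonneg (Finset.filter_subset _ _) fun k _ _ =>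
        mul_nonneg (sq_nonneg _) (binomialWeight_nonneg hp0 hp1 k)

/-! ### Random variables with binomial law -/

section Law

variable {Ω : Type*} [MeasurableSpace Ω] {μ : Measure Ω} {n : ℕ} {p : unitInterval} {X : Ω → ℤ}

theorem real_eq_of_hasLaw_binomial
    (h : HasLaw X ((binomial n p).map fun k : ℕ => (k : ℤ)) μ) (k : ℕ) :
    μ.real {ω | X ω = k} = binomialWeight n p k := by
  rw [h.measureReal_eq (p := fun y => y = (k : ℤ)) (Set.to_countable _).measurableSet]
  exact map_cast_binomial_real_singleton (R := ℤ) n k p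

theorem ae_mem_range_of_hasLaw_binomial
    (h : HasLaw X ((binomial n p).map fun k : ℕ => (k : ℤ)) μ) :
    ∀ᵐ ω ∂μ, ∃ k ∈ Finset.range (n + 1), X ω = k := by
  refine (h.ae_iff (p := fun y => ∃ k ∈ Finset.range (n + 1), y = (k : ℤ))
    (measurable_of_countable _)).2 ?_
  rw [ae_map_iff (by fun_prop) (Set.to_countable _).measurableSet]
  filter_upwards [ae_le_of_hasLaw_binomial (HasLaw.id (μ := binomial n p))] with k hk
  exact ⟨k, by simpa [Nat.lt_succ_iff] using hk, rfl⟩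

theorem real_le_of_hasLaw_binomial
    (h : HasLaw X ((binomial n p).map fun k : ℕ => (k : ℤ)) μ) {lam : ℝ} (hlam : 0 < lam)
    (hnp : lam ≤ n * p) (hnq : lam ≤ n * (1 - p)) (v : ℤ) :
    μ.real {ω | X ω = v} ≤ 4 / √lam := by
  by_cases hv : ∃ k : ℕ, v = k
  · obtain ⟨k, rfl⟩ := hv
    rw [real_eq_of_hasLaw_binomial h]
    exact binomialWeight_le hlam p.2.1 p.2.2 hnp hnq k
  · have h0 : μ {ω | X ω = v} = 0 := by
      rw [← nonpos_iff_eq_zero, ← measure_empty (μ := μ)]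
      refine measure_mono_ae ?_
      filter_upwards [ae_mem_range_of_hasLaw_binomial h] with ω hω hω'
      obtain ⟨k, -, hk⟩ := hω
      exact hv ⟨k, hω'.symm.trans hk⟩
    rw [measureReal_def, h0, ENNReal.toReal_zero]
    positivity

variable [IsProbabilityMeasure μ]

theorem real_far_le_of_hasLaw_binomial
    (h : HasLaw X ((binomial n p).map fun k : ℕ => (k : ℤ)) μ) {M : ℝ} (hM : 0 < M) :
    μ.real {ω | M < |(X ω : ℝ) - n * p|} ≤ n * p * (1 - p) / M ^ 2 := by
  set s := (Finset.range (n + 1)).filter (fun k : ℕ => M < |(k : ℝ) - n * p|)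
  calc _ ≤ μ.real (⋃ k ∈ s, {ω | X ω = (k : ℤ)}) := by
        refine ENNReal.toReal_mono (measure_ne_top _ _) (measure_mono_ae ?_)
        filter_upwards [ae_mem_range_of_hasLaw_binomial h] with ω hω hω'
        obtain ⟨k, hk, hXk⟩ := hω
        refine Set.mem_iUnion₂.2 ⟨k, Finset.mem_filter.2 ⟨hk, ?_⟩, hXk⟩
        have h2 : M < |(X ω : ℝ) - n * p| := hω'
        rw [hXk] at h2
        simpa using h2
    _ ≤ ∑ k ∈ s, μ.real {ω | X ω = (k : ℤ)} := measureReal_biUnion_finset_le _ _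
    _ = ∑ k ∈ s, binomialWeight n p k :=
        Finset.sum_congr rfl fun k _ => real_eq_of_hasLaw_binomial h k
    _ ≤ _ := sum_binomialWeight_far_le p hM

/-- If `X` is independent of `Y` and has small atoms, then a relation that determines `X` from `Y`
is unlikely. -/
theorem real_rel_le_of_indepFun {E : Type*} [Countable E] [MeasurableSpace E]
    [MeasurableSingletonClass E] {Y : Ω → E} (hX : AEMeasurable X μ) (hY : AEMeasurable Y μ)
    (hXY : IndepFun X Y μ) {β : ℝ} (hβ : ∀ v, μ.real {ω | X ω = v} ≤ β) {R : ℤ → E → Prop}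
    (hR : ∀ x x' y, R x y → R x' y → x = x') : μ.real {ω | R (X ω) (Y ω)} ≤ β := by
  have hβ0 : 0 ≤ β := measureReal_nonneg.trans (hβ 0)
  have hlaw := (indepFun_iff_map_prod_eq_prod_map_map hX hY).1 hXY
  have hset : MeasurableSet {z : ℤ × E | R z.1 z.2} := (Set.to_countable _).measurableSet
  have := Measure.isProbabilityMeasure_map hX (μ := μ)
  have := Measure.isProbabilityMeasure_map hY (μ := μ)
  have h1 : μ {ω | R (X ω) (Y ω)} = (μ.map fun ω => (X ω, Y ω)) {z | R z.1 z.2} := by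
    rw [Measure.map_apply_of_aemeasurable (hX.prodMk hY) hset]
    rfl
  -- By Fubini it suffices to bound each section at fixed y, which is empty or a single atom of X.
  rw [measureReal_def, h1, hlaw, Measure.prod_apply_symm hset]
  refine ENNReal.toReal_le_of_le_ofReal hβ0 ?_
  calc _ ≤ ∫⁻ _y, ENNReal.ofReal β ∂(μ.map Y) := by
        refine lintegral_mono fun y => ?_
        by_cases hy : ∃ x, R x y
        · obtain ⟨x, hx⟩ := hy
          have h2 : (fun x => (x, y)) ⁻¹' {z : ℤ × E | R z.1 z.2} ⊆ {x} :=
            fun x' hx' => hR x' x y hx' hx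
          refine (measure_mono h2).trans ?_
          rw [Measure.map_apply_of_aemeasurable hX (measurableSet_singleton x),
            ENNReal.le_ofReal_iff_toReal_le (measure_ne_top _ _) hβ0]
          exact hβ x
        · have h2 : (fun x => (x, y)) ⁻¹' {z : ℤ × E | R z.1 z.2} = ∅ := by
            ext x; simp only [Set.mem_preimage, Set.mem_empty_iff_false, iff_false]
            exact fun hx => hy ⟨x, hx⟩
          rw [h2]; simp
    _ = _ := by rw [lintegral_const]; simp

end Law

/-- Vanishing at ζ determines a_0 from the other coefficients, of which it is independent, so the
probability is at most the largest atom of a_0. -/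
theorem IsBinomialModel.real_vanish_le {Ω : Type*} [MeasurableSpace Ω] {μ : Measure Ω}
    [IsProbabilityMeasure μ] {H : ℕ} {p : unitInterval} {d : ℕ} [NeZero d] {a : Fin d → Ω → ℤ}
    (h : IsBinomialModel μ H p d a) {lam : ℝ} (hlam : 0 < lam)
    (hnp : lam ≤ H * p) (hnq : lam ≤ H * (1 - p)) (ζ : ℂ) :
    μ.real {ω | ζ ^ d + ∑ i : Fin d, (a i ω : ℂ) * ζ ^ (i : ℕ) = 0} ≤ 4 / √lam := by
  classical
  have hae : ∀ i, AEMeasurable (a i) μ := fun i => (h.law i).aemeasurable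
  have h1 := h.indep.indepFun_finset₀ {0} {0}ᶜ disjoint_compl_right hae
  have hm1 : Measurable fun x : ({0} : Finset (Fin d)) → ℤ =>
      x ⟨0, Finset.mem_singleton_self 0⟩ := measurable_pi_apply _
  have h2 : IndepFun (a 0) (fun ω (i : ({0}ᶜ : Finset (Fin d))) => a i ω) μ :=
    h1.comp hm1 measurable_id
  have hY : AEMeasurable (fun ω (i : ({0}ᶜ : Finset (Fin d))) => a i ω) μ :=
    aemeasurable_pi_lambda _ fun i => hae i
  have h3 := real_rel_le_of_indepFun (hae 0) hY h2
    (real_le_of_hasLaw_binomial (h.law 0) hlam hnp hnq)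
    (R := fun x y => ζ ^ d + ((x : ℂ) + ∑ i : ({0}ᶜ : Finset (Fin d)),
      (y i : ℂ) * ζ ^ ((i : Fin d) : ℕ)) = 0) (by
        intro x x' y hx hx'
        have : (x : ℂ) = x' := by linear_combination hx - hx'
        exact_mod_cast this)
  convert h3 using 3
  ext ω
  congr! 2
  rw [Finset.sum_coe_sort ({0}ᶜ : Finset (Fin d)) (fun i => (a i ω : ℂ) * ζ ^ (i : ℕ)),
    Fintype.sum_eq_add_sum_compl 0 (fun i => (a i ω : ℂ) * ζ ^ (i : ℕ))]
  simp

/-- If no coefficient is farther than s/K from s = Hp and f vanishes at none of the at most d roots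
of 1 + x + ... + x^(d-1), then f is irreducible. The first kind of failure is bounded by Chebyshev,
the second by the atom bound. -/
theorem exists_binomial_bound (d : ℕ) [NeZero d] : ∃ ε : ℝ → ℝ, Tendsto ε atTop (𝓝 0) ∧
      ∀ (H : ℕ) (p : unitInterval)
        (Ω : Type*) [MeasurableSpace Ω] (μ : Measure Ω) [IsProbabilityMeasure μ]
        (a : Fin d → Ω → ℤ), IsBinomialModel μ H p d a →
        1 - ε (min (H * (p : ℝ)) (H * (1 - (p : ℝ)))) ≤ probIrreducible μ a := by
  classical
  set K : ℝ := 36 * d * 2 ^ d with hK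
  have hd1 : (1 : ℝ) ≤ d := by exact_mod_cast NeZero.one_le
  have hK1 : 1 ≤ K := by
    have h2d : (1 : ℝ) ≤ 2 ^ d := one_le_pow₀ (by norm_num)
    nlinarith
  set Cd : ℝ := d * K ^ 2 + d * 4
  -- Below K the deterministic criterion is unavailable and the bound is made trivial. In Cd, d·K²
  -- comes from the deviations and d·4 from the roots of unity.
  refine ⟨fun x => if x < K then 1 else Cd / √x, ?_, ?_⟩
  · have h1 : Tendsto (fun x : ℝ => Cd / √x) atTop (𝓝 0) :=
      Real.tendsto_sqrt_atTop.const_div_atTop Cd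
    refine h1.congr' ?_
    filter_upwards [eventually_ge_atTop K] with x hx
    rw [if_neg (not_lt.2 hx)]
  intro H p Ω _ μ _ a h
  set lam := min (H * (p : ℝ)) (H * (1 - (p : ℝ))) with hlam
  refine le_trans ?_ (one_sub_real_le_probIrreducible μ a)
  have hbad1 : μ.real {ω | ¬ Irreducible (monicPoly fun i => a i ω)} ≤ 1 := measureReal_le_one
  simp only
  split_ifs with hx
  · linarith
  rw [not_lt] at hx
  have hlam0 : 0 < lam := by linarith
  have hnp : lam ≤ H * p := min_le_left _ _
  have hnq : lam ≤ H * (1 - p) := min_le_right _ _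
  have hε : 0 ≤ Cd / √lam := by positivity
  rcases Nat.lt_or_ge d 2 with hd | hd
  · obtain rfl : d = 1 := by have := NeZero.ne d; omega
    have : {ω | ¬ Irreducible (monicPoly fun i => a i ω)} = ∅ := by
      ext ω; simpa using irreducible_monicPoly_one _
    rw [this, measureReal_empty]
    linarith
  set U : ℂ[X] := ∑ i ∈ Finset.range d, X ^ i with hU
  have hUe : ∀ ζ : ℂ, U.eval ζ = ∑ i ∈ Finset.range d, ζ ^ i := by
    intro ζ; simp [hU, eval_finsetSum]
  have hU0 : U ≠ 0 := by
    intro h0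
    have := hUe 1
    rw [h0] at this
    simp only [eval_zero, one_pow, Finset.sum_const, Finset.card_range, nsmul_eq_mul,
      mul_one] at this
    exact NeZero.ne d (by exact_mod_cast this.symm)
  have hUdeg : U.natDegree ≤ d := by
    refine natDegree_sum_le_of_forall_le _ _ fun i hi => ?_
    rw [natDegree_X_pow]
    exact (Finset.mem_range.1 hi).le
  set s : ℝ := H * p with hs
  have hsK : K ≤ s := hx.trans hnp
  have hM : 0 < s / K := div_pos (by linarith) (by linarith)
  have hsub : {ω | ¬ Irreducible (monicPoly fun i => a i ω)} ⊆
      (⋃ i ∈ (Finset.univ : Finset (Fin d)), {ω | s / K < |(a i ω : ℝ) - H * p|}) ∪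
      ⋃ ζ ∈ U.roots.toFinset, {ω | ζ ^ d + ∑ i : Fin d, (a i ω : ℂ) * ζ ^ (i : ℕ) = 0} := by
    intro ω hω
    by_contra hn
    simp only [Set.mem_union, Set.mem_iUnion, not_or, not_exists, Set.mem_ofPred_eq,
      not_lt] at hn
    refine hω (irreducible_of_coeff_near hd hsK (fun i => hn.1 i (Finset.mem_univ i)) ?_)
    intro ζ hζ
    refine hn.2 ζ ?_
    rw [Multiset.mem_toFinset, mem_roots hU0, IsRoot.def, hUe, hζ]
  have hfar : ∀ i, μ.real {ω | s / K < |(a i ω : ℝ) - H * p|} ≤ K ^ 2 / √lam := by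
    intro i
    refine (real_far_le_of_hasLaw_binomial (h.law i) hM).trans ?_
    have hs0 : 0 < s := by linarith
    have hp0 : (0 : ℝ) ≤ p := p.2.1
    have e1 : (H : ℝ) * p * (1 - (p : ℝ)) / (s / K) ^ 2 = K ^ 2 * (1 - (p : ℝ)) / s := by
      rw [← hs]; field_simp
    have hlam1 : 1 ≤ lam := by linarith
    -- Since λ ≥ 1, √λ ≤ λ ≤ s; Chebyshev's 1/s is weakened to the rate 1/√λ of the atoms.
    have e2 : √lam ≤ s := (Real.sqrt_le_left (by linarith) |>.2 (by nlinarith)).trans hnp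
    rw [e1]
    have hsq : 0 < √lam := Real.sqrt_pos.2 hlam0
    calc K ^ 2 * (1 - (p : ℝ)) / s ≤ K ^ 2 / s := by
          gcongr
          exact mul_le_of_le_one_right (by positivity) (by linarith)
      _ ≤ _ := by gcongr
  have hbad : μ.real {ω | ¬ Irreducible (monicPoly fun i => a i ω)} ≤ Cd / √lam := by
    calc _ ≤ _ := measureReal_mono hsub
      _ ≤ ∑ _i : Fin d, K ^ 2 / √lam + ∑ _ζ ∈ U.roots.toFinset, 4 / √lam := by
        refine (measureReal_union_le _ _).trans (add_le_add ?_ ?_)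
        · exact (measureReal_biUnion_finset_le _ _).trans (Finset.sum_le_sum fun i _ => hfar i)
        · exact (measureReal_biUnion_finset_le _ _).trans (Finset.sum_le_sum fun ζ _ =>
            h.real_vanish_le hlam0 hnp hnq ζ)
      _ ≤ d * (K ^ 2 / √lam) + d * (4 / √lam) := by
        simp only [Finset.sum_const, Finset.card_univ, Fintype.card_fin, nsmul_eq_mul]
        have : (U.roots.toFinset.card : ℝ) ≤ d := by
          exact_mod_cast (Multiset.toFinset_card_le _).trans ((card_roots' _).trans hUdeg)
        gcongr
      _ = _ := by ring
  linarith

end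

theorem theorem1p1 :
    (∀ P : ℤ[X], P ≠ 0 → ∃ c : ℝ, ∀ (d H : ℕ) [NeZero d], 3 ≤ H →
      ∀ (Ω : Type*) [MeasurableSpace Ω] (μ : Measure Ω) [IsProbabilityMeasure μ]
        (a : Fin d → Ω → ℤ), IsSparseModel μ P H d a →
        1 - (P.natDegree : ℝ) / (2 * H + 1) - 2 * d * 2 ^ d * Real.log H ^ c / H
          ≤ probIrreducible μ a) ∧
    (∀ (d : ℕ) [NeZero d], ∃ ε : ℝ → ℝ, Tendsto ε atTop (𝓝 0) ∧
      ∀ (H : ℕ) (p : unitInterval)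
        (Ω : Type*) [MeasurableSpace Ω] (μ : Measure Ω) [IsProbabilityMeasure μ]
        (a : Fin d → Ω → ℤ), IsBinomialModel μ H p d a →
        1 - ε (min (H * (p : ℝ)) (H * (1 - (p : ℝ)))) ≤ probIrreducible μ a) ∧
    (∀ P : ℤ[X], P ≠ 0 → ∃ c : ℝ, ∀ (d H L : ℕ) [NeZero d], 3 ≤ H →
      ∀ (Ω : Type*) [MeasurableSpace Ω] (μ : Measure Ω) [IsProbabilityMeasure μ]
        (a : Fin d → Ω → ℤ) (t : {i : Fin d // i ≠ 0} → Ω → ℝ)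
        (Q : ∀ i : {i : Fin d // i ≠ 0}, StepPoly i.1),
        IsDependentModel μ P H L d a t Q →
        1 - (P.natDegree : ℝ) / (2 * H + 1)
            - 2 * d ^ 2 * (2 * L) ^ d * Real.log H ^ c / H
          ≤ probIrreducible μ a) := by
  refine ⟨fun P hP => ?_, fun d _ => exists_binomial_bound d, fun P hP => ?_⟩
  · obtain ⟨c, hc⟩ := exists_dependent_bound hP
    refine ⟨c, fun d H _ hH Ω _ μ _ a h => ?_⟩
    have := hc d H 1 hH Ω μ a _ _ h.isDependentModel
    simpa using this
  · obtain ⟨c, hc⟩ := exists_dependent_bound hP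
    refine ⟨c, fun d H L _ hH Ω _ μ _ a t Q h => ?_⟩
    -- The bound with d is stronger than the required one with d².
    refine le_trans ?_ (hc d H L hH Ω μ a t Q h)
    have hd : (1 : ℝ) ≤ d := by exact_mod_cast NeZero.one_le
    have hlog : 0 ≤ Real.log H ^ c :=
      Real.rpow_nonneg (Real.log_natCast_nonneg H) c
    have hd2 : (d : ℝ) ≤ d ^ 2 := le_self_pow₀ hd two_ne_zero
    gcongr
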